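/- Let $\mathfrak g=\mathfrak{sl}(2,\mathbb R)$ with basis $H=\begin{pmatrix}1&0\\0&-1\end{pmatrix}$, $X=\begin{pmatrix}0&1\\0&0\end{pmatrix}$, $Y=\begin{pmatrix}0&0\\1&0\end{pmatrix}$ and dual coordinates $(h,x,y)$, so that $(h,x,y)$ denotes the matrix $\begin{pmatrix}h&x\\y&-h\end{pmatrix}$. Let $\mathcal N=\{h^2+xy=0\}$ be the nilpotent cone, $\mathcal N^+=\{h^2+xy=0,\ x-y>0\}$, and $\square=\frac12\partial_H^2+2\,\partial_Y\partial_X$. *Generalized functions.* For $U\subset\mathfrak g$ open and $(V,\rho)$ a finite-dimensional real representation of $\mathfrak g$, a $V$-valued generalized function on $U$ is a continuous linear map $\phi$ from the compactly supported smooth densities $f\,dZ$ on $U$ ($dZ=dx\,dy\,dh$) to $V$. It is locally invariant if $(\rho(Z)+\mathcal L_Z)\phi=0$ for all $Z\in\mathfrak g$, where $\mathcal L_Z$ is the differential operator $(\mathcal L_Z\phi)(W)=\frac{d}{dt}\phi(W-t[Z,W])|_{t=0}$. Let $\mathcal S_V(U)$ be the space of locally invariant $V$-valued generalized functions $\phi$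 on $U$ with $\phi|_{U\setminus\mathcal N}=0$. *The measure $\delta_{\mathcal N^+}$.* Let $V_1=\mathbb R^2$ be the standard representation with basis $e=(1,0)$, $f=(0,1)$ and symplectic form $B$, $B(e,f)=1$. Let $\mu_1:V_1\to\mathfrak g$ be given by $\operatorname{tr}(\mu_1(v)Z)=\frac12B(v,Zv)$ for all $Z\in\mathfrak g$. Let $\delta_{\mathcal N^+}$ be defined by $\int\delta_{\mathcal N^+}(Z)g(Z)\,dZ=\int_{V_1}g(\mu_1(v))\,dv$, where $dv$ is twice the Lebesgue measure on $\mathbb R^2$. *The neighborhood.* Let $\mathcal V\subset SL(2,\mathbb R)$ be a connected open set containing the identity, let $\Delta\subset\mathbb R$ be an open interval containing $0$, and let $$U=\{\operatorname{Ad}(g)(X+yY)\ :\ g\in\mathcal V,\ y\in\Delta\},$$ a connected open neighborhood of $X$. *The representation $V_n$ and the function $s_n$.* Let $n\in\mathbb N$ and let $V_n$ be the irreducible representation of $\mathfrak g$ of dimension $n+1$. - If $n$ is even, identify $V_n$ with the subrepresentation of $S^{n/2}(\mathfrak g)$ (adjoint action) generated by $X^{n/2}$, and put $s_n(Z)=Z^{n/2}\in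 V_n$ for $Z\in\mathcal N$. - If $n$ is odd, identify $V_n$ with the subrepresentation of $V_1\otimes S^{(n-1)/2}(\mathfrak g)$ generated by $e\otimes X^{(n-1)/2}$; assume that there is a continuous map $s_1:U\cap\mathcal N^+\to V_1$ with $\mu_1(s_1(Z))=Z$ for all $Z$ and $s_1(X)=\sqrt2\,e$, and put $s_n(Z)=s_1(Z)\otimes Z^{(n-1)/2}\in V_n$ for $Z\in U\cap\mathcal N^+$. Let $s_n\delta_{\mathcal N^+}$ be the $V_n$-valued generalized function $f\,dZ\mapsto\int f(Z)\,s_n(Z)\,\delta_{\mathcal N^+}(Z)\,dZ$ on $U$. **Theorem.** Write $\mathcal S_n(U)=\mathcal S_{V_n}(U)$. 1. If $n$ is even, $\mathcal S_n(U)$ is infinite dimensional, with basis $\big(\square^k(s_n\delta_{\mathcal N^+})\big)_{k\in\mathbb N}$. 2. If $n$ is odd, $\dim\mathcal S_n(U)=\frac{n+1}2$, with basis $\big(\square^k(s_n\delta_{\mathcal N^+})\big)_{0\le k\le\frac{n-1}2}$. -/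

import Mathlib

open MeasureTheory TopologicalSpace
open scoped Distributions LineDeriv Matrix TensorProduct

noncomputable section

namespace SlTwo

/-! ### The Lie algebra `sl(2, ℝ)`, its coordinates, the nilpotent cone -/

/-- The Lie algebra `sl(2, ℝ)` of real `2 × 2` matrices of trace zero. -/
abbrev Sl : Type := LieAlgebra.SpecialLinear.sl (Fin 2) ℝ

theorem mem_sl_iff (M : Matrix (Fin 2) (Fin 2) ℝ) :
    M ∈ LieAlgebra.SpecialLinear.sl (Fin 2) ℝ ↔ M 0 0 + M 1 1 = 0 := by
  have h : M ∈ LieAlgebra.SpecialLinear.sl (Fin 2) ℝ ↔ M.trace = 0 := Iff.rfl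
  rw [h, Matrix.trace_fin_two]

/-- The linear coordinates `(h, x, y)` on `sl(2, ℝ)`: the triple `p = (h, x, y)` is the matrix with
rows `(h, x)` and `(y, -h)`. Analysis on `sl(2, ℝ)` is carried out in these coordinates. -/
def ofCoords : (Fin 3 → ℝ) ≃ₗ[ℝ] Sl where
  toFun p := ⟨!![p 0, p 1; p 2, -p 0], (mem_sl_iff _).2 (by simp)⟩
  invFun Z := ![Z.1 0 0, Z.1 0 1, Z.1 1 0]
  map_add' p q := by
    apply Subtype.ext
    change !![(p + q) 0, (p + q) 1; (p + q) 2, -(p + q) 0] =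
      !![p 0, p 1; p 2, -p 0] + !![q 0, q 1; q 2, -q 0]
    simp [add_comm]
  map_smul' c p := by
    apply Subtype.ext
    change !![(c • p) 0, (c • p) 1; (c • p) 2, -(c • p) 0] = c • !![p 0, p 1; p 2, -p 0]
    simp
  left_inv p := by
    funext i
    fin_cases i <;> rfl
  right_inv Z := by
    have h : Z.1 0 0 + Z.1 1 1 = 0 := (mem_sl_iff _).1 Z.2
    apply Subtype.ext
    change !![Z.1 0 0, Z.1 0 1; Z.1 1 0, -Z.1 0 0] = Z.1
    rw [Matrix.eta_fin_two Z.1]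
    simp
    linarith

theorem coe_ofCoords (p : Fin 3 → ℝ) :
    (ofCoords p : Matrix (Fin 2) (Fin 2) ℝ) = !![p 0, p 1; p 2, -p 0] := rfl

/-- Coordinates of `H`, the diagonal matrix with entries `1, -1`. -/
def cH : Fin 3 → ℝ := ![1, 0, 0]

/-- Coordinates of `X`, the matrix with rows `(0, 1)` and `(0, 0)`. -/
def cX : Fin 3 → ℝ := ![0, 1, 0]

/-- Coordinates of `Y`, the matrix with rows `(0, 0)` and `(1, 0)`. -/
def cY : Fin 3 → ℝ := ![0, 0, 1]

/-- The nilpotent cone, `h ^ 2 + x * y = 0`. -/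
def nilCone : Set (Fin 3 → ℝ) := {p | p 0 ^ 2 + p 1 * p 2 = 0}

/-- The upper half cone `N⁺`: `h ^ 2 + x * y = 0` and `x - y > 0`. -/
def nilConePlus : Set (Fin 3 → ℝ) := {p | p 0 ^ 2 + p 1 * p 2 = 0 ∧ 0 < p 1 - p 2}

theorem mem_nilCone_iff (p : Fin 3 → ℝ) : p ∈ nilCone ↔ IsNilpotent (ofCoords p).1 := by
  constructor
  · intro hp
    refine ⟨2, ?_⟩
    have hp' : p 0 ^ 2 + p 1 * p 2 = 0 := hp
    rw [coe_ofCoords, pow_two, Matrix.mul_fin_two]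
    ext i j
    fin_cases i <;> fin_cases j <;> simp <;> linarith
  · intro hp
    obtain ⟨k, hk⟩ := hp
    have h : (ofCoords p : Matrix (Fin 2) (Fin 2) ℝ).det = 0 := by
      have h1 := congrArg Matrix.det hk
      rw [Matrix.det_pow, Matrix.det_zero] at h1
      exact eq_zero_of_pow_eq_zero h1
    rw [coe_ofCoords, Matrix.det_fin_two_of] at h
    change p 0 ^ 2 + p 1 * p 2 = 0
    linarith

/-- The set `π(𝒱 × Δ)`, `π(g, X + y Y) = Ad(g)(X + y Y)`, in coordinates. -/
def adTube (𝒱 : Set (Matrix.SpecialLinearGroup (Fin 2) ℝ)) (Δ : Set ℝ) : Set (Fin 3 → ℝ) :=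
  {p | ∃ g ∈ 𝒱, ∃ y ∈ Δ,
    (ofCoords p).1 = (g : Matrix (Fin 2) (Fin 2) ℝ) * (ofCoords (cX + y • cY)).1 *
      ((g⁻¹ : Matrix.SpecialLinearGroup (Fin 2) ℝ) : Matrix (Fin 2) (Fin 2) ℝ)}

/-! ### Generalized functions

A generalized function on `U` with values in `V` is a continuous linear map from the compactly
supported smooth densities on `U` to `V`. Densities are written `f dZ`, with `dZ = dx dy dh` and `f`
a test function, so that this is the space `𝓓'(U, V)` of `V`-valued distributions. -/

variable {U : Opens (Fin 3 → ℝ)}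

/-- `ℒ_Z` on test functions: `(ℒ_Z f)(p) = d/dt f(p - t [Z, p])` at `t = 0`. -/
def lieDeriv (Z : Sl) (f : 𝓓(U, ℝ)) : 𝓓(U, ℝ) where
  toFun p := fderiv ℝ f p (-ofCoords.symm ⁅Z, ofCoords p⁆)
  contDiff' := by
    have h1 : ContDiff ℝ ((⊤ : ℕ∞) : WithTop ℕ∞) (fun p => fderiv ℝ f p) :=
      f.contDiff.fderiv_right (by simp)
    have h2 : ContDiff ℝ ((⊤ : ℕ∞) : WithTop ℕ∞)
        (fun p : Fin 3 → ℝ => -ofCoords.symm ⁅Z, ofCoords p⁆) :=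
      (LinearMap.toContinuousLinearMap
        (-(ofCoords.symm.toLinearMap ∘ₗ (LieAlgebra.ad ℝ Sl Z) ∘ₗ ofCoords.toLinearMap))).contDiff
    exact h1.clm_apply h2
  hasCompactSupport' := by
    refine (f.hasCompactSupport.fderiv ℝ).mono ?_
    intro p hp hq
    exact hp (by simp [hq])
  tsupport_subset' := by
    refine (closure_mono ?_).trans ((tsupport_fderiv_subset ℝ).trans f.tsupport_subset)
    intro p hp hq
    exact hp (by simp [hq])

theorem hasDerivAt_lieDeriv (Z : Sl) (f : 𝓓(U, ℝ)) (p : Fin 3 → ℝ) :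
    HasDerivAt (fun t : ℝ => f (p - t • ofCoords.symm ⁅Z, ofCoords p⁆)) (lieDeriv Z f p) 0 := by
  have hf : HasFDerivAt f (fderiv ℝ f p) (p - (0 : ℝ) • ofCoords.symm ⁅Z, ofCoords p⁆) := by
    simpa using (f.contDiff.differentiable (by simp) p).hasFDerivAt
  have hl : HasDerivAt (fun t : ℝ => p - t • ofCoords.symm ⁅Z, ofCoords p⁆)
      (-ofCoords.symm ⁅Z, ofCoords p⁆) 0 := by
    simpa using ((hasDerivAt_id (0 : ℝ)).smul_const (ofCoords.symm ⁅Z, ofCoords p⁆)).const_sub p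
  exact hf.comp_hasDerivAt 0 hl

section Values

variable {V : Type*} [NormedAddCommGroup V] [NormedSpace ℝ V]

/-- The Casimir operator `□ = (1/2) ∂_H² + 2 ∂_Y ∂_X`. -/
def casimir (T : 𝓓'(U, V)) : 𝓓'(U, V) :=
  (1 / 2 : ℝ) • ∂_{cH} (∂_{cH} T) + (2 : ℝ) • ∂_{cY} (∂_{cX} T)

variable [LieRingModule Sl V] [LieModule ℝ Sl V]

/-- `T` is locally invariant: `(ρ(Z) + ℒ_Z) T = 0` for all `Z`. The vector field of `ℒ_Z` is
divergence free (`ad Z` has trace zero), so `ℒ_Z` acts on generalized functions as the negative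
transpose of `ℒ_Z` on test functions: `(ℒ_Z T)(f) = -T (ℒ_Z f)`. -/
def IsLocallyInvariant (T : 𝓓'(U, V)) : Prop :=
  ∀ (Z : Sl) (f : 𝓓(U, ℝ)), ⁅Z, T f⁆ + -T (lieDeriv Z f) = 0

variable (U V) in
/-- The space `S(U)` of locally invariant `V`-valued generalized functions on `U` whose restriction
to `U \ N` is zero. -/
def invariantsOnCone : Submodule ℝ 𝓓'(U, V) where
  carrier := {T | IsLocallyInvariant T ∧
    Distribution.IsVanishingOn T ((U : Set (Fin 3 → ℝ)) \ nilCone)}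
  zero_mem' := by
    refine ⟨fun Z f => ?_, fun f _ => rfl⟩
    change ⁅Z, (0 : V)⁆ + -(0 : V) = 0
    simp
  add_mem' := by
    rintro S T ⟨hS, hS'⟩ ⟨hT, hT'⟩
    refine ⟨fun Z f => ?_, fun f hf => ?_⟩
    · change ⁅Z, S f + T f⁆ + -(S (lieDeriv Z f) + T (lieDeriv Z f)) = 0
      have h1 := hS Z f
      have h2 := hT Z f
      rw [lie_add, neg_add, add_add_add_comm, h1, h2, add_zero]
    · change S f + T f = 0
      rw [hS' f hf, hT' f hf, add_zero]
  smul_mem' := by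
    rintro c T ⟨hT, hT'⟩
    refine ⟨fun Z f => ?_, fun f hf => ?_⟩
    · change ⁅Z, c • T f⁆ + -(c • T (lieDeriv Z f)) = 0
      rw [lie_smul, ← smul_neg, ← smul_add, hT Z f, smul_zero]
    · change c • T f = 0
      rw [hT' f hf, smul_zero]

end Values

/-! ### The moment map and the measure `δ_{N⁺}(Z) dZ` -/

/-- The moment map `μ₁ : V₁ = ℝ² → sl(2, ℝ)`, in coordinates. -/
def moment (v : Fin 2 → ℝ) : Fin 3 → ℝ := ![-(v 0 * v 1) / 2, v 0 ^ 2 / 2, -v 1 ^ 2 / 2]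

/-- The symplectic form on `ℝ²` with `B(e, f) = 1`. -/
def symp (v w : Fin 2 → ℝ) : ℝ := v 0 * w 1 - v 1 * w 0

/-- `μ₁(v)` is the unique element of `sl(2, ℝ)` with `tr(μ₁(v) Z) = (1/2) B(v, Z v)`. -/
theorem eq_moment_iff (v : Fin 2 → ℝ) (p : Fin 3 → ℝ) :
    p = moment v ↔ ∀ Z : Sl, ((ofCoords p).1 * Z.1).trace = 1 / 2 * symp v (Z.1 *ᵥ v) := by
  constructor
  · rintro rfl Z
    obtain ⟨q, rfl⟩ := ofCoords.surjective Z
    simp [coe_ofCoords, moment, symp, Matrix.trace_fin_two, Matrix.mulVec,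
      dotProduct, Fin.sum_univ_two]
    ring
  · intro h
    have hH := h (ofCoords cH)
    have hX := h (ofCoords cX)
    have hY := h (ofCoords cY)
    simp [coe_ofCoords, cH, cX, cY, symp, Matrix.trace_fin_two, Matrix.mulVec,
      dotProduct, Fin.sum_univ_two] at hH hX hY
    ext i
    fin_cases i <;> simp [moment] <;> linarith

/-- The measure `δ_{N⁺}(Z) dZ`: the image under `μ₁` of the invariant measure `dv = 2 de* df*` on
`ℝ²`, so that `∫ δ_{N⁺}(Z) g(Z) dZ = ∫ g(μ₁(v)) dv`. -/
def diracPlus : Measure (Fin 3 → ℝ) := Measure.map moment ((2 : ENNReal) • volume)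

/-- The product `s δ_{N⁺}` of a `V`-valued function `s` and `δ_{N⁺}`, as a generalized function on
`U`: `f ↦ ∫ f(Z) s(Z) δ_{N⁺}(Z) dZ` (meaningful when `s` is locally integrable on `U` for
`δ_{N⁺}(Z) dZ`; only the values of `s` on `U ∩ N⁺` matter). -/
def mulDiracPlus {V : Type*} [NormedAddCommGroup V] [NormedSpace ℝ V]
    (U : Opens (Fin 3 → ℝ)) (s : (Fin 3 → ℝ) → V) : 𝓓'(U, V) :=
  (TestFunction.integralAgainstBilinCLM (ContinuousLinearMap.lsmul ℝ ℝ) diracPlus s :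
    𝓓(U, ℝ) →L[ℝ] V)

/-! ### The symmetric algebra of a Lie algebra as a Lie module -/

section Sym

variable {L : Type*} [LieRing L] [LieAlgebra ℝ L]

/-- The algebra map `S(L) → S(L)[ε]`, `w ↦ w + ε [Z, w]` for `w ∈ L`. -/
def symDual (Z : L) : SymmetricAlgebra ℝ L →ₐ[ℝ]
    TrivSqZeroExt (SymmetricAlgebra ℝ L) (SymmetricAlgebra ℝ L) :=
  SymmetricAlgebra.lift
    ((TrivSqZeroExt.inlAlgHom ℝ (SymmetricAlgebra ℝ L) (SymmetricAlgebra ℝ L)).toLinearMap ∘ₗ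
        SymmetricAlgebra.ι ℝ L +
      ((TrivSqZeroExt.inrHom (SymmetricAlgebra ℝ L) (SymmetricAlgebra ℝ L)).restrictScalars ℝ) ∘ₗ
        SymmetricAlgebra.ι ℝ L ∘ₗ (LieAlgebra.ad ℝ L Z : L →ₗ[ℝ] L))

theorem fst_symDual (Z : L) (p : SymmetricAlgebra ℝ L) : (symDual Z p).fst = p := by
  have h : (TrivSqZeroExt.fstHom ℝ (SymmetricAlgebra ℝ L) (SymmetricAlgebra ℝ L)).comp
      (symDual Z) = AlgHom.id ℝ _ := by
    apply SymmetricAlgebra.algHom_ext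
    ext w
    simp [symDual]
  exact DFunLike.congr_fun h p

/-- The adjoint action of `Z ∈ L` on `S(L)`: the derivation with `w ↦ [Z, w]` for `w ∈ L`. -/
def symDer (Z : L) : Derivation ℝ (SymmetricAlgebra ℝ L) (SymmetricAlgebra ℝ L) :=
  Derivation.mk'
    (((TrivSqZeroExt.sndHom (SymmetricAlgebra ℝ L) (SymmetricAlgebra ℝ L)).restrictScalars ℝ) ∘ₗ
      (symDual Z).toLinearMap)
    (by
      intro p q
      simp [fst_symDual, TrivSqZeroExt.snd_mul, mul_comm])

theorem symDer_ι (Z w : L) :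
    symDer Z (SymmetricAlgebra.ι ℝ L w) = SymmetricAlgebra.ι ℝ L ⁅Z, w⁆ := by
  simp [symDer, symDual]

theorem symDerivation_ext
    {D D' : Derivation ℝ (SymmetricAlgebra ℝ L) (SymmetricAlgebra ℝ L)}
    (h : ∀ w, D (SymmetricAlgebra.ι ℝ L w) = D' (SymmetricAlgebra.ι ℝ L w)) : D = D' := by
  ext p
  induction p using SymmetricAlgebra.induction with
  | algebraMap r => simp
  | ι w => exact h w
  | mul a b ha hb => simp [ha, hb]
  | add a b ha hb => simp [ha, hb]

instance symLieRingModule : LieRingModule L (SymmetricAlgebra ℝ L) where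
  bracket Z p := symDer Z p
  add_lie Z W p := by
    have h : symDer (Z + W) = symDer Z + symDer W :=
      symDerivation_ext fun w => by simp [symDer_ι]
    simp [h]
  lie_add Z p q := map_add _ _ _
  leibniz_lie Z W p := by
    have h : symDer ⁅Z, W⁆ = ⁅symDer Z, symDer W⁆ :=
      symDerivation_ext fun w => by simp [symDer_ι, Derivation.commutator_apply, lie_lie]
    change symDer Z (symDer W p) = symDer ⁅Z, W⁆ p + symDer W (symDer Z p)
    rw [h, Derivation.commutator_apply]
    abel

theorem sym_lie_apply (Z : L) (p : SymmetricAlgebra ℝ L) : ⁅Z, p⁆ = symDer Z p := rfl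

instance symLieModule : LieModule ℝ L (SymmetricAlgebra ℝ L) where
  smul_lie t Z p := by
    have h : symDer (t • Z) = t • symDer Z :=
      symDerivation_ext fun w => by simp [symDer_ι]
    simp [sym_lie_apply, h]
  lie_smul t Z p := (symDer Z).map_smul t p

end Sym

/-! ### The irreducible representations `V_n` and the functions `s_n` -/

/-- `Z ^ m ∈ S^m(sl(2, ℝ))`, for `Z` given by its coordinates. -/
def symPow (m : ℕ) (p : Fin 3 → ℝ) : SymmetricAlgebra ℝ Sl :=
  SymmetricAlgebra.ι ℝ Sl (ofCoords p) ^ m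

/-- `V_{2m}`: the irreducible component of `S^m(sl(2, ℝ))` generated by `X ^ m`. -/
def evenRep (m : ℕ) : LieSubmodule ℝ Sl (SymmetricAlgebra ℝ Sl) :=
  LieSubmodule.lieSpan ℝ Sl {symPow m cX}

/-- `V_{2m+1}`: the irreducible component of `V₁ ⊗ S^m(sl(2, ℝ))` generated by `e ⊗ X ^ m`, where
`V₁ = ℝ²` is the standard representation and `e = (1, 0)`. -/
def oddRep (m : ℕ) : LieSubmodule ℝ Sl ((Fin 2 → ℝ) ⊗[ℝ] SymmetricAlgebra ℝ Sl) :=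
  LieSubmodule.lieSpan ℝ Sl {(![1, 0] : Fin 2 → ℝ) ⊗ₜ[ℝ] symPow m cX}

open Classical in
/-- `s_{2m}(Z) = Z ^ m` as an element of `V_{2m}` (for `Z` nilpotent, `Z ^ m` does lie in `V_{2m}`;
the value at other `Z` is irrelevant). -/
def sEven (m : ℕ) (p : Fin 3 → ℝ) : evenRep m :=
  if h : symPow m p ∈ evenRep m then ⟨symPow m p, h⟩ else 0

open Classical in
/-- `s_{2m+1}(Z) = s₁(Z) ⊗ Z ^ m` as an element of `V_{2m+1}`, for a given function `s₁` (when
`μ₁(s₁(Z)) = Z`, the tensor `s₁(Z) ⊗ Z ^ m` does lie in `V_{2m+1}`; the value at other `Z` is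
irrelevant). -/
def sOdd (m : ℕ) (s₁ : (Fin 3 → ℝ) → (Fin 2 → ℝ)) (p : Fin 3 → ℝ) : oddRep m :=
  if h : s₁ p ⊗ₜ[ℝ] symPow m p ∈ oddRep m then ⟨s₁ p ⊗ₜ[ℝ] symPow m p, h⟩ else 0

/-- `s₁` is the continuous section of `μ₁` over `U ∩ N⁺` with `s₁(X) = √2 e`
(recall `μ₁(√2 e) = X`). -/
structure IsMomentSection (U : Opens (Fin 3 → ℝ)) (s₁ : (Fin 3 → ℝ) → (Fin 2 → ℝ)) : Prop where
  continuousOn : ContinuousOn s₁ ((U : Set (Fin 3 → ℝ)) ∩ nilConePlus)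
  moment_eq : ∀ p ∈ (U : Set (Fin 3 → ℝ)) ∩ nilConePlus, moment (s₁ p) = p
  base : s₁ cX = ![√2, 0]

end SlTwo

end

noncomputable section
namespace SlTwo

/-! ### Differential operators with polynomial coefficients on test functions -/

section Operators

variable {U : Opens (Fin 3 → ℝ)}

/-- Multiplication of test functions by a smooth function. -/
def mulOp (a : (Fin 3 → ℝ) → ℝ) (ha : ContDiff ℝ ((⊤ : ℕ∞) : WithTop ℕ∞) a) :
    𝓓(U, ℝ) →ₗ[ℝ] 𝓓(U, ℝ) where
  toFun f := ⟨fun p => a p * f p, ha.mul f.contDiff, f.hasCompactSupport.mul_left,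
    (closure_mono (Function.support_mul_subset_right _ _)).trans f.tsupport_subset⟩
  map_add' f g := by
    ext p
    exact mul_add _ _ _
  map_smul' c f := by
    ext p
    exact mul_left_comm _ _ _

@[simp]
theorem mulOp_apply (a : (Fin 3 → ℝ) → ℝ) (ha : ContDiff ℝ ((⊤ : ℕ∞) : WithTop ℕ∞) a)
    (f : 𝓓(U, ℝ)) (p : Fin 3 → ℝ) : mulOp a ha f p = a p * f p := rfl

/-- The directional derivative of test functions. -/
def dOp (v : Fin 3 → ℝ) : 𝓓(U, ℝ) →ₗ[ℝ] 𝓓(U, ℝ) :=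
  (TestFunction.lineDerivCLM ℝ v : 𝓓(U, ℝ) →L[ℝ] 𝓓(U, ℝ)).toLinearMap

theorem differentiable_testFunction (f : 𝓓(U, ℝ)) : Differentiable ℝ f :=
  f.contDiff.differentiable (by simp)

theorem dOp_apply (v : Fin 3 → ℝ) (f : 𝓓(U, ℝ)) (p : Fin 3 → ℝ) :
    dOp v f p = fderiv ℝ f p v := by
  have h : dOp v f p = lineDeriv ℝ f p v := by
    simp [dOp]
  rw [h, (differentiable_testFunction f p).lineDeriv_eq_fderiv]

/-- Multiplication by the `i`-th coordinate. -/
def zOp (i : Fin 3) : 𝓓(U, ℝ) →ₗ[ℝ] 𝓓(U, ℝ) :=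
  mulOp (fun p => p i) (contDiff_apply ℝ ℝ i)

@[simp]
theorem zOp_apply (i : Fin 3) (f : 𝓓(U, ℝ)) (p : Fin 3 → ℝ) : zOp i f p = p i * f p := rfl

theorem dOp_zOp (v : Fin 3 → ℝ) (i : Fin 3) (f : 𝓓(U, ℝ)) :
    dOp v (zOp i f) = zOp i (dOp v f) + v i • f := by
  ext p
  have h1 : HasFDerivAt (fun p : Fin 3 → ℝ => p i)
      (ContinuousLinearMap.proj (R := ℝ) (φ := fun _ : Fin 3 => ℝ) i) p :=
    hasFDerivAt_apply i p
  have h2 := h1.mul (differentiable_testFunction f p).hasFDerivAt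
  have h3 : (zOp i f : (Fin 3 → ℝ) → ℝ) = (fun p => p i) * ⇑f := rfl
  change _ = p i * dOp v f p + v i * f p
  rw [dOp_apply, dOp_apply, h3, h2.fderiv]
  simp
  ring

theorem zOp_comm (i j : Fin 3) (f : 𝓓(U, ℝ)) : zOp i (zOp j f) = zOp j (zOp i f) := by
  ext p
  simp only [zOp_apply]
  ring

theorem dOp_comm (v w : Fin 3 → ℝ) (f : 𝓓(U, ℝ)) : dOp v (dOp w f) = dOp w (dOp v f) := by
  ext p
  have hf : ContDiff ℝ 2 f := contDiff_infty.1 f.contDiff 2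
  have key : ∀ a b : Fin 3 → ℝ, dOp a (dOp b f) p = fderiv ℝ (fderiv ℝ f) p a b := by
    intro a b
    have h : (dOp b f : (Fin 3 → ℝ) → ℝ) = fun p => fderiv ℝ f p b := by
      funext p
      exact dOp_apply b f p
    rw [dOp_apply, h]
    have hd : DifferentiableAt ℝ (fderiv ℝ f) p :=
      (hf.fderiv_right (m := 1) (by norm_num)).differentiable (by norm_num) p
    rw [fderiv_clm_apply hd (differentiableAt_const b)]
    simp
  rw [key, key]
  exact (hf.contDiffAt.isSymmSndFDerivAt (by simp)) v w

/-- Multiplication by the invariant quadratic form `h ^ 2 + x * y`. -/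
def qOp : 𝓓(U, ℝ) →ₗ[ℝ] 𝓓(U, ℝ) := zOp 0 ∘ₗ zOp 0 + zOp 1 ∘ₗ zOp 2

/-- The Euler vector field. -/
def eulerOp : 𝓓(U, ℝ) →ₗ[ℝ] 𝓓(U, ℝ) := zOp 0 ∘ₗ dOp cH + zOp 1 ∘ₗ dOp cX + zOp 2 ∘ₗ dOp cY

/-- The operator `(1/2) ∂_H² + 2 ∂_Y ∂_X` on test functions. -/
def boxOp : 𝓓(U, ℝ) →ₗ[ℝ] 𝓓(U, ℝ) :=
  (1 / 2 : ℝ) • (dOp cH ∘ₗ dOp cH) + (2 : ℝ) • (dOp cX ∘ₗ dOp cY)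

theorem qOp_apply (f : 𝓓(U, ℝ)) (p : Fin 3 → ℝ) :
    qOp f p = (p 0 ^ 2 + p 1 * p 2) * f p := by
  change p 0 * (p 0 * f p) + p 1 * (p 2 * f p) = _
  ring

theorem eulerOp_apply (f : 𝓓(U, ℝ)) (p : Fin 3 → ℝ) : eulerOp f p = fderiv ℝ f p p := by
  change p 0 * dOp cH f p + p 1 * dOp cX f p + p 2 * dOp cY f p = _
  have hp : p = p 0 • cH + p 1 • cX + p 2 • cY := by
    funext i
    fin_cases i <;> simp [cH, cX, cY]
  conv_rhs => rw [hp]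
  rw [map_add, map_add, map_smul, map_smul, map_smul, ← hp]
  simp [dOp_apply]

@[simp] theorem cH_zero : cH 0 = 1 := rfl
@[simp] theorem cH_one : cH 1 = 0 := rfl
@[simp] theorem cH_two : cH 2 = 0 := rfl
@[simp] theorem cX_zero : cX 0 = 0 := rfl
@[simp] theorem cX_one : cX 1 = 1 := rfl
@[simp] theorem cX_two : cX 2 = 0 := rfl
@[simp] theorem cY_zero : cY 0 = 0 := rfl
@[simp] theorem cY_one : cY 1 = 0 := rfl
@[simp] theorem cY_two : cY 2 = 1 := rfl

theorem symm_lie_ofCoords (z p : Fin 3 → ℝ) :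
    ofCoords.symm ⁅ofCoords z, ofCoords p⁆ =
      ![z 1 * p 2 - p 1 * z 2, 2 * (z 0 * p 1 - z 1 * p 0), 2 * (z 2 * p 0 - z 0 * p 2)] := by
  rw [LinearEquiv.symm_apply_eq]
  apply Subtype.ext
  rw [LieAlgebra.SpecialLinear.sl_bracket, coe_ofCoords, coe_ofCoords, coe_ofCoords,
    Matrix.mul_fin_two, Matrix.mul_fin_two]
  ext i j
  fin_cases i <;> fin_cases j <;> simp <;> ring

theorem lieDeriv_ofCoords (z : Fin 3 → ℝ) (f : 𝓓(U, ℝ)) :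
    lieDeriv (ofCoords z) f =
      z 0 • ((2 : ℝ) • zOp 2 (dOp cY f) - (2 : ℝ) • zOp 1 (dOp cX f)) +
      z 1 • ((2 : ℝ) • zOp 0 (dOp cX f) - zOp 2 (dOp cH f)) +
      z 2 • (zOp 1 (dOp cH f) - (2 : ℝ) • zOp 0 (dOp cY f)) := by
  ext p
  have hp : -ofCoords.symm ⁅ofCoords z, ofCoords p⁆ =
      (-(z 1 * p 2 - p 1 * z 2)) • cH + (-(2 * (z 0 * p 1 - z 1 * p 0))) • cX +
        (-(2 * (z 2 * p 0 - z 0 * p 2))) • cY := by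
    rw [symm_lie_ofCoords]
    funext i
    fin_cases i <;> simp [cH, cX, cY]
  change fderiv ℝ f p (-ofCoords.symm ⁅ofCoords z, ofCoords p⁆) =
    z 0 * (2 * (p 2 * dOp cY f p) - 2 * (p 1 * dOp cX f p)) +
      z 1 * (2 * (p 0 * dOp cX f p) - p 2 * dOp cH f p) +
      z 2 * (p 1 * dOp cH f p - 2 * (p 0 * dOp cY f p))
  rw [hp, map_add, map_add, map_smul, map_smul, map_smul, dOp_apply, dOp_apply, dOp_apply]
  simp only [smul_eq_mul]
  ring

theorem lieDeriv_H (f : 𝓓(U, ℝ)) : lieDeriv (ofCoords cH) f =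
    (2 : ℝ) • zOp 2 (dOp cY f) - (2 : ℝ) • zOp 1 (dOp cX f) := by
  rw [lieDeriv_ofCoords]; simp

theorem lieDeriv_X (f : 𝓓(U, ℝ)) : lieDeriv (ofCoords cX) f =
    (2 : ℝ) • zOp 0 (dOp cX f) - zOp 2 (dOp cH f) := by
  rw [lieDeriv_ofCoords]; simp

theorem lieDeriv_Y (f : 𝓓(U, ℝ)) : lieDeriv (ofCoords cY) f =
    zOp 1 (dOp cH f) - (2 : ℝ) • zOp 0 (dOp cY f) := by
  rw [lieDeriv_ofCoords]; simp

theorem boxOp_apply' (f : 𝓓(U, ℝ)) :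
    boxOp f = (1 / 2 : ℝ) • dOp cH (dOp cH f) + (2 : ℝ) • dOp cX (dOp cY f) := rfl

theorem qOp_apply' (f : 𝓓(U, ℝ)) : qOp f = zOp 0 (zOp 0 f) + zOp 1 (zOp 2 f) := rfl

theorem eulerOp_apply' (f : 𝓓(U, ℝ)) :
    eulerOp f = zOp 0 (dOp cH f) + zOp 1 (dOp cX f) + zOp 2 (dOp cY f) := rfl

theorem dOp_YX (f : 𝓓(U, ℝ)) : dOp cY (dOp cX f) = dOp cX (dOp cY f) := dOp_comm _ _ _
theorem dOp_YH (f : 𝓓(U, ℝ)) : dOp cY (dOp cH f) = dOp cH (dOp cY f) := dOp_comm _ _ _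
theorem dOp_XH (f : 𝓓(U, ℝ)) : dOp cX (dOp cH f) = dOp cH (dOp cX f) := dOp_comm _ _ _

theorem boxOp_qOp (f : 𝓓(U, ℝ)) :
    boxOp (qOp f) = qOp (boxOp f) + (2 : ℝ) • eulerOp f + (3 : ℝ) • f := by
  simp only [boxOp_apply', qOp_apply', eulerOp_apply', map_add, map_smul, dOp_zOp,
    cH_zero, cH_one, cH_two, cX_zero, cX_one, cX_two, cY_zero, cY_one, cY_two, zero_smul,
    one_smul, add_zero]
  module

theorem boxOp_eulerOp (f : 𝓓(U, ℝ)) :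
    boxOp (eulerOp f) = eulerOp (boxOp f) + (2 : ℝ) • boxOp f := by
  simp only [boxOp_apply', eulerOp_apply', map_add, map_smul, dOp_zOp, dOp_YX, dOp_YH,
    dOp_XH, cH_zero, cH_one, cH_two, cX_zero, cX_one, cX_two, cY_zero, cY_one, cY_two, zero_smul,
    one_smul, add_zero]
  module

theorem boxOp_lieDeriv (Z : Sl) (f : 𝓓(U, ℝ)) :
    boxOp (lieDeriv Z f) = lieDeriv Z (boxOp f) := by
  obtain ⟨z, rfl⟩ := ofCoords.surjective Z
  simp only [boxOp_apply', lieDeriv_ofCoords, map_add, map_sub, map_smul, dOp_zOp, dOp_YX, dOp_YH,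
    dOp_XH, cH_zero, cH_one, cH_two, cX_zero, cX_one, cX_two, cY_zero, cY_one, cY_two, zero_smul,
    one_smul, add_zero]
  module

theorem lieDeriv_qOp (Z : Sl) (f : 𝓓(U, ℝ)) :
    lieDeriv Z (qOp f) = qOp (lieDeriv Z f) := by
  obtain ⟨z, rfl⟩ := ofCoords.surjective Z
  simp only [qOp_apply', lieDeriv_ofCoords, map_add, map_sub, map_smul, dOp_zOp,
    cH_zero, cH_one, cH_two, cX_zero, cX_one, cX_two, cY_zero, cY_one, cY_two, zero_smul,
    one_smul, add_zero]
  ext p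
  simp only [FunLike.coe_add, FunLike.coe_smul, FunLike.coe_sub, Pi.add_apply, Pi.sub_apply,
    Pi.smul_apply, zOp_apply, smul_eq_mul]
  ring

theorem lieDeriv_zOp_sum (f : 𝓓(U, ℝ)) :
    lieDeriv (ofCoords cH) (zOp 0 f) + lieDeriv (ofCoords cX) (zOp 1 f) +
      lieDeriv (ofCoords cY) (zOp 2 f) = 0 := by
  simp only [lieDeriv_H, lieDeriv_X, lieDeriv_Y, map_add, dOp_zOp,
    cH_one, cH_two, cX_zero, cX_one, cY_zero, cY_two, zero_smul,
    one_smul, add_zero]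
  ext p
  simp only [FunLike.coe_add, FunLike.coe_smul, FunLike.coe_sub, Pi.add_apply, Pi.sub_apply,
    Pi.smul_apply, zOp_apply, smul_eq_mul, FunLike.coe_zero, Pi.zero_apply]
  ring

theorem tsupport_dOp_subset (v : Fin 3 → ℝ) (f : 𝓓(U, ℝ)) : tsupport (dOp v f) ⊆ tsupport f := by
  have h : (dOp v f : (Fin 3 → ℝ) → ℝ) = fun p => fderiv ℝ f p v := by
    funext p
    exact dOp_apply v f p
  rw [h]
  exact tsupport_fderiv_apply_subset ℝ v

theorem tsupport_mulOp_subset (a : (Fin 3 → ℝ) → ℝ)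
    (ha : ContDiff ℝ ((⊤ : ℕ∞) : WithTop ℕ∞) a) (f : 𝓓(U, ℝ)) :
    tsupport (mulOp a ha f) ⊆ tsupport f :=
  closure_mono (Function.support_mul_subset_right _ _)

theorem tsupport_zOp_subset (i : Fin 3) (f : 𝓓(U, ℝ)) : tsupport (zOp i f) ⊆ tsupport f :=
  tsupport_mulOp_subset _ _ f

theorem tsupport_qOp_subset (f : 𝓓(U, ℝ)) : tsupport (qOp f) ⊆ tsupport f := by
  have h : (qOp f : (Fin 3 → ℝ) → ℝ) = fun p => (p 0 ^ 2 + p 1 * p 2) * f p := by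
    funext p
    exact qOp_apply f p
  rw [h]
  exact closure_mono (Function.support_mul_subset_right _ _)

theorem tsupport_boxOp_subset (f : 𝓓(U, ℝ)) : tsupport (boxOp f) ⊆ tsupport f := by
  refine (tsupport_add _ _).trans (Set.union_subset ?_ ?_)
  · exact (tsupport_smul_subset_right (fun _ => (1 / 2 : ℝ)) _).trans
      ((tsupport_dOp_subset _ _).trans (tsupport_dOp_subset _ _))
  · exact (tsupport_smul_subset_right (fun _ => (2 : ℝ)) _).trans
      ((tsupport_dOp_subset _ _).trans (tsupport_dOp_subset _ _))

end Operators

/-! ### Invariant linear functionals supported on the cone -/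

section Functionals

variable {U : Opens (Fin 3 → ℝ)} {V : Type*} [NormedAddCommGroup V] [NormedSpace ℝ V]

/-- Multiplication of functionals by the quadratic form. -/
def mulQ : Module.End ℝ (𝓓(U, ℝ) →ₗ[ℝ] V) := LinearMap.lcomp ℝ V qOp

@[simp]
theorem mulQ_apply (T : 𝓓(U, ℝ) →ₗ[ℝ] V) (f : 𝓓(U, ℝ)) : mulQ T f = T (qOp f) := rfl

/-- The operator `□` on functionals. -/
def boxEnd : Module.End ℝ (𝓓(U, ℝ) →ₗ[ℝ] V) := LinearMap.lcomp ℝ V boxOp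

@[simp]
theorem boxEnd_apply (T : 𝓓(U, ℝ) →ₗ[ℝ] V) (f : 𝓓(U, ℝ)) : boxEnd T f = T (boxOp f) := rfl

/-- If `T` is homogeneous of degree `d` and `q T = 0`, then `q □^(k+1) T` is a multiple of
`□^k T`. -/
theorem mulQ_boxEnd_pow {T : 𝓓(U, ℝ) →ₗ[ℝ] V} {n : ℝ}
    (hE : ∀ f, T (eulerOp f) = (-(1 + n / 2)) • T f) (hq : mulQ T = 0) (k : ℕ) :
    mulQ ((boxEnd ^ (k + 1)) T) = ((k + 1) * (2 * k + 1 - n) : ℝ) • (boxEnd ^ k) T := by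
  have hEk : ∀ (k : ℕ) (f : 𝓓(U, ℝ)),
      (boxEnd ^ k) T (eulerOp f) = (-(1 + n / 2) + 2 * k) • (boxEnd ^ k) T f := by
    intro k
    induction k with
    | zero => intro f; simpa using hE f
    | succ k ih =>
      intro f
      rw [pow_succ', Module.End.mul_apply, boxEnd_apply, boxEnd_apply, boxOp_eulerOp, map_add, ih,
        map_smul]
      push_cast
      module
  have step : ∀ k : ℕ, mulQ ((boxEnd ^ (k + 1)) T) =
      boxEnd (mulQ ((boxEnd ^ k) T)) + (2 * (-(1 + n / 2) + 2 * k) + 3) • (boxEnd ^ k) T := by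
    intro k
    ext f
    rw [pow_succ', Module.End.mul_apply]
    simp only [mulQ_apply, boxEnd_apply, LinearMap.add_apply, LinearMap.smul_apply, boxOp_qOp,
      map_add, map_smul, hEk]
    module
  induction k with
  | zero =>
    rw [step 0]
    simp only [pow_zero, Module.End.one_apply, hq, map_zero, zero_add]
    push_cast
    module
  | succ k ih =>
    rw [step (k + 1), ih, map_smul, ← Module.End.mul_apply, ← pow_succ']
    push_cast
    module

variable [LieRingModule Sl V] [LieModule ℝ Sl V]

variable (U V) in
/-- Locally invariant linear maps on test functions, vanishing off the nilpotent cone; no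
continuity is required. -/
def algInv : Submodule ℝ (𝓓(U, ℝ) →ₗ[ℝ] V) where
  carrier := {T | (∀ (Z : Sl) (f : 𝓓(U, ℝ)), ⁅Z, T f⁆ = T (lieDeriv Z f)) ∧
    ∀ f : 𝓓(U, ℝ), tsupport f ⊆ (U : Set (Fin 3 → ℝ)) \ nilCone → T f = 0}
  zero_mem' := ⟨fun Z f => by simp, fun f _ => rfl⟩
  add_mem' := by
    rintro S T ⟨hS, hS'⟩ ⟨hT, hT'⟩
    exact ⟨fun Z f => by simp [hS, hT], fun f hf => by simp [hS' f hf, hT' f hf]⟩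
  smul_mem' := by
    rintro c T ⟨hT, hT'⟩
    exact ⟨fun Z f => by simp [hT], fun f hf => by simp [hT' f hf]⟩

theorem mulQ_mem {T : 𝓓(U, ℝ) →ₗ[ℝ] V} (hT : T ∈ algInv U V) : mulQ T ∈ algInv U V :=
  ⟨fun Z f => by simp [hT.1, lieDeriv_qOp],
    fun f hf => hT.2 _ ((tsupport_qOp_subset f).trans hf)⟩

theorem mulQ_pow_mem {T : 𝓓(U, ℝ) →ₗ[ℝ] V} (hT : T ∈ algInv U V) (k : ℕ) :
    (mulQ ^ k) T ∈ algInv U V := by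
  induction k with
  | zero => simpa using hT
  | succ k ih =>
    rw [pow_succ', Module.End.mul_apply]
    exact mulQ_mem ih

theorem boxEnd_mem {T : 𝓓(U, ℝ) →ₗ[ℝ] V} (hT : T ∈ algInv U V) : boxEnd T ∈ algInv U V :=
  ⟨fun Z f => by simp [hT.1, boxOp_lieDeriv],
    fun f hf => hT.2 _ ((tsupport_boxOp_subset f).trans hf)⟩

theorem boxEnd_pow_mem {T : 𝓓(U, ℝ) →ₗ[ℝ] V} (hT : T ∈ algInv U V) (k : ℕ) :
    (boxEnd ^ k) T ∈ algInv U V := by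
  induction k with
  | zero => simpa using hT
  | succ k ih =>
    rw [pow_succ', Module.End.mul_apply]
    exact boxEnd_mem ih

/-- The isotropy relation: `ρ(Z) T(Z) = 0`, since `[Z, Z] = 0`. -/
theorem isotropy {T : 𝓓(U, ℝ) →ₗ[ℝ] V} (hT : T ∈ algInv U V) (f : 𝓓(U, ℝ)) :
    ⁅ofCoords cH, T (zOp 0 f)⁆ + ⁅ofCoords cX, T (zOp 1 f)⁆ + ⁅ofCoords cY, T (zOp 2 f)⁆ = 0 := by
  rw [hT.1, hT.1, hT.1, ← map_add, ← map_add, lieDeriv_zOp_sum, map_zero]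

end Functionals
end SlTwo
end

noncomputable section
namespace SlTwo

/-! ### Functionals on a box killed by two partial derivatives -/

section Box

open Set

/-- Smooth functions vanishing outside the closed box `[a, b]`. -/
structure IsBoxFn (a b : Fin 3 → ℝ) (f : (Fin 3 → ℝ) → ℝ) : Prop where
  contDiff : ContDiff ℝ ((⊤ : ℕ∞) : WithTop ℕ∞) f
  eq_zero : ∀ p, p ∉ Icc a b → f p = 0

variable {a b : Fin 3 → ℝ} {f g : (Fin 3 → ℝ) → ℝ}

theorem IsBoxFn.hasCompactSupport (hf : IsBoxFn a b f) : HasCompactSupport f :=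
  HasCompactSupport.intro isCompact_Icc hf.eq_zero

theorem IsBoxFn.mul_left (hf : IsBoxFn a b f) (hg : ContDiff ℝ ((⊤ : ℕ∞) : WithTop ℕ∞) g) :
    IsBoxFn a b (fun p => g p * f p) :=
  ⟨hg.mul hf.contDiff, fun p hp => by simp [hf.eq_zero p hp]⟩

/-- The integral of `f` along the half line or line `p - A e_i`. -/
def lineInt (A : Set ℝ) (i : Fin 3) (f : (Fin 3 → ℝ) → ℝ) (p : Fin 3 → ℝ) : ℝ :=
  ∫ t in A, f (p - t • (Pi.single i 1 : Fin 3 → ℝ))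

theorem contDiff_lineInt (A : Set ℝ) (i : Fin 3)
    (hf : ContDiff ℝ ((⊤ : ℕ∞) : WithTop ℕ∞) f) (hc : HasCompactSupport f) :
    ContDiff ℝ ((⊤ : ℕ∞) : WithTop ℕ∞) (lineInt A i f) := by
  set L : ℝ → (Fin 3 → ℝ) := fun t => t • (Pi.single i 1 : Fin 3 → ℝ) with hL
  have hLc : Continuous L := by fun_prop
  set μ : Measure (Fin 3 → ℝ) := Measure.map L (volume.restrict A) with hμ
  have hfin : IsLocallyFiniteMeasure μ := by
    refine ⟨fun x => ⟨Metric.ball x 1, Metric.ball_mem_nhds x one_pos, ?_⟩⟩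
    rw [hμ, Measure.map_apply hLc.measurable Metric.isOpen_ball.measurableSet]
    refine lt_of_le_of_lt ((Measure.restrict_apply_le _ _).trans
      (measure_mono (t := Metric.ball (x i) 1) ?_)) measure_ball_lt_top
    intro t ht
    have h1 : dist (L t) x < 1 := ht
    have h2 := (dist_le_pi_dist (L t) x i).trans_lt h1
    simpa [hL] using h2
  have h := hc.contDiff_convolution_right (μ := μ) (n := ⊤) (ContinuousLinearMap.mul ℝ ℝ)
    (locallyIntegrable_const (1 : ℝ)) hf
  have h' : lineInt A i f = convolution (fun _ => (1 : ℝ)) f (ContinuousLinearMap.mul ℝ ℝ) μ := by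
    funext p
    rw [convolution_def, hμ, integral_map hLc.measurable.aemeasurable]
    · simp [lineInt, hL]
    · have : Continuous fun x => (ContinuousLinearMap.mul ℝ ℝ) 1 (f (p - x)) := by
        have := hf.continuous
        fun_prop
      exact this.aestronglyMeasurable
  rw [h']
  exact h

theorem lineInt_Ioi (i : Fin 3) (f : (Fin 3 → ℝ) → ℝ) (p : Fin 3 → ℝ) (s : ℝ) :
    lineInt (Ioi 0) i f (p + s • Pi.single i 1) =
      ∫ t in Iio s, f (p + t • (Pi.single i 1 : Fin 3 → ℝ)) := by
  have h := (Measure.measurePreserving_sub_left (volume : Measure ℝ) s).setIntegral_preimage_emb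
    (measurableEmbedding_subLeft s) (fun t => f (p + t • (Pi.single i 1 : Fin 3 → ℝ))) (Iio s)
  rw [← h, lineInt]
  have h2 : (fun x : ℝ => s - x) ⁻¹' Iio s = Ioi 0 := by
    ext x; simp
  rw [h2]
  refine integral_congr_ae (Filter.Eventually.of_forall fun t => ?_)
  change f _ = f _
  congr 1
  module

theorem lineInt_univ (i : Fin 3) (f : (Fin 3 → ℝ) → ℝ) (p : Fin 3 → ℝ) (s : ℝ) :
    lineInt univ i f (p + s • Pi.single i 1) =
      ∫ t : ℝ, f (p + t • (Pi.single i 1 : Fin 3 → ℝ)) := by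
  rw [← integral_sub_left_eq_self (fun t => f (p + t • (Pi.single i 1 : Fin 3 → ℝ))) volume s]
  simp only [lineInt, Measure.restrict_univ]
  refine integral_congr_ae (Filter.Eventually.of_forall fun t => ?_)
  change f _ = f _
  congr 1
  module

theorem lineInt_univ' (i : Fin 3) (f : (Fin 3 → ℝ) → ℝ) (p : Fin 3 → ℝ) :
    lineInt univ i f p = ∫ t : ℝ, f (p + t • (Pi.single i 1 : Fin 3 → ℝ)) := by
  simpa using lineInt_univ i f p 0

theorem lineInt_univ_add (i : Fin 3) (f : (Fin 3 → ℝ) → ℝ) (p : Fin 3 → ℝ) (s : ℝ) :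
    lineInt univ i f (p + s • Pi.single i 1) = lineInt univ i f p := by
  rw [lineInt_univ, lineInt_univ']

theorem IsBoxFn.line (hf : IsBoxFn a b f) (i : Fin 3) (p : Fin 3 → ℝ) :
    Continuous (fun t : ℝ => f (p + t • (Pi.single i 1 : Fin 3 → ℝ))) ∧
      HasCompactSupport (fun t : ℝ => f (p + t • (Pi.single i 1 : Fin 3 → ℝ))) := by
  constructor
  · have := hf.contDiff.continuous
    fun_prop
  · refine HasCompactSupport.intro (isCompact_Icc (a := a i - p i) (b := b i - p i)) fun t ht => ?_
    refine hf.eq_zero _ fun h => ht ?_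
    have h1 := h.1 i
    have h2 := h.2 i
    simp at h1 h2
    exact ⟨by linarith, by linarith⟩

theorem IsBoxFn.integrable_line (hf : IsBoxFn a b f) (i : Fin 3) (p : Fin 3 → ℝ) :
    Integrable (fun t : ℝ => f (p + t • (Pi.single i 1 : Fin 3 → ℝ))) :=
  (hf.line i p).1.integrable_of_hasCompactSupport (hf.line i p).2

theorem fderiv_lineInt_Ioi (hf : IsBoxFn a b f) (i : Fin 3) (p : Fin 3 → ℝ) :
    fderiv ℝ (lineInt (Ioi 0) i f) p (Pi.single i 1) = f p := by
  have hd : HasFDerivAt (lineInt (Ioi 0) i f) (fderiv ℝ (lineInt (Ioi 0) i f) p)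
      (p + (0 : ℝ) • (Pi.single i 1 : Fin 3 → ℝ)) := by
    simpa using ((contDiff_lineInt (Ioi 0) i hf.contDiff hf.hasCompactSupport).differentiable
      (by simp) p).hasFDerivAt
  have hl : HasDerivAt (fun s : ℝ => p + s • (Pi.single i 1 : Fin 3 → ℝ)) (Pi.single i 1) 0 := by
    simpa using ((hasDerivAt_id (0 : ℝ)).smul_const (Pi.single i 1 : Fin 3 → ℝ)).const_add p
  have h1 := hd.comp_hasDerivAt 0 hl
  set φ : ℝ → ℝ := fun t => f (p + t • (Pi.single i 1 : Fin 3 → ℝ)) with hφ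
  have hi : Integrable φ := hf.integrable_line i p
  have h2 : lineInt (Ioi 0) i f ∘ (fun s : ℝ => p + s • (Pi.single i 1 : Fin 3 → ℝ)) =
      fun s => (∫ t in Iic 0, φ t) + ∫ t in (0 : ℝ)..s, φ t := by
    funext s
    rw [← intervalIntegral.integral_Iic_sub_Iic hi.integrableOn hi.integrableOn,
      integral_Iic_eq_integral_Iio (x := s)]
    simp [lineInt_Ioi, hφ]
  rw [h2] at h1
  have h3 := ((hf.line i p).1.integral_hasStrictDerivAt 0 0).hasDerivAt.const_add (∫ t in Iic 0, φ t)
  have := h1.unique h3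
  simpa using this

/-- Every box function is, modulo an `i`-th partial derivative, the product of a fixed bump
function of the `i`-th coordinate and of its integral in the `i`-th direction. -/
theorem exists_primitive (hf : IsBoxFn a b f) (i : Fin 3) {χ : ℝ → ℝ}
    (hχ : ContDiff ℝ ((⊤ : ℕ∞) : WithTop ℕ∞) χ) (hχ0 : ∀ t, t ∉ Icc (a i) (b i) → χ t = 0)
    (hχ1 : ∫ t, χ t = 1) :
    IsBoxFn a b (fun p => χ (p i) * lineInt univ i f p) ∧
    ∃ F, IsBoxFn a b F ∧ ∀ p, fderiv ℝ F p (Pi.single i 1) =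
      f p - χ (p i) * lineInt univ i f p := by
  have hI := contDiff_lineInt univ i hf.contDiff hf.hasCompactSupport
  have hχi : ContDiff ℝ ((⊤ : ℕ∞) : WithTop ℕ∞) (fun p : Fin 3 → ℝ => χ (p i)) :=
    hχ.comp (contDiff_apply ℝ ℝ i)
  have hoff : ∀ (p : Fin 3 → ℝ) (j : Fin 3), j ≠ i → ¬ (a j ≤ p j ∧ p j ≤ b j) →
      ∀ t : ℝ, f (p + t • (Pi.single i 1 : Fin 3 → ℝ)) = 0 := by
    intro p j hj h t
    refine hf.eq_zero _ fun h' => h ?_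
    have h1 := h'.1 j
    have h2 := h'.2 j
    simp [hj] at h1 h2
    exact ⟨h1, h2⟩
  have hbox : IsBoxFn a b (fun p => χ (p i) * lineInt univ i f p) := by
    refine ⟨hχi.mul hI, fun p hp => ?_⟩
    by_cases hpi : p i ∈ Icc (a i) (b i)
    · have : ∃ j, ¬ (a j ≤ p j ∧ p j ≤ b j) := by
        by_contra! hcon
        exact hp ⟨fun j => (hcon j).1, fun j => (hcon j).2⟩
      obtain ⟨j, hj⟩ := this
      have hji : j ≠ i := by
        rintro rfl
        exact hj hpi
      rw [lineInt_univ']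
      simp [hoff p j hji hj]
    · simp [hχ0 _ hpi]
  refine ⟨hbox, ?_⟩
  set g : (Fin 3 → ℝ) → ℝ := fun p => f p - χ (p i) * lineInt univ i f p with hg
  have hgb : IsBoxFn a b g :=
    ⟨hf.contDiff.sub hbox.contDiff, fun p hp => by
      have := hbox.eq_zero p hp
      simp only [hg, hf.eq_zero p hp, this, sub_zero]⟩
  refine ⟨lineInt (Ioi 0) i g,
    ⟨contDiff_lineInt _ i hgb.contDiff hgb.hasCompactSupport, fun p hp => ?_⟩,
    fun p => fderiv_lineInt_Ioi hgb i p⟩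
  have hF : lineInt (Ioi 0) i g p = ∫ t in Iio (0 : ℝ), g (p + t • (Pi.single i 1 : Fin 3 → ℝ)) := by
    simpa using lineInt_Ioi i g p 0
  rw [hF]
  by_cases hlo : p i < a i
  · refine setIntegral_eq_zero_of_forall_eq_zero fun t ht => hgb.eq_zero _ fun h => ?_
    have := h.1 i
    simp at this ht
    linarith
  by_cases hhi : b i < p i
  · have h0 : ∀ t, t ∉ Iio (0 : ℝ) → g (p + t • (Pi.single i 1 : Fin 3 → ℝ)) = 0 := by
      intro t ht
      refine hgb.eq_zero _ fun h => ?_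
      have := h.2 i
      simp at this ht
      linarith
    rw [setIntegral_eq_integral_of_forall_compl_eq_zero h0]
    have h1 : ∀ t : ℝ, g (p + t • (Pi.single i 1 : Fin 3 → ℝ)) =
        f (p + t • (Pi.single i 1 : Fin 3 → ℝ)) - χ (p i + t) * lineInt univ i f p := by
      intro t
      simp only [hg, lineInt_univ_add]
      simp
    have hχc : Continuous χ := hχ.continuous
    have hχi : Integrable (fun t => χ (p i + t)) := by
      have : Integrable χ := hχc.integrable_of_hasCompactSupport
        (HasCompactSupport.intro isCompact_Icc hχ0)
      exact this.comp_add_left (p i)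
    simp only [h1]
    rw [integral_sub (hf.integrable_line i p) (hχi.mul_const _), integral_mul_const,
      integral_add_left_eq_self χ, hχ1, lineInt_univ']
    simp
  · have : ∃ j, ¬ (a j ≤ p j ∧ p j ≤ b j) := by
      by_contra! hcon
      exact hp ⟨fun j => (hcon j).1, fun j => (hcon j).2⟩
    obtain ⟨j, hj⟩ := this
    have hji : j ≠ i := by
      rintro rfl
      exact hj ⟨not_lt.1 hlo, not_lt.1 hhi⟩
    refine setIntegral_eq_zero_of_forall_eq_zero fun t ht => hgb.eq_zero _ fun h => hj ?_
    have h1 := h.1 j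
    have h2 := h.2 j
    simp [hji] at h1 h2
    exact ⟨h1, h2⟩

/-- A functional killed by `∂_0` and `∂_1` on a box only depends on the integrals over the planes
`p 2 = const`. -/
theorem exists_tensor_rep (hf : IsBoxFn a b f) {χ₀ χ₁ : ℝ → ℝ}
    (h₀ : ContDiff ℝ ((⊤ : ℕ∞) : WithTop ℕ∞) χ₀) (h₁ : ContDiff ℝ ((⊤ : ℕ∞) : WithTop ℕ∞) χ₁)
    (hz₀ : ∀ t, t ∉ Icc (a 0) (b 0) → χ₀ t = 0) (hz₁ : ∀ t, t ∉ Icc (a 1) (b 1) → χ₁ t = 0)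
    (hi₀ : ∫ t, χ₀ t = 1) (hi₁ : ∫ t, χ₁ t = 1) :
    ∃ g : ℝ → ℝ, ContDiff ℝ ((⊤ : ℕ∞) : WithTop ℕ∞) g ∧ (∀ t, t ∉ Icc (a 2) (b 2) → g t = 0) ∧
      ∀ S : ((Fin 3 → ℝ) → ℝ) →ₗ[ℝ] ℝ,
        (∀ i : Fin 3, i ≠ 2 → ∀ G, IsBoxFn a b G → S (fun p => fderiv ℝ G p (Pi.single i 1)) = 0) →
          S f = S (fun p => χ₀ (p 0) * χ₁ (p 1) * g (p 2)) := by
  obtain ⟨hf1, F, hF, hFd⟩ := exists_primitive hf 0 h₀ hz₀ hi₀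
  obtain ⟨hf2, G, hG, hGd⟩ := exists_primitive hf1 1 h₁ hz₁ hi₁
  set f1 : (Fin 3 → ℝ) → ℝ := fun p => χ₀ (p 0) * lineInt univ 0 f p with hf1def
  obtain ⟨c, hc⟩ : ∃ c, χ₀ c ≠ 0 := by
    by_contra! h
    simp [h] at hi₀
  set J : (Fin 3 → ℝ) → ℝ := fun p =>
    ∫ t : ℝ, lineInt univ 0 f (p + t • (Pi.single 1 1 : Fin 3 → ℝ)) with hJ
  have hJ0 : ∀ (p : Fin 3 → ℝ) (s : ℝ), J (p + s • Pi.single 0 1) = J p := by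
    intro p s
    simp only [hJ]
    refine integral_congr_ae (Filter.Eventually.of_forall fun t => ?_)
    change lineInt univ 0 f _ = lineInt univ 0 f _
    rw [add_right_comm, lineInt_univ_add]
  have hJ1 : ∀ (p : Fin 3 → ℝ) (s : ℝ), J (p + s • Pi.single 1 1) = J p := by
    intro p s
    simp only [hJ]
    rw [← integral_add_left_eq_self
      (fun t : ℝ => lineInt univ 0 f (p + t • (Pi.single 1 1 : Fin 3 → ℝ))) s]
    refine integral_congr_ae (Filter.Eventually.of_forall fun t => ?_)
    change lineInt univ 0 f _ = lineInt univ 0 f _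
    congr 1
    module
  have hJ2 : ∀ p : Fin 3 → ℝ, J ![c, 0, p 2] = J p := by
    intro p
    rw [← hJ0 p (c - p 0), ← hJ1 (p + (c - p 0) • Pi.single 0 1) (-p 1)]
    congr 1
    funext i
    fin_cases i <;> simp
  have hL : ∀ p, lineInt univ 1 f1 p = χ₀ (p 0) * J p := by
    intro p
    rw [lineInt_univ', hJ, ← integral_const_mul]
    simp [hf1def]
  refine ⟨fun q => lineInt univ 1 f1 ![c, 0, q] / χ₀ c, ?_, ?_, ?_⟩
  · refine ((contDiff_lineInt univ 1 hf1.contDiff hf1.hasCompactSupport).comp ?_).div_const _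
    refine contDiff_pi.2 fun i => ?_
    fin_cases i
    · exact contDiff_const
    · exact contDiff_const
    · exact contDiff_id
  · intro t ht
    have : ∀ s : ℝ, f1 (![c, 0, t] + s • (Pi.single 1 1 : Fin 3 → ℝ)) = 0 := by
      intro s
      refine hf1.eq_zero _ fun h => ht ?_
      have h1 := h.1 2
      have h2 := h.2 2
      simp at h1 h2
      exact ⟨h1, h2⟩
    simp only [lineInt_univ', this, integral_zero, zero_div]
  · intro S hS
    have e1 : S f = S f1 := by
      have h := hS 0 (by decide) F hF
      have h' : (fun p => fderiv ℝ F p (Pi.single 0 1)) = f - f1 := by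
        funext p
        exact hFd p
      rw [h', map_sub] at h
      linarith
    have e2 : S f1 = S (fun p => χ₁ (p 1) * lineInt univ 1 f1 p) := by
      have h := hS 1 (by decide) G hG
      have h' : (fun p => fderiv ℝ G p (Pi.single 1 1)) =
          f1 - fun p => χ₁ (p 1) * lineInt univ 1 f1 p := by
        funext p
        exact hGd p
      rw [h', map_sub] at h
      linarith
    rw [e1, e2]
    congr 1
    funext p
    simp only [hL, hJ2]
    simp
    field_simp

/-- Hadamard's lemma on the line. -/
theorem exists_eq_mul_of_zero {g : ℝ → ℝ} (hg : ContDiff ℝ ((⊤ : ℕ∞) : WithTop ℕ∞) g)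
    (h0 : g 0 = 0) :
    ∃ g₁ : ℝ → ℝ, ContDiff ℝ ((⊤ : ℕ∞) : WithTop ℕ∞) g₁ ∧ ∀ t, g t = t * g₁ t := by
  obtain ⟨η, hηc, hηs, -, hη1⟩ : ∃ η : ℝ → ℝ, ContDiff ℝ ((⊤ : ℕ∞) : WithTop ℕ∞) η ∧
      HasCompactSupport η ∧ True ∧ ∀ t ∈ Icc (0 : ℝ) 1, η t = 1 := by
    let B : ContDiffBump (0 : ℝ) := ⟨1, 2, one_pos, one_lt_two⟩
    refine ⟨B, B.contDiff, B.hasCompactSupport, trivial, fun t ht => B.one_of_mem_closedBall ?_⟩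
    simpa [abs_of_nonneg ht.1] using ht.2
  have hg' : ContDiff ℝ ((⊤ : ℕ∞) : WithTop ℕ∞) (deriv g) := hg.deriv'
  set G : ℝ → ℝ → ℝ := fun p x => η (-x) * deriv g (-x * p) with hG
  have hμ : LocallyIntegrable (fun _ : ℝ => (1 : ℝ)) (volume.restrict (Icc (0 : ℝ) 1)) :=
    locallyIntegrable_const 1
  have h := contDiffOn_convolution_right_with_param_comp (μ := volume.restrict (Icc (0 : ℝ) 1))
    (n := ⊤) (ContinuousLinearMap.mul ℝ ℝ) (s := univ) (v := fun _ : ℝ => (0 : ℝ)) (g := G)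
    (k := (Neg.neg : ℝ → ℝ) ⁻¹' tsupport η)
    contDiffOn_const isOpen_univ ((Homeomorph.neg ℝ).isClosedEmbedding.isCompact_preimage hηs)
    (fun p x _ hx => by
      have : η (-x) = 0 := image_eq_zero_of_notMem_tsupport hx
      simp [hG, this]) hμ (by
      refine ContDiff.contDiffOn ?_
      change ContDiff ℝ _ (fun z : ℝ × ℝ => η (-z.2) * deriv g (-z.2 * z.1))
      exact (hηc.comp contDiff_snd.neg).mul (hg'.comp (contDiff_snd.neg.mul contDiff_fst)))
  refine ⟨_, contDiffOn_univ.1 h, fun t => ?_⟩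
  rw [convolution_def]
  have e : ∫ x in Icc (0 : ℝ) 1, (ContinuousLinearMap.mul ℝ ℝ) 1 (G t (0 - x)) =
      ∫ x in (0 : ℝ)..1, deriv g (x * t) := by
    rw [intervalIntegral.integral_of_le zero_le_one, ← integral_Icc_eq_integral_Ioc]
    refine setIntegral_congr_fun measurableSet_Icc fun x hx => ?_
    simp [hG, hη1 x hx]
  rw [e]
  have hd : ∀ x, HasDerivAt g (deriv g x) x := fun x =>
    (hg.differentiable (by simp) x).hasDerivAt
  have h1 : ∫ x in (0 : ℝ)..1, deriv g (x * t) * t = g (1 * t) - g (0 * t) := by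
    refine intervalIntegral.integral_eq_sub_of_hasDerivAt (f := fun x => g (x * t)) (fun x _ => ?_) ?_
    · exact (hd (x * t)).comp x (by simpa using (hasDerivAt_id x).mul_const t)
    · exact Continuous.intervalIntegrable
        ((hg'.continuous.comp (continuous_id.mul continuous_const)).mul continuous_const) _ _
  rw [intervalIntegral.integral_mul_const] at h1
  simp [h0] at h1
  linarith

end Box
end SlTwo
end

noncomputable section
namespace SlTwo

/-! ### Scalar functionals equivariant under a Borel subalgebra -/

section Chart

open Set Topology

/-- Smooth functions with compact support contained in `O`. -/
structure IsTest (O : Set (Fin 3 → ℝ)) (f : (Fin 3 → ℝ) → ℝ) : Prop where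
  contDiff : ContDiff ℝ ((⊤ : ℕ∞) : WithTop ℕ∞) f
  hasCompactSupport : HasCompactSupport f
  tsupport_subset : tsupport f ⊆ O

theorem IsTest.mono {O O' : Set (Fin 3 → ℝ)} {f : (Fin 3 → ℝ) → ℝ} (hf : IsTest O f)
    (h : O ⊆ O') : IsTest O' f :=
  ⟨hf.1, hf.2, hf.3.trans h⟩

theorem IsTest.eq_zero {O : Set (Fin 3 → ℝ)} {f : (Fin 3 → ℝ) → ℝ} (hf : IsTest O f)
    {p : Fin 3 → ℝ} (hp : p ∉ O) : f p = 0 :=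
  image_eq_zero_of_notMem_tsupport fun h => hp (hf.3 h)

/-- The coordinates `(α, β, q) = (h / x, log x, h ^ 2 + x y)` on `{x > 0}`. -/
def chartInv (p : Fin 3 → ℝ) : Fin 3 → ℝ := ![p 0 / p 1, Real.log (p 1), p 0 ^ 2 + p 1 * p 2]

/-- The inverse of `chartInv`. -/
def chart (u : Fin 3 → ℝ) : Fin 3 → ℝ :=
  ![u 0 * Real.exp (u 1), Real.exp (u 1), u 2 * Real.exp (-u 1) - u 0 ^ 2 * Real.exp (u 1)]

theorem chart_one_pos (u : Fin 3 → ℝ) : 0 < chart u 1 := Real.exp_pos _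

theorem chart_chartInv {p : Fin 3 → ℝ} (hp : 0 < p 1) : chart (chartInv p) = p := by
  funext i
  fin_cases i
  · simp [chart, chartInv, Real.exp_log hp, hp.ne']
  · simp [chart, chartInv, Real.exp_log hp]
  · simp [chart, chartInv, Real.exp_log hp, Real.exp_neg]
    field_simp
    ring

theorem chartInv_chart (u : Fin 3 → ℝ) : chartInv (chart u) = u := by
  have h := Real.exp_pos (u 1)
  have h2 : Real.exp (-u 1) * Real.exp (u 1) = 1 := by rw [← Real.exp_add]; simp
  funext i
  fin_cases i
  · simp [chart, chartInv]
  · simp [chart, chartInv]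
  · simp [chart, chartInv]
    linear_combination u 2 * h2

theorem chart_mem_nilCone {u : Fin 3 → ℝ} : chart u ∈ nilCone ↔ u 2 = 0 := by
  have h : chart u 0 ^ 2 + chart u 1 * chart u 2 = u 2 := congrFun (chartInv_chart u) 2
  change chart u 0 ^ 2 + chart u 1 * chart u 2 = 0 ↔ _
  rw [h]

theorem contDiff_chart : ContDiff ℝ ((⊤ : ℕ∞) : WithTop ℕ∞) chart := by
  refine contDiff_pi.2 fun i => ?_
  fin_cases i
  · change ContDiff ℝ _ fun u : Fin 3 → ℝ => u 0 * Real.exp (u 1)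
    fun_prop
  · change ContDiff ℝ _ fun u : Fin 3 → ℝ => Real.exp (u 1)
    fun_prop
  · change ContDiff ℝ _ fun u : Fin 3 → ℝ => u 2 * Real.exp (-u 1) - u 0 ^ 2 * Real.exp (u 1)
    fun_prop

theorem contDiffAt_chartInv {p : Fin 3 → ℝ} (hp : 0 < p 1) :
    ContDiffAt ℝ ((⊤ : ℕ∞) : WithTop ℕ∞) chartInv p := by
  have h0 := contDiffAt_apply (𝕜 := ℝ) (E := ℝ) (n := ((⊤ : ℕ∞) : WithTop ℕ∞)) (0 : Fin 3) p
  have h1 := contDiffAt_apply (𝕜 := ℝ) (E := ℝ) (n := ((⊤ : ℕ∞) : WithTop ℕ∞)) (1 : Fin 3) p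
  have h2 := contDiffAt_apply (𝕜 := ℝ) (E := ℝ) (n := ((⊤ : ℕ∞) : WithTop ℕ∞)) (2 : Fin 3) p
  refine contDiffAt_pi.2 fun i => ?_
  fin_cases i
  · exact h0.div h1 hp.ne'
  · exact h1.log hp.ne'
  · exact (h0.pow 2).add (h1.mul h2)

theorem hasFDerivAt_chartInv {p : Fin 3 → ℝ} (hp : 0 < p 1) (w : Fin 3 → ℝ) :
    fderiv ℝ chartInv p w =
      ![w 0 / p 1 - p 0 * w 1 / p 1 ^ 2, w 1 / p 1, 2 * p 0 * w 0 + p 1 * w 2 + p 2 * w 1] := by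
  have hd : HasFDerivAt chartInv (fderiv ℝ chartInv p) (p + (0 : ℝ) • w) := by
    simpa using ((contDiffAt_chartInv hp).differentiableAt (by simp)).hasFDerivAt
  have hl : HasDerivAt (fun s : ℝ => p + s • w) w 0 := by
    simpa using ((hasDerivAt_id (0 : ℝ)).smul_const w).const_add p
  have h1 := hd.comp_hasDerivAt 0 hl
  have hc : ∀ i : Fin 3, HasDerivAt (fun s : ℝ => p i + s * w i) (w i) 0 := fun i => by
    simpa using ((hasDerivAt_id (0 : ℝ)).mul_const (w i)).const_add (p i)
  have h2 : HasDerivAt (chartInv ∘ fun s : ℝ => p + s • w)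
      ![w 0 / p 1 - p 0 * w 1 / p 1 ^ 2, w 1 / p 1, 2 * p 0 * w 0 + p 1 * w 2 + p 2 * w 1] 0 := by
    refine hasDerivAt_pi.2 fun i => ?_
    fin_cases i
    · have h := (hc 0).div (hc 1) (by simpa using hp.ne')
      exact h.congr_deriv (by simp; field_simp)
    · have h := (hc 1).log (by simpa using hp.ne')
      exact h.congr_deriv (by simp)
    · have h := ((hc 0).pow 2).add ((hc 1).mul (hc 2))
      exact h.congr_deriv (by simp; ring)
  exact h1.unique h2

/-- Transport of functions from the chart, extended by zero. -/
def push : ((Fin 3 → ℝ) → ℝ) →ₗ[ℝ] ((Fin 3 → ℝ) → ℝ) where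
  toFun F p := if 0 < p 1 then F (chartInv p) else 0
  map_add' F G := by
    funext p
    by_cases h : 0 < p 1 <;> simp [h]
  map_smul' c F := by
    funext p
    by_cases h : 0 < p 1 <;> simp [h]

theorem push_of_pos (F : (Fin 3 → ℝ) → ℝ) {p : Fin 3 → ℝ} (hp : 0 < p 1) :
    push F p = F (chartInv p) := if_pos hp

theorem push_of_not_pos (F : (Fin 3 → ℝ) → ℝ) {p : Fin 3 → ℝ} (hp : ¬ 0 < p 1) :
    push F p = 0 := if_neg hp

theorem eventually_pos {p : Fin 3 → ℝ} (hp : 0 < p 1) : ∀ᶠ z in 𝓝 p, 0 < z 1 :=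
  (continuous_apply (1 : Fin 3)).continuousAt.eventually (lt_mem_nhds hp)

theorem push_eventuallyEq (F : (Fin 3 → ℝ) → ℝ) {p : Fin 3 → ℝ} (hp : 0 < p 1) :
    push F =ᶠ[𝓝 p] F ∘ chartInv := by
  filter_upwards [eventually_pos hp] with z hz using push_of_pos F hz

theorem push_eq_zero {K : Set (Fin 3 → ℝ)} {F : (Fin 3 → ℝ) → ℝ} (hF : ∀ u, u ∉ K → F u = 0)
    {p : Fin 3 → ℝ} (hp : p ∉ chart '' K) : push F p = 0 := by
  by_cases h : 0 < p 1
  · rw [push_of_pos F h]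
    exact hF _ fun hu => hp ⟨_, hu, chart_chartInv h⟩
  · exact push_of_not_pos F h

theorem push_eventuallyEq_zero {K : Set (Fin 3 → ℝ)} (hK : IsCompact K) {F : (Fin 3 → ℝ) → ℝ}
    (hF : ∀ u, u ∉ K → F u = 0) {p : Fin 3 → ℝ} (hp : p ∉ chart '' K) :
    push F =ᶠ[𝓝 p] fun _ => 0 := by
  have hc : IsClosed (chart '' K) := (hK.image contDiff_chart.continuous).isClosed
  filter_upwards [hc.isOpen_compl.mem_nhds hp] with z hz using push_eq_zero hF hz

theorem notMem_chart_image {K : Set (Fin 3 → ℝ)} {p : Fin 3 → ℝ} (hp : ¬ 0 < p 1) :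
    p ∉ chart '' K := by
  rintro ⟨u, -, rfl⟩
  exact hp (chart_one_pos u)

theorem isTest_push {K O : Set (Fin 3 → ℝ)} (hK : IsCompact K) {F : (Fin 3 → ℝ) → ℝ}
    (hFs : ContDiff ℝ ((⊤ : ℕ∞) : WithTop ℕ∞) F) (hF : ∀ u, u ∉ K → F u = 0)
    (hO : chart '' K ⊆ O) : IsTest O (push F) := by
  have hKc : IsCompact (chart '' K) := hK.image contDiff_chart.continuous
  have hsupp : Function.support (push F) ⊆ chart '' K := by
    intro p hp
    by_contra h
    exact hp (push_eq_zero hF h)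
  refine ⟨contDiff_iff_contDiffAt.2 fun p => ?_, HasCompactSupport.intro hKc fun p hp =>
    push_eq_zero hF hp, (closure_minimal hsupp hKc.isClosed).trans hO⟩
  by_cases h : 0 < p 1
  · exact (hFs.contDiffAt.comp p (contDiffAt_chartInv h)).congr_of_eventuallyEq
      (push_eventuallyEq F h)
  · exact contDiffAt_const.congr_of_eventuallyEq
      (push_eventuallyEq_zero hK hF (notMem_chart_image h))

theorem fderiv_push {a b : Fin 3 → ℝ} {F : (Fin 3 → ℝ) → ℝ} (hF : IsBoxFn a b F)
    (p w : Fin 3 → ℝ) :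
    fderiv ℝ (push F) p w = if 0 < p 1 then fderiv ℝ F (chartInv p)
      ![w 0 / p 1 - p 0 * w 1 / p 1 ^ 2, w 1 / p 1, 2 * p 0 * w 0 + p 1 * w 2 + p 2 * w 1]
      else 0 := by
  by_cases h : 0 < p 1
  · rw [if_pos h, (push_eventuallyEq F h).fderiv_eq, fderiv_comp p
      (hF.contDiff.differentiable (by simp) _)
      ((contDiffAt_chartInv h).differentiableAt (by simp)), ContinuousLinearMap.comp_apply,
      hasFDerivAt_chartInv h]
  · rw [if_neg h, (push_eventuallyEq_zero isCompact_Icc hF.eq_zero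
      (notMem_chart_image h)).fderiv_eq]
    simp

/-- The vector field of `Y`. -/
def fieldY (f : (Fin 3 → ℝ) → ℝ) (p : Fin 3 → ℝ) : ℝ := fderiv ℝ f p ![p 1, 0, -2 * p 0]

/-- The vector field of `H`. -/
def fieldH (f : (Fin 3 → ℝ) → ℝ) (p : Fin 3 → ℝ) : ℝ := fderiv ℝ f p ![0, -2 * p 1, 2 * p 2]

theorem fieldY_push {a b : Fin 3 → ℝ} {F : (Fin 3 → ℝ) → ℝ} (hF : IsBoxFn a b F) :
    fieldY (push F) = push fun u => fderiv ℝ F u (Pi.single 0 1) := by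
  funext p
  rw [fieldY, fderiv_push hF]
  by_cases h : 0 < p 1
  · rw [if_pos h, push_of_pos _ h]
    congr 1
    funext i
    fin_cases i
    · simp [h.ne']
    · simp
    · simp
      ring
  · rw [if_neg h, push_of_not_pos _ h]

theorem fieldH_push {a b : Fin 3 → ℝ} {F : (Fin 3 → ℝ) → ℝ} (hF : IsBoxFn a b F) :
    fieldH (push F) = push fun u => 2 * (u 0 * fderiv ℝ F u (Pi.single 0 1)) -
      2 * fderiv ℝ F u (Pi.single 1 1) := by
  funext p
  rw [fieldH, fderiv_push hF]
  by_cases h : 0 < p 1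
  · rw [if_pos h, push_of_pos _ h]
    have hv : (![(![0, -2 * p 1, 2 * p 2] : Fin 3 → ℝ) 0 / p 1 -
        p 0 * (![0, -2 * p 1, 2 * p 2] : Fin 3 → ℝ) 1 / p 1 ^ 2,
        (![0, -2 * p 1, 2 * p 2] : Fin 3 → ℝ) 1 / p 1,
        2 * p 0 * (![0, -2 * p 1, 2 * p 2] : Fin 3 → ℝ) 0 +
        p 1 * (![0, -2 * p 1, 2 * p 2] : Fin 3 → ℝ) 2 +
        p 2 * (![0, -2 * p 1, 2 * p 2] : Fin 3 → ℝ) 1] : Fin 3 → ℝ) =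
        (2 * chartInv p 0) • Pi.single 0 1 - (2 : ℝ) • Pi.single 1 1 := by
      funext i
      fin_cases i
      · simp [chartInv]
        field_simp
      · simp
        field_simp
      · simp
        ring
    rw [hv, map_sub, map_smul, map_smul]
    simp only [smul_eq_mul]
    ring
  · rw [if_neg h, push_of_not_pos _ h]

theorem q_mul_push (F : (Fin 3 → ℝ) → ℝ) :
    (fun p : Fin 3 → ℝ => (p 0 ^ 2 + p 1 * p 2) * push F p) = push fun u => u 2 * F u := by
  funext p
  by_cases h : 0 < p 1
  · rw [push_of_pos _ h, push_of_pos _ h]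
    simp [chartInv]
  · rw [push_of_not_pos _ h, push_of_not_pos _ h, mul_zero]

/-- `S` is killed by the vector field of `Y` and is an eigenvector of that of `H`, on `O`. -/
structure IsBorelEquivariant (O : Set (Fin 3 → ℝ)) (lam : ℝ)
    (S : ((Fin 3 → ℝ) → ℝ) →ₗ[ℝ] ℝ) : Prop where
  fieldY : ∀ f, IsTest O f → S (fieldY f) = 0
  fieldH : ∀ f, IsTest O f → S (fieldH f) = lam * S f

/-- The functional `G ↦ S (e ^ (c β) G)` in the chart. -/
def chartFunctional (S : ((Fin 3 → ℝ) → ℝ) →ₗ[ℝ] ℝ) (c : ℝ) : ((Fin 3 → ℝ) → ℝ) →ₗ[ℝ] ℝ :=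
  S ∘ₗ push ∘ₗ LinearMap.mulLeft ℝ (fun u : Fin 3 → ℝ => Real.exp (c * u 1))

theorem chartFunctional_apply (S : ((Fin 3 → ℝ) → ℝ) →ₗ[ℝ] ℝ) (c : ℝ) (G : (Fin 3 → ℝ) → ℝ) :
    chartFunctional S c G = S (push fun u => Real.exp (c * u 1) * G u) := rfl

theorem contDiff_exp_coord (c : ℝ) :
    ContDiff ℝ ((⊤ : ℕ∞) : WithTop ℕ∞) (fun u : Fin 3 → ℝ => Real.exp (c * u 1)) := by
  fun_prop

theorem fderiv_exp_coord (c : ℝ) (u w : Fin 3 → ℝ) :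
    fderiv ℝ (fun u : Fin 3 → ℝ => Real.exp (c * u 1)) u w = c * w 1 * Real.exp (c * u 1) := by
  have h1 : HasFDerivAt (fun p : Fin 3 → ℝ => p 1)
      (ContinuousLinearMap.proj (R := ℝ) (φ := fun _ : Fin 3 => ℝ) 1) u := hasFDerivAt_apply 1 u
  have h2 := (h1.const_mul c).exp
  rw [h2.fderiv]
  simp
  ring

theorem IsBorelEquivariant.chartFunctional_fderiv {O : Set (Fin 3 → ℝ)} {lam : ℝ}
    {S : ((Fin 3 → ℝ) → ℝ) →ₗ[ℝ] ℝ} (hS : IsBorelEquivariant O lam S) {a b : Fin 3 → ℝ}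
    (hab : chart '' Icc a b ⊆ O) (i : Fin 3) (hi : i ≠ 2) {G : (Fin 3 → ℝ) → ℝ}
    (hG : IsBoxFn a b G) :
    chartFunctional S (-(1 + lam / 2)) (fun p => fderiv ℝ G p (Pi.single i 1)) = 0 := by
  set c := -(1 + lam / 2) with hc
  set F : (Fin 3 → ℝ) → ℝ := fun u => Real.exp (c * u 1) * G u with hFdef
  have hF : IsBoxFn a b F := hG.mul_left (contDiff_exp_coord c)
  have htest : ∀ {F}, IsBoxFn a b F → IsTest O (push F) := fun hF =>
    isTest_push isCompact_Icc hF.contDiff hF.eq_zero hab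
  have hdF : ∀ u w, fderiv ℝ F u w = Real.exp (c * u 1) * fderiv ℝ G u w + c * w 1 * F u := by
    intro u w
    have h1 := ((contDiff_exp_coord c).differentiable (by simp) u).hasFDerivAt.mul
      (hG.contDiff.differentiable (by simp) u).hasFDerivAt
    have h2 : F = (fun u : Fin 3 → ℝ => Real.exp (c * u 1)) * G := rfl
    rw [h2, h1.fderiv]
    simp only [FunLike.coe_add, Pi.add_apply, FunLike.coe_smul, Pi.smul_apply, smul_eq_mul,
      fderiv_exp_coord, Pi.mul_apply]
    ring
  have hY : ∀ {F}, IsBoxFn a b F → S (push fun u => fderiv ℝ F u (Pi.single 0 1)) = 0 := by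
    intro F hF
    rw [← fieldY_push hF]
    exact hS.fieldY _ (htest hF)
  rw [chartFunctional_apply]
  obtain rfl | rfl : i = 0 ∨ i = 1 := by
    fin_cases i <;> simp_all
  · have h := hY hF
    simp only [hdF] at h
    simpa using h
  · have h0 : IsBoxFn a b (fun u => u 0 * F u) := hF.mul_left (contDiff_apply ℝ ℝ 0)
    have h1 := hY h0
    have h2 : ∀ u : Fin 3 → ℝ, fderiv ℝ (fun u => u 0 * F u) u (Pi.single 0 1) =
        u 0 * fderiv ℝ F u (Pi.single 0 1) + F u := by
      intro u
      have h3 : HasFDerivAt (fun p : Fin 3 → ℝ => p 0)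
        (ContinuousLinearMap.proj (R := ℝ) (φ := fun _ : Fin 3 => ℝ) 0) u := hasFDerivAt_apply 0 u
      have h4 := h3.mul (hF.contDiff.differentiable (by simp) u).hasFDerivAt
      have h5 : (fun u => u 0 * F u) = (fun p : Fin 3 → ℝ => p 0) * F := rfl
      rw [h5, h4.fderiv]
      simp
    have h3 := hS.fieldH _ (htest hF)
    rw [fieldH_push hF] at h3
    have e1 : (fun u => fderiv ℝ (fun u => u 0 * F u) u (Pi.single 0 1)) =
        (fun u => u 0 * fderiv ℝ F u (Pi.single 0 1)) + F := funext h2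
    have e2 : (fun u : Fin 3 → ℝ => 2 * (u 0 * fderiv ℝ F u (Pi.single 0 1)) -
        2 * fderiv ℝ F u (Pi.single 1 1)) = (2 : ℝ) • (fun u => u 0 * fderiv ℝ F u (Pi.single 0 1))
        - (2 : ℝ) • (fun u => Real.exp (c * u 1) * fderiv ℝ G u (Pi.single 1 1)) -
          (2 * c) • F := by
      funext u
      simp only [hdF, Pi.sub_apply, Pi.smul_apply, smul_eq_mul]
      simp
      ring
    rw [e1, map_add, map_add] at h1
    rw [e2] at h3
    simp only [map_sub, map_smul, smul_eq_mul] at h3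
    have hc2 : lam = -2 - 2 * c := by rw [hc]; ring
    rw [hc2] at h3
    linarith

theorem exists_bump (c : ℝ) {r : ℝ} (hr : 0 < r) :
    ∃ χ : ℝ → ℝ, ContDiff ℝ ((⊤ : ℕ∞) : WithTop ℕ∞) χ ∧
      (∀ t, t ∉ Icc (c - r) (c + r) → χ t = 0) ∧ ∫ t, χ t = 1 := by
  let B : ContDiffBump c := ⟨r / 2, r, by positivity, by linarith⟩
  refine ⟨B.normed volume, B.contDiff_normed, fun t ht => ?_, B.integral_normed⟩
  have h : t ∉ tsupport (B.normed volume) := by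
    rw [B.tsupport_normed_eq, Real.closedBall_eq_Icc]
    exact ht
  exact image_eq_zero_of_notMem_tsupport h

theorem exists_cutoff (c : ℝ) {r : ℝ} (hr : 0 < r) :
    ∃ η : ℝ → ℝ, ContDiff ℝ ((⊤ : ℕ∞) : WithTop ℕ∞) η ∧
      (∀ t, t ∉ Icc (c - r) (c + r) → η t = 0) ∧
      (∀ t ∈ Icc (c - r / 2) (c + r / 2), η t = 1) := by
  let B : ContDiffBump c := ⟨r / 2, r, by positivity, by linarith⟩
  refine ⟨B, B.contDiff, fun t ht => ?_, fun t ht => B.one_of_mem_closedBall ?_⟩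
  · have h : t ∉ tsupport B := by
      rw [B.tsupport_eq, Real.closedBall_eq_Icc]
      exact ht
    exact image_eq_zero_of_notMem_tsupport h
  · rw [Real.closedBall_eq_Icc]
    exact ht

/-- The closed box of radius `r` around `u`. -/
theorem mem_Icc_box {u v : Fin 3 → ℝ} {r : ℝ} :
    v ∈ Icc (u - fun _ => r) (u + fun _ => r) ↔ ∀ i, v i ∈ Icc (u i - r) (u i + r) :=
  ⟨fun h i => ⟨h.1 i, h.2 i⟩, fun h => ⟨fun i => (h i).1, fun i => (h i).2⟩⟩

theorem exists_box_subset {u : Fin 3 → ℝ} {O : Set (Fin 3 → ℝ)} (hO : O ∈ 𝓝 u) :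
    ∃ r > 0, Icc (u - fun _ => r) (u + fun _ => r) ⊆ O := by
  obtain ⟨r, hr, h⟩ := Metric.nhds_basis_closedBall.mem_iff.1 hO
  refine ⟨r, hr, fun v hv => h ?_⟩
  rw [Metric.mem_closedBall, dist_pi_le_iff hr.le]
  intro i
  have := mem_Icc_box.1 hv i
  rw [Real.dist_eq, abs_le]
  exact ⟨by linarith [this.1], by linarith [this.2]⟩

/-- Test functions supported in the open chart box come from box functions. -/
theorem exists_box_rep {u : Fin 3 → ℝ} {r : ℝ} (c : ℝ) {f : (Fin 3 → ℝ) → ℝ}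
    (hf : IsTest ({p | 0 < p 1 ∧ ∀ i, chartInv p i ∈ Ioo (u i - r) (u i + r)}) f) :
    ∃ G, IsBoxFn (u - fun _ => r) (u + fun _ => r) G ∧
      ∀ S : ((Fin 3 → ℝ) → ℝ) →ₗ[ℝ] ℝ, S f = chartFunctional S c G := by
  refine ⟨fun v => Real.exp (-c * v 1) * f (chart v), ⟨(contDiff_exp_coord (-c)).mul
    (hf.contDiff.comp contDiff_chart), fun v hv => ?_⟩, fun S => ?_⟩
  · have : f (chart v) = 0 := hf.eq_zero fun h => hv (mem_Icc_box.2 fun i => by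
      have := h.2 i
      rw [chartInv_chart] at this
      exact Ioo_subset_Icc_self this)
    simp [this]
  · rw [chartFunctional_apply]
    congr 1
    funext p
    by_cases h : 0 < p 1
    · rw [push_of_pos _ h]
      simp only [chart_chartInv h]
      rw [← mul_assoc, ← Real.exp_add]
      simp
    · rw [push_of_not_pos _ h]
      exact hf.eq_zero fun h' => h h'.1

theorem isOpen_chartBox (u : Fin 3 → ℝ) (r : ℝ) :
    IsOpen {p : Fin 3 → ℝ | 0 < p 1 ∧ ∀ i, chartInv p i ∈ Ioo (u i - r) (u i + r)} := by
  rw [isOpen_iff_mem_nhds]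
  rintro p ⟨h1, h2⟩
  have hc := (contDiffAt_chartInv h1).continuousAt
  have h3 : ∀ᶠ z in 𝓝 p, ∀ i, chartInv z i ∈ Ioo (u i - r) (u i + r) :=
    Filter.eventually_all.2 fun i =>
      ((continuous_apply i).continuousAt.comp hc).eventually (isOpen_Ioo.mem_nhds (h2 i))
  filter_upwards [eventually_pos h1, h3] with z hz1 hz2 using ⟨hz1, hz2⟩

/-- Unique continuation along the cone, for equivariant functionals supported on the cone. -/
theorem unique_continuation_pos {O : Set (Fin 3 → ℝ)} (hO : IsOpen O) {p₀ : Fin 3 → ℝ}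
    (hp₀ : p₀ ∈ O) (hpos : 0 < p₀ 1) :
    ∃ B : Set (Fin 3 → ℝ), IsOpen B ∧ p₀ ∈ B ∧ B ⊆ {p | 0 < p 1} ∧
      ∀ (lam : ℝ) (S : ((Fin 3 → ℝ) → ℝ) →ₗ[ℝ] ℝ), IsBorelEquivariant O lam S →
        (∀ f, IsTest (O \ nilCone) f → S f = 0) →
        ∀ p' ∈ B ∩ nilCone, ∀ O' ∈ 𝓝 p', (∀ f, IsTest (O ∩ O') f → S f = 0) →
          ∀ f, IsTest B f → S f = 0 := by
  set u := chartInv p₀ with hu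
  obtain ⟨r, hr, hrO⟩ := exists_box_subset (u := u) (O := chart ⁻¹' O)
    ((hO.preimage contDiff_chart.continuous).mem_nhds (by
      rw [mem_preimage, hu, chart_chartInv hpos]
      exact hp₀))
  refine ⟨_, isOpen_chartBox u r, ⟨hpos, fun i => ⟨by linarith, by linarith⟩⟩, fun p hp => hp.1,
    ?_⟩
  intro lam S hS hcone p' hp' O' hO' hvan f hf
  obtain ⟨G, hG, hGS⟩ := exists_box_rep (-(1 + lam / 2)) hf
  rw [hGS S]
  set S' := chartFunctional S (-(1 + lam / 2)) with hS'
  have hab : chart '' Icc (u - fun _ => r) (u + fun _ => r) ⊆ O := image_subset_iff.2 hrO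
  have hkill := fun i hi G hG => hS.chartFunctional_fderiv hab i hi (G := G) hG
  set u' := chartInv p' with hu'
  have hu'2 : u' 2 = 0 := hp'.2
  have hcp : chart u' = p' := chart_chartInv hp'.1.1
  obtain ⟨s, hs, hsO⟩ := exists_box_subset (u := u')
    (O := chart ⁻¹' O' ∩ {v | ∀ i, v i ∈ Ioo (u i - r) (u i + r)}) (by
      refine Filter.inter_mem ?_ ?_
      · exact contDiff_chart.continuous.continuousAt.preimage_mem_nhds (by rwa [hcp])
      · exact Filter.eventually_all.2 fun i =>
          (continuous_apply i).continuousAt.eventually (isOpen_Ioo.mem_nhds (hp'.1.2 i)))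
  have hsub : ∀ v ∈ Icc (u' - fun _ => s) (u' + fun _ => s), ∀ i, v i ∈ Icc (u i - r) (u i + r) :=
    fun v hv i => Ioo_subset_Icc_self ((hsO hv).2 i)
  have hbd : ∀ i (t : ℝ), t ∈ Icc (u' i - s) (u' i + s) → t ∈ Icc (u i - r) (u i + r) := by
    intro i t ht
    have h := hsub (Function.update u' i t) (mem_Icc_box.2 fun j => by
      by_cases hj : j = i
      · subst hj
        simpa using ht
      · simp [hj, hs.le]) i
    simpa using h
  obtain ⟨χ₀, hχ₀, hz₀, hi₀⟩ := exists_bump (u' 0) hs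
  obtain ⟨χ₁, hχ₁, hz₁, hi₁⟩ := exists_bump (u' 1) hs
  obtain ⟨η, hη, hηz, hη1⟩ := exists_cutoff 0 hs
  obtain ⟨g, hg, hgz, hrep⟩ := exists_tensor_rep hG hχ₀ hχ₁
    (fun t ht => hz₀ t fun h => ht (hbd 0 t h)) (fun t ht => hz₁ t fun h => ht (hbd 1 t h)) hi₀ hi₁
  rw [hrep S' hkill]
  have hsplit : (fun p : Fin 3 → ℝ => χ₀ (p 0) * χ₁ (p 1) * g (p 2)) =
      (fun p => χ₀ (p 0) * χ₁ (p 1) * (g (p 2) * η (p 2))) +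
        fun p => χ₀ (p 0) * χ₁ (p 1) * (g (p 2) * (1 - η (p 2))) := by
    funext p
    simp only [Pi.add_apply]
    ring
  have hsm : ∀ k : ℝ → ℝ, ContDiff ℝ ((⊤ : ℕ∞) : WithTop ℕ∞) k →
      ContDiff ℝ ((⊤ : ℕ∞) : WithTop ℕ∞) (fun p : Fin 3 → ℝ => Real.exp (-(1 + lam / 2) * p 1) *
        (χ₀ (p 0) * χ₁ (p 1) * k (p 2))) := by
    intro k hk
    exact (contDiff_exp_coord _).mul (((hχ₀.comp (contDiff_apply ℝ ℝ 0)).mul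
      (hχ₁.comp (contDiff_apply ℝ ℝ 1))).mul (hk.comp (contDiff_apply ℝ ℝ 2)))
  rw [hsplit, map_add, hS', chartFunctional_apply, chartFunctional_apply]
  have e1 : S (push fun p : Fin 3 → ℝ => Real.exp (-(1 + lam / 2) * p 1) *
      (χ₀ (p 0) * χ₁ (p 1) * (g (p 2) * η (p 2)))) = 0 := by
    refine hvan _ (isTest_push isCompact_Icc (K := Icc (u' - fun _ => s) (u' + fun _ => s))
      (hsm _ (hg.mul hη)) (fun v hv => ?_) ?_)
    · rw [mem_Icc_box] at hv
      push Not at hv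
      obtain ⟨i, hi⟩ := hv
      fin_cases i
      · have : χ₀ (v 0) = 0 := hz₀ _ hi
        simp [this]
      · have : χ₁ (v 1) = 0 := hz₁ _ hi
        simp [this]
      · have : η (v 2) = 0 := hηz _ (by simpa [hu'2] using hi)
        simp [this]
    · rintro _ ⟨v, hv, rfl⟩
      exact ⟨hab ⟨v, mem_Icc_box.2 (hsub v hv), rfl⟩, (hsO hv).1⟩
  have e2 : S (push fun p : Fin 3 → ℝ => Real.exp (-(1 + lam / 2) * p 1) *
      (χ₀ (p 0) * χ₁ (p 1) * (g (p 2) * (1 - η (p 2))))) = 0 := by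
    refine hcone _ (isTest_push (K := Icc (u - fun _ => r) (u + fun _ => r) ∩
      {v | s / 2 ≤ |v 2|}) (isCompact_Icc.inter_right (isClosed_le continuous_const
        (continuous_apply 2).abs)) (hsm _ (hg.mul (contDiff_const.sub hη))) (fun v hv => ?_) ?_)
    · by_cases h : s / 2 ≤ |v 2|
      · have hv' : v ∉ Icc (u - fun _ => r) (u + fun _ => r) := fun h' => hv ⟨h', h⟩
        rw [mem_Icc_box] at hv'
        push Not at hv'
        obtain ⟨i, hi⟩ := hv'
        fin_cases i
        · have : χ₀ (v 0) = 0 := hz₀ _ fun h => hi (hbd 0 _ h)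
          simp [this]
        · have : χ₁ (v 1) = 0 := hz₁ _ fun h => hi (hbd 1 _ h)
          simp [this]
        · have : g (v 2) = 0 := hgz _ hi
          simp [this]
      · have : η (v 2) = 1 := hη1 _ (by
          rw [not_le, abs_lt] at h
          exact ⟨by linarith, by linarith⟩)
        simp [this]
    · rintro _ ⟨v, hv, rfl⟩
      refine ⟨hab ⟨v, hv.1, rfl⟩, fun h => ?_⟩
      rw [chart_mem_nilCone] at h
      have h2 : s / 2 ≤ |v 2| := hv.2
      rw [h, abs_zero] at h2
      linarith
  rw [e1, e2, add_zero]

/-- Near a point of the cone, an equivariant functional killed by the quadratic form is determined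
by its value on one test function. -/
theorem exists_determining_test {O : Set (Fin 3 → ℝ)} (hO : IsOpen O) {p₀ : Fin 3 → ℝ}
    (hp₀ : p₀ ∈ O) (hpos : 0 < p₀ 1) (hcone : p₀ ∈ nilCone) (lam : ℝ) :
    ∃ B : Set (Fin 3 → ℝ), IsOpen B ∧ p₀ ∈ B ∧ B ⊆ {p | 0 < p 1} ∧ ∃ χ, IsTest O χ ∧
      ∀ S : ((Fin 3 → ℝ) → ℝ) →ₗ[ℝ] ℝ, IsBorelEquivariant O lam S →
        (∀ f, IsTest O f → S (fun p => (p 0 ^ 2 + p 1 * p 2) * f p) = 0) → S χ = 0 →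
          ∀ f, IsTest B f → S f = 0 := by
  set u := chartInv p₀ with hu
  have hu2 : u 2 = 0 := hcone
  obtain ⟨r, hr, hrO⟩ := exists_box_subset (u := u) (O := chart ⁻¹' O)
    ((hO.preimage contDiff_chart.continuous).mem_nhds (by
      rw [mem_preimage, hu, chart_chartInv hpos]
      exact hp₀))
  have hab : chart '' Icc (u - fun _ => r) (u + fun _ => r) ⊆ O := image_subset_iff.2 hrO
  obtain ⟨χ₀, hχ₀, hz₀, hi₀⟩ := exists_bump (u 0) hr
  obtain ⟨χ₁, hχ₁, hz₁, hi₁⟩ := exists_bump (u 1) hr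
  obtain ⟨η, hη, hηz, hη1⟩ := exists_cutoff (u 2) hr
  have htest : ∀ k : ℝ → ℝ, ContDiff ℝ ((⊤ : ℕ∞) : WithTop ℕ∞) k →
      (∀ t, t ∉ Icc (u 2 - r) (u 2 + r) → k t = 0) →
      IsTest O (push fun p : Fin 3 → ℝ => Real.exp (-(1 + lam / 2) * p 1) *
        (χ₀ (p 0) * χ₁ (p 1) * k (p 2))) := by
    intro k hk hkz
    refine isTest_push isCompact_Icc ((contDiff_exp_coord _).mul
      (((hχ₀.comp (contDiff_apply ℝ ℝ 0)).mul
      (hχ₁.comp (contDiff_apply ℝ ℝ 1))).mul (hk.comp (contDiff_apply ℝ ℝ 2)))) (fun v hv => ?_) hab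
    rw [mem_Icc_box] at hv
    push Not at hv
    obtain ⟨i, hi⟩ := hv
    fin_cases i
    · have : χ₀ (v 0) = 0 := hz₀ _ hi
      simp [this]
    · have : χ₁ (v 1) = 0 := hz₁ _ hi
      simp [this]
    · have : k (v 2) = 0 := hkz _ hi
      simp [this]
  refine ⟨_, isOpen_chartBox u r, ⟨hpos, fun i => ⟨by linarith, by linarith⟩⟩, fun p hp => hp.1,
    _, htest η hη hηz, ?_⟩
  intro S hS hq hχ f hf
  obtain ⟨G, hG, hGS⟩ := exists_box_rep (-(1 + lam / 2)) hf
  have hkill := fun i hi G hG => hS.chartFunctional_fderiv hab i hi (G := G) hG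
  obtain ⟨g, hg, hgz, hrep⟩ := exists_tensor_rep hG hχ₀ hχ₁ hz₀ hz₁ hi₀ hi₁
  rw [hGS S, hrep _ hkill]
  have h02 : (0 : ℝ) ∈ Icc (u 2 - r / 2) (u 2 + r / 2) := by
    rw [hu2]
    exact ⟨by linarith, by linarith⟩
  obtain ⟨k, hk, hgk⟩ := exists_eq_mul_of_zero (g := fun t => g t - g 0 * η t)
    (hg.sub (contDiff_const.mul hη)) (by simp [hη1 0 h02])
  have hkz : ∀ t, t ∉ Icc (u 2 - r) (u 2 + r) → k t = 0 := by
    intro t ht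
    have h1 := hgk t
    rw [hgz t ht, hηz t ht] at h1
    have h2 : t ≠ 0 := by
      rintro rfl
      exact ht ⟨by linarith [h02.1], by linarith [h02.2]⟩
    simpa [h2] using h1.symm
  have hsplit : (fun p : Fin 3 → ℝ => χ₀ (p 0) * χ₁ (p 1) * g (p 2)) =
      g 0 • (fun p : Fin 3 → ℝ => χ₀ (p 0) * χ₁ (p 1) * η (p 2)) +
        fun p => p 2 * (χ₀ (p 0) * χ₁ (p 1) * k (p 2)) := by
    funext p
    simp only [Pi.add_apply, Pi.smul_apply, smul_eq_mul]
    linear_combination (χ₀ (p 0) * χ₁ (p 1)) * hgk (p 2)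
  rw [hsplit, map_add, map_smul, chartFunctional_apply, chartFunctional_apply, hχ, smul_zero,
    zero_add]
  have h := hq _ (htest k hk hkz)
  rw [q_mul_push] at h
  rw [← h]
  congr 2
  funext v
  ring

/-! ### The half space `y < 0` -/

/-- The Weyl group element acting on `sl(2, ℝ)`. -/
def weyl : (Fin 3 → ℝ) ≃L[ℝ] (Fin 3 → ℝ) :=
  LinearEquiv.toContinuousLinearEquiv
    { toFun := fun p => ![-p 0, -p 2, -p 1]
      invFun := fun p => ![-p 0, -p 2, -p 1]
      map_add' := fun p q => by
        funext i
        fin_cases i <;> simp [add_comm]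
      map_smul' := fun c p => by
        funext i
        fin_cases i <;> simp
      left_inv := fun p => by
        funext i
        fin_cases i <;> simp
      right_inv := fun p => by
        funext i
        fin_cases i <;> simp }

theorem weyl_apply (p : Fin 3 → ℝ) : weyl p = ![-p 0, -p 2, -p 1] := rfl

theorem weyl_weyl (p : Fin 3 → ℝ) : weyl (weyl p) = p := by
  funext i
  fin_cases i <;> simp [weyl_apply]

theorem weyl_mem_nilCone {p : Fin 3 → ℝ} : weyl p ∈ nilCone ↔ p ∈ nilCone := by
  change (-p 0) ^ 2 + (-p 2) * (-p 1) = 0 ↔ p 0 ^ 2 + p 1 * p 2 = 0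
  rw [neg_sq, neg_mul_neg, mul_comm]

theorem IsTest.comp_weyl {O : Set (Fin 3 → ℝ)} {f : (Fin 3 → ℝ) → ℝ} (hf : IsTest O f) :
    IsTest (weyl ⁻¹' O) (f ∘ weyl) := by
  refine ⟨hf.1.comp weyl.contDiff, hf.2.comp_homeomorph weyl.toHomeomorph, ?_⟩
  rw [show tsupport (f ∘ weyl) = weyl ⁻¹' tsupport f from
    tsupport_comp_eq_preimage f weyl.toHomeomorph]
  exact preimage_mono hf.3

/-- The vector field of `X`. -/
def fieldX (f : (Fin 3 → ℝ) → ℝ) (p : Fin 3 → ℝ) : ℝ := fderiv ℝ f p ![-p 2, 2 * p 0, 0]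

/-- Equivariance under the opposite Borel subalgebra. -/
structure IsOppBorelEquivariant (O : Set (Fin 3 → ℝ)) (lam : ℝ)
    (S : ((Fin 3 → ℝ) → ℝ) →ₗ[ℝ] ℝ) : Prop where
  fieldX : ∀ f, IsTest O f → S (fieldX f) = 0
  fieldH : ∀ f, IsTest O f → S (fieldH f) = lam * S f

theorem fderiv_comp_weyl {O : Set (Fin 3 → ℝ)} {f : (Fin 3 → ℝ) → ℝ} (hf : IsTest O f)
    (p w : Fin 3 → ℝ) : fderiv ℝ (f ∘ weyl) p w = fderiv ℝ f (weyl p) (weyl w) := by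
  rw [fderiv_comp p (hf.1.differentiable (by simp) _) weyl.differentiableAt,
    ContinuousLinearMap.comp_apply, weyl.fderiv]
  rfl

/-- Pull-back of a functional by the Weyl group element. -/
def weylFunctional (S : ((Fin 3 → ℝ) → ℝ) →ₗ[ℝ] ℝ) : ((Fin 3 → ℝ) → ℝ) →ₗ[ℝ] ℝ :=
  S ∘ₗ LinearMap.funLeft ℝ ℝ weyl

theorem weylFunctional_apply (S : ((Fin 3 → ℝ) → ℝ) →ₗ[ℝ] ℝ) (f : (Fin 3 → ℝ) → ℝ) :
    weylFunctional S f = S (f ∘ weyl) := rfl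

theorem IsOppBorelEquivariant.isBorelEquivariant_weylFunctional {O : Set (Fin 3 → ℝ)} {lam : ℝ}
    {S : ((Fin 3 → ℝ) → ℝ) →ₗ[ℝ] ℝ} (hS : IsOppBorelEquivariant O lam S) :
    IsBorelEquivariant (weyl ⁻¹' O) (-lam) (weylFunctional S) := by
  have hpre : weyl ⁻¹' (weyl ⁻¹' O) = O := by
    ext p
    simp [weyl_weyl]
  constructor
  · intro f hf
    have h := hS.fieldX _ (hpre ▸ hf.comp_weyl)
    rw [weylFunctional_apply]
    have e : fieldY f ∘ weyl = -SlTwo.fieldX (f ∘ weyl) := by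
      funext p
      rw [Pi.neg_apply, SlTwo.fieldX, fderiv_comp_weyl hf, Function.comp_apply, fieldY, ← map_neg]
      congr 1
      funext i
      fin_cases i <;> simp [weyl_apply]
    rw [e, map_neg, h, neg_zero]
  · intro f hf
    have h := hS.fieldH _ (hpre ▸ hf.comp_weyl)
    rw [weylFunctional_apply, weylFunctional_apply]
    have e : SlTwo.fieldH f ∘ weyl = -SlTwo.fieldH (f ∘ weyl) := by
      funext p
      rw [Pi.neg_apply, SlTwo.fieldH, fderiv_comp_weyl hf, Function.comp_apply, SlTwo.fieldH,
        ← map_neg]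
      congr 1
      funext i
      fin_cases i <;> simp [weyl_apply]
    rw [e, map_neg, h]
    ring

/-- Unique continuation along the cone in the half space `y < 0`. -/
theorem unique_continuation_neg {O : Set (Fin 3 → ℝ)} (hO : IsOpen O) {p₀ : Fin 3 → ℝ}
    (hp₀ : p₀ ∈ O) (hneg : p₀ 2 < 0) :
    ∃ B : Set (Fin 3 → ℝ), IsOpen B ∧ p₀ ∈ B ∧ B ⊆ {p | p 2 < 0} ∧
      ∀ (lam : ℝ) (S : ((Fin 3 → ℝ) → ℝ) →ₗ[ℝ] ℝ), IsOppBorelEquivariant O lam S →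
        (∀ f, IsTest (O \ nilCone) f → S f = 0) →
        ∀ p' ∈ B ∩ nilCone, ∀ O' ∈ 𝓝 p', (∀ f, IsTest (O ∩ O') f → S f = 0) →
          ∀ f, IsTest B f → S f = 0 := by
  have hpre : ∀ O : Set (Fin 3 → ℝ), weyl ⁻¹' (weyl ⁻¹' O) = O := fun O => by
    ext p
    simp [weyl_weyl]
  obtain ⟨B, hB, hpB, hBpos, h⟩ := unique_continuation_pos (hO.preimage weyl.continuous)
    (p₀ := weyl p₀) (by simpa [weyl_weyl] using hp₀) (by simpa [weyl_apply] using hneg)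
  refine ⟨weyl ⁻¹' B, hB.preimage weyl.continuous, hpB, fun p hp => ?_, ?_⟩
  · have := hBpos hp
    simpa [weyl_apply] using this
  intro lam S hS hcone p' hp' O' hO' hvan f hf
  have h1 := h (-lam) _ hS.isBorelEquivariant_weylFunctional (fun f hf => hcone _ ?_) (weyl p')
    ⟨hp'.1, weyl_mem_nilCone.2 hp'.2⟩ (weyl ⁻¹' O')
    (weyl.continuous.continuousAt.preimage_mem_nhds (by rwa [weyl_weyl]))
    (fun f hf => hvan _ ?_) (f ∘ weyl) ?_
  · rw [weylFunctional_apply] at h1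
    rw [← h1]
    congr 1
    funext p
    simp [weyl_weyl]
  · have h2 := hf.comp_weyl
    refine h2.mono fun p hp => ⟨?_, fun hpn => hp.2 (weyl_mem_nilCone.2 hpn)⟩
    simpa [weyl_weyl] using hp.1
  · have h2 := hf.comp_weyl
    refine h2.mono fun p hp => ?_
    simpa [weyl_weyl] using hp
  · have h2 := hf.comp_weyl
    rwa [hpre] at h2

end Chart
end SlTwo
end

noncomputable section
namespace SlTwo

/-! ### Distributions supported on the cone have finite order -/

section FiniteOrder

variable {U : Opens (Fin 3 → ℝ)} {V : Type*} [NormedAddCommGroup V] [NormedSpace ℝ V]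

theorem exists_seminorm_bound (T : 𝓓'(U, V)) {K : Set (Fin 3 → ℝ)} (hK : IsCompact K)
    (hKU : K ⊆ U) : ∃ (N : ℕ) (C : ℝ), 0 ≤ C ∧ ∀ (f : 𝓓(U, ℝ)) (A : ℝ), 0 ≤ A →
      tsupport f ⊆ K → (∀ i ≤ N, ∀ x ∈ K, ‖iteratedFDeriv ℝ i f x‖ ≤ A) → ‖T f‖ ≤ C * A := by
  let K' : Compacts (Fin 3 → ℝ) := ⟨K, hK⟩
  let L : 𝓓^{⊤}_{K'}(Fin 3 → ℝ, ℝ) →L[ℝ] V :=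
    (show 𝓓(U, ℝ) →L[ℝ] V from T).comp (TestFunction.ofSupportedInCLM ℝ (K := K') hKU)
  obtain ⟨s, C, -, hC⟩ := Seminorm.bound_of_continuous
    (ContDiffMapSupportedIn.withSeminorms ℝ (Fin 3 → ℝ) ℝ ⊤ K')
    ((normSeminorm ℝ V).comp L.toLinearMap) (continuous_norm.comp L.continuous)
  refine ⟨s.sup id, C, C.2, fun f A hA hf hb => ?_⟩
  let g : 𝓓^{⊤}_{K'}(Fin 3 → ℝ, ℝ) :=
    ContDiffMapSupportedIn.of_support_subset f.contDiff ((subset_tsupport _).trans hf)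
  have h1 : ‖T f‖ ≤ C * s.sup (ContDiffMapSupportedIn.seminorm ℝ (Fin 3 → ℝ) ℝ ⊤ K') g := hC g
  refine h1.trans (mul_le_mul_of_nonneg_left ?_ C.2)
  refine Seminorm.finset_sup_apply_le hA fun i hi => ?_
  rw [ContDiffMapSupportedIn.seminorm_top_le_iff ℝ hA]
  exact fun x hx => hb i (Finset.le_sup (f := id) hi) x hx

theorem exists_iteratedFDeriv_bound {F : Type*} [NormedAddCommGroup F] [NormedSpace ℝ F]
    {f : F → ℝ} (hf : ContDiff ℝ ((⊤ : ℕ∞) : WithTop ℕ∞) f) {K : Set F} (hK : IsCompact K)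
    (N : ℕ) : ∃ A : ℝ, 1 ≤ A ∧ ∀ i ≤ N, ∀ x ∈ K, ‖iteratedFDeriv ℝ i f x‖ ≤ A := by
  have h : ∀ i : ℕ, ∃ A : ℝ, ∀ x ∈ K, ‖iteratedFDeriv ℝ i f x‖ ≤ A := fun i =>
    hK.exists_bound_of_continuousOn
      (hf.continuous_iteratedFDeriv (m := i) (by exact_mod_cast le_top)).continuousOn
  choose A hA using h
  refine ⟨1 + ∑ i ∈ Finset.range (N + 1), |A i|, ?_, fun i hi x hx => (hA i x hx).trans ?_⟩
  · linarith [Finset.sum_nonneg fun i (_ : i ∈ Finset.range (N + 1)) => abs_nonneg (A i)]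
  · have := Finset.single_le_sum (f := fun i => |A i|) (fun i _ => abs_nonneg (A i))
      (Finset.mem_range.2 (Nat.lt_succ_of_le hi))
    have h2 := le_abs_self (A i)
    linarith

/-- The quadratic form `h ^ 2 + x y`. -/
def quad (p : Fin 3 → ℝ) : ℝ := p 0 ^ 2 + p 1 * p 2

theorem contDiff_quad : ContDiff ℝ ((⊤ : ℕ∞) : WithTop ℕ∞) quad := by
  unfold quad
  fun_prop

theorem qOp_pow_apply (k : ℕ) (f : 𝓓(U, ℝ)) (p : Fin 3 → ℝ) :
    ((qOp ^ k : Module.End ℝ 𝓓(U, ℝ)) f) p = quad p ^ k * f p := by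
  induction k with
  | zero => simp
  | succ k ih =>
    rw [pow_succ', Module.End.mul_apply, qOp_apply, ih, pow_succ, quad]
    ring

theorem mulQ_pow_apply (k : ℕ) (T : 𝓓(U, ℝ) →ₗ[ℝ] V) (f : 𝓓(U, ℝ)) :
    (mulQ ^ k) T f = T ((qOp ^ k : Module.End ℝ 𝓓(U, ℝ)) f) := by
  induction k generalizing f with
  | zero => simp
  | succ k ih =>
    rw [pow_succ', Module.End.mul_apply, mulQ_apply, ih, ← Module.End.mul_apply, ← pow_succ]

theorem contDiff_comp_quad {ψ : ℝ → ℝ} (hψ : ContDiff ℝ ((⊤ : ℕ∞) : WithTop ℕ∞) ψ) (l : ℝ) :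
    ContDiff ℝ ((⊤ : ℕ∞) : WithTop ℕ∞) (fun p => ψ (l * quad p)) :=
  hψ.comp (contDiff_const.mul contDiff_quad)

/-- A distribution supported on the cone is killed by a power of the quadratic form, on test
functions supported in a fixed compact set. -/
theorem exists_qOp_pow_eq_zero (T : 𝓓'(U, V))
    (hT : ∀ f : 𝓓(U, ℝ), tsupport f ⊆ (U : Set (Fin 3 → ℝ)) \ nilCone → T f = 0)
    {K : Set (Fin 3 → ℝ)} (hK : IsCompact K) (hKU : K ⊆ U) :
    ∃ M : ℕ, ∀ f : 𝓓(U, ℝ), tsupport f ⊆ K →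
      T ((qOp ^ M : Module.End ℝ 𝓓(U, ℝ)) f) = 0 := by
  obtain ⟨N, C, hC, hb⟩ := exists_seminorm_bound T hK hKU
  refine ⟨N + 1, fun f hf => ?_⟩
  obtain ⟨χ, hχ, hχz, hχ1⟩ := exists_cutoff 0 (r := 1) one_pos
  set ψ : ℝ → ℝ := fun s => s ^ (N + 1) * χ s with hψdef
  have hψ : ContDiff ℝ ((⊤ : ℕ∞) : WithTop ℕ∞) ψ := (contDiff_id.pow _).mul hχ
  have hψc : HasCompactSupport ψ := HasCompactSupport.intro (K := Set.Icc (-1) 1) isCompact_Icc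
    fun s hs => by
      have : χ s = 0 := hχz s (by simpa using hs)
      simp [hψdef, this]
  obtain ⟨A, hA1, hA⟩ := exists_iteratedFDeriv_bound f.contDiff hK N
  obtain ⟨D, hD1, hD⟩ := exists_iteratedFDeriv_bound contDiff_quad hK N
  obtain ⟨P, hP1, hP'⟩ := exists_iteratedFDeriv_bound hψ hψc N
  have hP : ∀ i ≤ N, ∀ s, ‖iteratedFDeriv ℝ i ψ s‖ ≤ P := by
    intro i hi s
    by_cases hs : s ∈ tsupport ψ
    · exact hP' i hi s hs
    · rw [image_eq_zero_of_notMem_tsupport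
        (fun h => hs (tsupport_iteratedFDeriv_subset i h)), norm_zero]
      linarith
  -- the localized functional
  have key : ∀ l : ℝ, 1 ≤ l → ‖T ((qOp ^ (N + 1) : Module.End ℝ 𝓓(U, ℝ)) f)‖ * l ≤
      C * (2 ^ N * (A * (N.factorial * P * D ^ N))) := by
    intro l hl
    have hl0 : 0 < l := by linarith
    set g := mulOp _ (contDiff_comp_quad hψ l) f with hg
    have e1 : T g = l ^ (N + 1) • T ((qOp ^ (N + 1) : Module.End ℝ 𝓓(U, ℝ)) f) := by
      rw [← map_smul, ← sub_eq_zero, ← map_sub]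
      refine hT _ fun p hp => ⟨TestFunction.tsupport_subset _ hp, fun hpc => ?_⟩
      have hn : ∀ᶠ z in nhds p, χ (l * quad z) = 1 := by
        have hcont : Continuous fun z => l * quad z := continuous_const.mul contDiff_quad.continuous
        have hm : Set.Icc ((0 : ℝ) - 1 / 2) (0 + 1 / 2) ∈ nhds (l * quad p) := by
          have : quad p = 0 := hpc
          rw [this, mul_zero]
          exact Icc_mem_nhds (by norm_num) (by norm_num)
        filter_upwards [hcont.continuousAt.preimage_mem_nhds hm] with z hz using hχ1 _ hz
      have hz : (⇑(g - l ^ (N + 1) • (qOp ^ (N + 1) : Module.End ℝ 𝓓(U, ℝ)) f)) =ᶠ[nhds p] 0 := by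
        filter_upwards [hn] with z hz
        change ψ (l * quad z) * f z -
          l ^ (N + 1) * ((qOp ^ (N + 1) : Module.End ℝ 𝓓(U, ℝ)) f) z = 0
        rw [qOp_pow_apply, hψdef]
        simp only [hz, mul_one, mul_pow]
        ring
      exact (notMem_tsupport_iff_eventuallyEq.2 hz) hp
    have e2 : ‖T g‖ ≤ C * (2 ^ N * (A * (N.factorial * P * (l * D) ^ N))) := by
      have hlD : 1 ≤ l * D := one_le_mul_of_one_le_of_one_le hl hD1
      have hNf : (1 : ℝ) ≤ N.factorial := by exact_mod_cast N.factorial_pos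
      have hcomp : ∀ i ≤ N, ∀ x ∈ K, ‖iteratedFDeriv ℝ i (fun p => ψ (l * quad p)) x‖ ≤
          N.factorial * P * (l * D) ^ N := by
        intro i hi x hx
        have h1 := norm_iteratedFDeriv_comp_le (g := ψ) (f := fun p => l * quad p) (n := i)
          hψ (contDiff_const.mul contDiff_quad) (by exact_mod_cast le_top) x (C := P) (D := l * D)
          (fun j hj => hP j (hj.trans hi) _) (fun j hj1 hj => by
            have h2 : iteratedFDeriv ℝ j (fun p => l * quad p) x = l • iteratedFDeriv ℝ j quad x :=
              iteratedFDeriv_const_smul_apply (a := l)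
                (contDiff_quad.contDiffAt.of_le (by exact_mod_cast le_top))
            rw [h2, norm_smul, Real.norm_of_nonneg hl0.le]
            calc l * ‖iteratedFDeriv ℝ j quad x‖ ≤ l * D :=
                  mul_le_mul_of_nonneg_left (hD j (hj.trans hi) x hx) hl0.le
              _ ≤ (l * D) ^ j := le_self_pow₀ hlD (by omega))
        refine h1.trans ?_
        have : (i.factorial : ℝ) ≤ N.factorial := by exact_mod_cast Nat.factorial_le hi
        gcongr
      refine hb g _ (by positivity) ((tsupport_mulOp_subset _ _ f).trans hf) fun i hi x hx => ?_
      have h1 := norm_iteratedFDeriv_mul_le (contDiff_comp_quad hψ l) f.contDiff x (n := i)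
        (by exact_mod_cast le_top)
      refine h1.trans ?_
      calc ∑ j ∈ Finset.range (i + 1), (i.choose j : ℝ) *
            ‖iteratedFDeriv ℝ j (fun p => ψ (l * quad p)) x‖ * ‖iteratedFDeriv ℝ (i - j) f x‖
          ≤ ∑ j ∈ Finset.range (i + 1), (i.choose j : ℝ) *
            (A * (N.factorial * P * (l * D) ^ N)) := by
            refine Finset.sum_le_sum fun j hj => ?_
            rw [mul_assoc, mul_comm A]
            have hj' : j ≤ i := Nat.lt_succ_iff.1 (Finset.mem_range.1 hj)
            have := hcomp j (hj'.trans hi) x hx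
            have := hA (i - j) ((Nat.sub_le _ _).trans hi) x hx
            gcongr
        _ = 2 ^ i * (A * (N.factorial * P * (l * D) ^ N)) := by
            rw [← Finset.sum_mul]
            congr 1
            exact_mod_cast Nat.sum_range_choose i
        _ ≤ 2 ^ N * (A * (N.factorial * P * (l * D) ^ N)) := by
            gcongr
            norm_num
    rw [e1, norm_smul, norm_pow, Real.norm_of_nonneg hl0.le, mul_pow] at e2
    have hlN : 0 < l ^ N := by positivity
    rw [← mul_le_mul_iff_right₀ hlN]
    calc l ^ N * (‖T ((qOp ^ (N + 1) : Module.End ℝ 𝓓(U, ℝ)) f)‖ * l)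
        = l ^ (N + 1) * ‖T ((qOp ^ (N + 1) : Module.End ℝ 𝓓(U, ℝ)) f)‖ := by ring
      _ ≤ _ := e2
      _ = _ := by ring
  by_contra hne
  have hpos : 0 < ‖T ((qOp ^ (N + 1) : Module.End ℝ 𝓓(U, ℝ)) f)‖ := norm_pos_iff.2 hne
  set B := C * (2 ^ N * (A * (N.factorial * P * D ^ N))) with hB
  obtain ⟨l, hl⟩ := exists_gt (max 1 (B / ‖T ((qOp ^ (N + 1) : Module.End ℝ 𝓓(U, ℝ)) f)‖))
  have h1 := key l (le_of_lt ((le_max_left _ _).trans_lt hl))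
  have h2 : B / ‖T ((qOp ^ (N + 1) : Module.End ℝ 𝓓(U, ℝ)) f)‖ < l := (le_max_right _ _).trans_lt hl
  rw [div_lt_iff₀ hpos] at h2
  linarith [mul_comm l ‖T ((qOp ^ (N + 1) : Module.End ℝ 𝓓(U, ℝ)) f)‖]

end FiniteOrder
end SlTwo
end

noncomputable section
namespace SlTwo

/-! ### Localization of linear functionals on test functions -/

section Local

open Set Topology

variable {U : Opens (Fin 3 → ℝ)}

theorem exists_zOp_eq (i : Fin 3) (f : 𝓓(U, ℝ)) (hf : ∀ p ∈ tsupport f, p i ≠ 0) :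
    ∃ g : 𝓓(U, ℝ), zOp i g = f ∧ tsupport g ⊆ tsupport f := by
  have hsub : tsupport (fun p => (p i)⁻¹ * f p) ⊆ tsupport f :=
    closure_mono (Function.support_mul_subset_right _ _)
  refine ⟨⟨fun p => (p i)⁻¹ * f p, ?_, f.hasCompactSupport.mul_left,
    hsub.trans f.tsupport_subset⟩, ?_, hsub⟩
  · refine contDiff_iff_contDiffAt.2 fun p => ?_
    by_cases hp : p ∈ tsupport f
    · exact ((contDiff_apply ℝ ℝ i).contDiffAt.inv (hf p hp)).mul f.contDiff.contDiffAt
    · refine (contDiffAt_const (c := (0 : ℝ))).congr_of_eventuallyEq ?_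
      filter_upwards [notMem_tsupport_iff_eventuallyEq.1 hp] with z hz
      simp [hz]
  · ext p
    change p i * ((p i)⁻¹ * f p) = f p
    by_cases hp : p ∈ tsupport f
    · field_simp [hf p hp]
    · simp [image_eq_zero_of_notMem_tsupport hp]

variable {V : Type*} [AddCommGroup V] [Module ℝ V]

theorem eq_zero_of_tsupport_subset_union (T : 𝓓(U, ℝ) →ₗ[ℝ] V) {W₁ W₂ : Set (Fin 3 → ℝ)}
    (h₁ : IsOpen W₁) (h₂ : IsOpen W₂) (hT₁ : ∀ f : 𝓓(U, ℝ), tsupport f ⊆ W₁ → T f = 0)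
    (hT₂ : ∀ f : 𝓓(U, ℝ), tsupport f ⊆ W₂ → T f = 0) (f : 𝓓(U, ℝ))
    (hf : tsupport f ⊆ W₁ ∪ W₂) : T f = 0 := by
  have hA : IsClosed (tsupport f \ W₂) := (isClosed_tsupport f).sdiff h₂
  obtain ⟨χ, hχ0, hχ1, -⟩ := exists_contMDiffMap_zero_one_nhds_of_isClosed
    (modelWithCornersSelf ℝ (Fin 3 → ℝ)) (n := (⊤ : ℕ∞)) h₁.isClosed_compl hA
    (disjoint_left.2 fun p hp hp' => by
      rcases hf hp'.1 with h | h
      · exact hp h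
      · exact hp'.2 h)
  have hχ : ContDiff ℝ ((⊤ : ℕ∞) : WithTop ℕ∞) χ := χ.contMDiff.contDiff
  have e : f = mulOp χ hχ f + (f - mulOp χ hχ f) := by abel
  have e1 : T (mulOp χ hχ f) = 0 := by
    refine hT₁ _ fun p hp => ?_
    by_contra hpW
    refine (notMem_tsupport_iff_eventuallyEq.2 ?_) hp
    filter_upwards [hχ0.filter_mono (nhds_le_nhdsSet (show p ∈ W₁ᶜ from hpW))] with z hz
    simp [hz]
  have hsub : tsupport (f - mulOp χ hχ f) ⊆ tsupport f := by
    refine closure_mono fun p hp hp' => hp ?_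
    change f p - χ p * f p = 0
    simp [hp']
  have e2 : T (f - mulOp χ hχ f) = 0 := by
    refine hT₂ _ fun p hp => ?_
    by_contra hpW
    refine (notMem_tsupport_iff_eventuallyEq.2 ?_) hp
    filter_upwards [hχ1.filter_mono (nhds_le_nhdsSet (show p ∈ tsupport f \ W₂ from ⟨hsub hp, hpW⟩))] with z hz
    change f z - χ z * f z = 0
    simp [hz]
  rw [e, map_add, e1, e2, add_zero]

/-- A linear functional on test functions that vanishes near every point is zero. -/
theorem eq_zero_of_locally_zero (T : 𝓓(U, ℝ) →ₗ[ℝ] V)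
    (hT : ∀ p ∈ U, ∃ W ∈ 𝓝 p, ∀ f : 𝓓(U, ℝ), tsupport f ⊆ W → T f = 0) : T = 0 := by
  have key : ∀ K : Set (Fin 3 → ℝ), IsCompact K → K ⊆ U → ∃ W : Set (Fin 3 → ℝ), IsOpen W ∧ K ⊆ W ∧
      ∀ f : 𝓓(U, ℝ), tsupport f ⊆ W → T f = 0 := by
    intro K hK hKU
    refine hK.induction_on (p := fun K => ∃ W : Set (Fin 3 → ℝ), IsOpen W ∧ K ⊆ W ∧
      ∀ f : 𝓓(U, ℝ), tsupport f ⊆ W → T f = 0) ?_ ?_ ?_ ?_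
    · refine ⟨∅, isOpen_empty, Subset.rfl, fun f hf => ?_⟩
      have h0 : (f : (Fin 3 → ℝ) → ℝ) = 0 := tsupport_eq_empty_iff.1 (subset_empty_iff.1 hf)
      have : f = 0 := by
        ext p
        exact congrFun h0 p
      rw [this, map_zero]
    · rintro s t hst ⟨W, hW, htW, h⟩
      exact ⟨W, hW, hst.trans htW, h⟩
    · rintro s t ⟨W, hW, hsW, h⟩ ⟨W', hW', htW', h'⟩
      exact ⟨W ∪ W', hW.union hW', union_subset_union hsW htW',
        eq_zero_of_tsupport_subset_union T hW hW' h h'⟩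
    · intro p hp
      obtain ⟨W, hW, h⟩ := hT p (hKU hp)
      exact ⟨interior W, mem_nhdsWithin_of_mem_nhds (interior_mem_nhds.2 hW), interior W,
        isOpen_interior, Subset.rfl, fun f hf => h f (hf.trans interior_subset)⟩
  ext f
  obtain ⟨W, -, hKW, h⟩ := key _ f.hasCompactSupport f.tsupport_subset
  exact h f hKW

/-- A linear retraction of the inclusion of test functions into all functions. -/
theorem exists_retraction (U : Opens (Fin 3 → ℝ)) :
    ∃ r : ((Fin 3 → ℝ) → ℝ) →ₗ[ℝ] 𝓓(U, ℝ), ∀ f : 𝓓(U, ℝ), r f = f := by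
  let i : 𝓓(U, ℝ) →ₗ[ℝ] ((Fin 3 → ℝ) → ℝ) :=
    { toFun := fun f => f, map_add' := fun _ _ => rfl, map_smul' := fun _ _ => rfl }
  obtain ⟨r, hr⟩ := LinearMap.exists_leftInverse_of_injective i
    (LinearMap.ker_eq_bot.2 DFunLike.coe_injective)
  exact ⟨r, fun f => LinearMap.congr_fun hr f⟩

/-- The test function on `U` given by a smooth function with compact support in `U`. -/
def IsTest.toTest {f : (Fin 3 → ℝ) → ℝ} (hf : IsTest U f) : 𝓓(U, ℝ) := ⟨f, hf.1, hf.2, hf.3⟩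

theorem IsTest.of_testFunction (f : 𝓓(U, ℝ)) {O : Set (Fin 3 → ℝ)} (hf : tsupport f ⊆ O) :
    IsTest O f := ⟨f.contDiff, f.hasCompactSupport, hf⟩

end Local

/-! ### Invariant functionals are determined near one point of the cone -/

section Gluing

open Set Topology

variable {U : Opens (Fin 3 → ℝ)} {V : Type*} [NormedAddCommGroup V] [NormedSpace ℝ V]
  [LieRingModule Sl V]

/-- Coordinate functionals `ξ 0, …, ξ n` for a basis of weight vectors of an irreducible
representation of dimension `n + 1`. -/
structure IsWeightSystem (n : ℕ) (ξ : ℕ → V →ₗ[ℝ] ℝ) : Prop where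
  lie_H : ∀ j v, ξ j ⁅ofCoords cH, v⁆ = (n - 2 * j : ℝ) * ξ j v
  lie_X : ∀ j v, ξ j ⁅ofCoords cX, v⁆ = (n - j : ℝ) * ξ (j + 1) v
  lie_Y : ∀ j ≤ n, ∀ v, ξ j ⁅ofCoords cY, v⁆ = (j : ℝ) * ξ (j - 1) v
  eq_zero_of_lt : ∀ j, n < j → ξ j = 0
  separates : ∀ v, (∀ j, ξ j v = 0) → v = 0

variable [LieModule ℝ Sl V] {n : ℕ} {ξ : ℕ → V →ₗ[ℝ] ℝ}

theorem lieDeriv_Y_eq_fieldY (f : 𝓓(U, ℝ)) :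
    (lieDeriv (ofCoords cY) f : (Fin 3 → ℝ) → ℝ) = fieldY f := by
  funext p
  change fderiv ℝ f p _ = fderiv ℝ f p _
  congr 1
  rw [symm_lie_ofCoords]
  funext i
  fin_cases i <;> simp

theorem lieDeriv_X_eq_fieldX (f : 𝓓(U, ℝ)) :
    (lieDeriv (ofCoords cX) f : (Fin 3 → ℝ) → ℝ) = fieldX f := by
  funext p
  change fderiv ℝ f p _ = fderiv ℝ f p _
  congr 1
  rw [symm_lie_ofCoords]
  funext i
  fin_cases i <;> simp

theorem lieDeriv_H_eq_fieldH (f : 𝓓(U, ℝ)) :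
    (lieDeriv (ofCoords cH) f : (Fin 3 → ℝ) → ℝ) = fieldH f := by
  funext p
  change fderiv ℝ f p _ = fderiv ℝ f p _
  congr 1
  rw [symm_lie_ofCoords]
  funext i
  fin_cases i <;> simp

theorem IsWeightSystem.isBorelEquivariant (hξ : IsWeightSystem n ξ) {T : 𝓓(U, ℝ) →ₗ[ℝ] V}
    (hT : T ∈ algInv U V) {r : ((Fin 3 → ℝ) → ℝ) →ₗ[ℝ] 𝓓(U, ℝ)} (hr : ∀ f : 𝓓(U, ℝ), r f = f) :
    IsBorelEquivariant U n (ξ 0 ∘ₗ T ∘ₗ r) := by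
  constructor
  · intro f hf
    have h : fieldY f = lieDeriv (ofCoords cY) hf.toTest := (lieDeriv_Y_eq_fieldY hf.toTest).symm
    rw [h, LinearMap.comp_apply, LinearMap.comp_apply, hr, ← hT.1, hξ.lie_Y 0 (Nat.zero_le _)]
    simp
  · intro f hf
    have h : fieldH f = lieDeriv (ofCoords cH) hf.toTest := (lieDeriv_H_eq_fieldH hf.toTest).symm
    have h' : r f = hf.toTest := hr hf.toTest
    rw [h, LinearMap.comp_apply, LinearMap.comp_apply, hr, ← hT.1, hξ.lie_H, LinearMap.comp_apply,
      LinearMap.comp_apply, h']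
    simp

theorem IsWeightSystem.isOppBorelEquivariant (hξ : IsWeightSystem n ξ) {T : 𝓓(U, ℝ) →ₗ[ℝ] V}
    (hT : T ∈ algInv U V) {r : ((Fin 3 → ℝ) → ℝ) →ₗ[ℝ] 𝓓(U, ℝ)} (hr : ∀ f : 𝓓(U, ℝ), r f = f) :
    IsOppBorelEquivariant U (-n) (ξ n ∘ₗ T ∘ₗ r) := by
  constructor
  · intro f hf
    have h : fieldX f = lieDeriv (ofCoords cX) hf.toTest := (lieDeriv_X_eq_fieldX hf.toTest).symm
    rw [h, LinearMap.comp_apply, LinearMap.comp_apply, hr, ← hT.1, hξ.lie_X]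
    simp
  · intro f hf
    have h : fieldH f = lieDeriv (ofCoords cH) hf.toTest := (lieDeriv_H_eq_fieldH hf.toTest).symm
    have h' : r f = hf.toTest := hr hf.toTest
    rw [h, LinearMap.comp_apply, LinearMap.comp_apply, hr, ← hT.1, hξ.lie_H, LinearMap.comp_apply,
      LinearMap.comp_apply, h']
    change (n - 2 * n : ℝ) * _ = -(n : ℝ) * _
    congr 1
    ring

/-- The isotropy relation in weight coordinates. -/
theorem IsWeightSystem.isotropy (hξ : IsWeightSystem n ξ) {T : 𝓓(U, ℝ) →ₗ[ℝ] V}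
    (hT : T ∈ algInv U V) {j : ℕ} (hj : j ≤ n) (f : 𝓓(U, ℝ)) :
    (n - j : ℝ) * ξ (j + 1) (T (zOp 1 f)) + (n - 2 * j : ℝ) * ξ j (T (zOp 0 f)) +
      (j : ℝ) * ξ (j - 1) (T (zOp 2 f)) = 0 := by
  have h := congrArg (ξ j) (SlTwo.isotropy hT f)
  rw [map_add, map_add, hξ.lie_H, hξ.lie_X, hξ.lie_Y j hj, map_zero] at h
  linarith

theorem IsWeightSystem.eq_zero_of_zero_pos (hξ : IsWeightSystem n ξ) {T : 𝓓(U, ℝ) →ₗ[ℝ] V}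
    (hT : T ∈ algInv U V) {B : Set (Fin 3 → ℝ)} (hB : B ⊆ {p | 0 < p 1})
    (h : ∀ f : 𝓓(U, ℝ), tsupport f ⊆ B → ξ 0 (T f) = 0) (f : 𝓓(U, ℝ)) (hf : tsupport f ⊆ B) :
    T f = 0 := by
  have key : ∀ j, ∀ f : 𝓓(U, ℝ), tsupport f ⊆ B → ξ j (T f) = 0 := by
    intro j
    induction j using Nat.strong_induction_on with
    | _ j ih =>
      intro f hf
      rcases j with _ | j
      · exact h f hf
      rcases Nat.lt_or_ge n (j + 1) with hn | hn
      · simp [hξ.eq_zero_of_lt _ hn]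
      obtain ⟨g, rfl, hg⟩ := exists_zOp_eq 1 f fun p hp => (hB (hf hp)).ne'
      have h1 := hξ.isotropy hT (Nat.le_of_succ_le hn) g
      rw [ih j (Nat.lt_succ_self j) (zOp 0 g) ((tsupport_zOp_subset _ _).trans (hg.trans hf)),
        ih (j - 1) (by omega) (zOp 2 g) ((tsupport_zOp_subset _ _).trans (hg.trans hf))] at h1
      have hne : (n - j : ℝ) ≠ 0 := by
        rw [sub_ne_zero]
        exact_mod_cast (by omega : n ≠ j)
      simpa [hne] using h1
  exact hξ.separates _ fun j => key j f hf

theorem IsWeightSystem.eq_zero_of_zero_neg (hξ : IsWeightSystem n ξ) {T : 𝓓(U, ℝ) →ₗ[ℝ] V}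
    (hT : T ∈ algInv U V) {B : Set (Fin 3 → ℝ)} (hB : B ⊆ {p | p 2 < 0})
    (h : ∀ f : 𝓓(U, ℝ), tsupport f ⊆ B → ξ n (T f) = 0) (f : 𝓓(U, ℝ)) (hf : tsupport f ⊆ B) :
    T f = 0 := by
  have key : ∀ k j, j + k = n → ∀ f : 𝓓(U, ℝ), tsupport f ⊆ B → ξ j (T f) = 0 := by
    intro k
    induction k using Nat.strong_induction_on with
    | _ k ih =>
      intro j hj f hf
      rcases k with _ | k
      · rw [add_zero] at hj
        rw [hj]
        exact h f hf
      obtain ⟨g, rfl, hg⟩ := exists_zOp_eq 2 f fun p hp => (hB (hf hp)).ne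
      have hz : ∀ i, tsupport (zOp i g) ⊆ B := fun i =>
        (tsupport_zOp_subset _ _).trans (hg.trans hf)
      have h1 := hξ.isotropy hT (j := j + 1) (by omega) g
      rw [ih k (Nat.lt_succ_self k) (j + 1) (by omega) (zOp 0 g) (hz 0)] at h1
      have h2 : ξ (j + 1 + 1) (T (zOp 1 g)) = 0 := by
        rcases k with _ | k
        · simp [hξ.eq_zero_of_lt (j + 1 + 1) (by omega)]
        · exact ih k (by omega) _ (by omega) _ (hz 1)
      rw [h2] at h1
      have hne : (j + 1 : ℝ) ≠ 0 := by positivity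
      simpa [hne] using h1
  refine hξ.separates _ fun j => ?_
  rcases Nat.lt_or_ge n j with hn | hn
  · simp [hξ.eq_zero_of_lt _ hn]
  · exact key (n - j) j (by omega) f hf

/-- Unique continuation near a point of the cone other than the vertex. -/
theorem IsWeightSystem.exists_nhds_eq_zero (hξ : IsWeightSystem n ξ) {p₀ : Fin 3 → ℝ}
    (hp₀ : p₀ ∈ U) (hsign : 0 < p₀ 1 ∨ p₀ 2 < 0) :
    ∃ B ∈ 𝓝 p₀, ∀ T ∈ algInv U V, ∀ p' ∈ B ∩ nilCone, ∀ W ∈ 𝓝 p',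
      (∀ f : 𝓓(U, ℝ), tsupport f ⊆ W → T f = 0) →
        ∀ f : 𝓓(U, ℝ), tsupport f ⊆ B → T f = 0 := by
  obtain ⟨r, hr⟩ := exists_retraction U
  have hr' : ∀ (η : V →ₗ[ℝ] ℝ) (T : 𝓓(U, ℝ) →ₗ[ℝ] V) (W : Set (Fin 3 → ℝ)),
      (∀ f : 𝓓(U, ℝ), tsupport f ⊆ W → T f = 0) →
        ∀ f, IsTest (U ∩ W) f → (η ∘ₗ T ∘ₗ r) f = 0 := by
    intro η T W h f hf
    have h' : f = (hf.mono inter_subset_left).toTest := rfl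
    rw [h', LinearMap.comp_apply, LinearMap.comp_apply, hr,
      h (hf.mono inter_subset_left).toTest (hf.3.trans inter_subset_right), map_zero]
  have hcone : ∀ (η : V →ₗ[ℝ] ℝ), ∀ T ∈ algInv U V, ∀ f, IsTest ((U : Set (Fin 3 → ℝ)) \ nilCone) f →
      (η ∘ₗ T ∘ₗ r) f = 0 := by
    intro η T hT f hf
    exact hr' η T _ hT.2 f (hf.mono fun p hp => ⟨hp.1, hp⟩)
  rcases hsign with hpos | hneg
  · obtain ⟨B, hB, hpB, hBpos, h⟩ := unique_continuation_pos U.isOpen hp₀ hpos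
    refine ⟨B, hB.mem_nhds hpB, fun T hT p' hp' W hW hTW => hξ.eq_zero_of_zero_pos hT hBpos ?_⟩
    intro f hf
    have h1 := h n _ (hξ.isBorelEquivariant hT hr) (hcone _ T hT) p' hp' W hW (hr' _ T W hTW) f
      (IsTest.of_testFunction f hf)
    simpa [hr] using h1
  · obtain ⟨B, hB, hpB, hBneg, h⟩ := unique_continuation_neg U.isOpen hp₀ hneg
    refine ⟨B, hB.mem_nhds hpB, fun T hT p' hp' W hW hTW => hξ.eq_zero_of_zero_neg hT hBneg ?_⟩
    intro f hf
    have h1 := h (-n) _ (hξ.isOppBorelEquivariant hT hr) (hcone _ T hT) p' hp' W hW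
      (hr' _ T W hTW) f (IsTest.of_testFunction f hf)
    simpa [hr] using h1

/-- An invariant functional supported on a connected piece of the cone minus its vertex is zero as
soon as it vanishes near one point of the cone. -/
theorem IsWeightSystem.eq_zero_of_nhds (hξ : IsWeightSystem n ξ)
    (hconn : IsPreconnected ((U : Set (Fin 3 → ℝ)) ∩ nilCone))
    (hsign : ∀ p ∈ (U : Set (Fin 3 → ℝ)) ∩ nilCone, 0 < p 1 ∨ p 2 < 0)
    {T : 𝓓(U, ℝ) →ₗ[ℝ] V} (hT : T ∈ algInv U V) {p₀ : Fin 3 → ℝ}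
    (hp₀ : p₀ ∈ (U : Set (Fin 3 → ℝ)) ∩ nilCone) {W : Set (Fin 3 → ℝ)} (hW : W ∈ 𝓝 p₀)
    (hTW : ∀ f : 𝓓(U, ℝ), tsupport f ⊆ W → T f = 0) : T = 0 := by
  set Z : Set (Fin 3 → ℝ) := {p | ∃ W ∈ 𝓝 p, ∀ f : 𝓓(U, ℝ), tsupport f ⊆ W → T f = 0} with hZ
  have hZo : IsOpen Z := by
    rw [isOpen_iff_mem_nhds]
    rintro p ⟨W, hW, h⟩
    filter_upwards [eventually_mem_nhds_iff.2 hW] with q hq using ⟨W, hq, h⟩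
  set Z' : Set (Fin 3 → ℝ) := interior ((Z ∩ nilCone)ᶜ) with hZ'
  have hcover : (U : Set (Fin 3 → ℝ)) ∩ nilCone ⊆ Z ∪ Z' := by
    intro p hp
    by_cases hpZ : p ∈ Z'
    · exact Or.inr hpZ
    left
    rw [hZ', interior_compl, notMem_compl_iff] at hpZ
    obtain ⟨B, hB, h⟩ := hξ.exists_nhds_eq_zero hp.1 (hsign p hp)
    obtain ⟨p', hp'B, ⟨W', hW', hTW'⟩, hp'N⟩ := mem_closure_iff_nhds.1 hpZ B hB
    exact ⟨B, hB, h T hT p' ⟨hp'B, hp'N⟩ W' hW' hTW'⟩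
  have hsub : (U : Set (Fin 3 → ℝ)) ∩ nilCone ⊆ Z := by
    intro p hp
    rcases hcover hp with h | h
    · exact h
    obtain ⟨p', hp', hp'Z, hp'Z'⟩ := hconn Z Z' hZo isOpen_interior hcover
      ⟨p₀, hp₀, W, hW, hTW⟩ ⟨p, hp, h⟩
    exact absurd ⟨hp'Z, hp'.2⟩ (interior_subset hp'Z')
  refine eq_zero_of_locally_zero T fun p hp => ?_
  by_cases hpN : p ∈ nilCone
  · exact hsub ⟨hp, hpN⟩
  · have hcl : IsClosed nilCone := by
      have : nilCone = quad ⁻¹' {0} := rfl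
      rw [this]
      exact isClosed_singleton.preimage contDiff_quad.continuous
    exact ⟨(U : Set (Fin 3 → ℝ)) \ nilCone, (U.isOpen.sdiff hcl).mem_nhds ⟨hp, hpN⟩, hT.2⟩

/-- An invariant functional killed by the quadratic form is determined by one number. -/
theorem IsWeightSystem.exists_determining (hξ : IsWeightSystem n ξ)
    (hconn : IsPreconnected ((U : Set (Fin 3 → ℝ)) ∩ nilCone))
    (hsign : ∀ p ∈ (U : Set (Fin 3 → ℝ)) ∩ nilCone, 0 < p 1 ∨ p 2 < 0)
    {p₀ : Fin 3 → ℝ} (hp₀ : p₀ ∈ (U : Set (Fin 3 → ℝ)) ∩ nilCone) (hpos : 0 < p₀ 1) :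
    ∃ χ : 𝓓(U, ℝ), ∀ T ∈ algInv U V, mulQ T = 0 → ξ 0 (T χ) = 0 → T = 0 := by
  obtain ⟨r, hr⟩ := exists_retraction U
  obtain ⟨B, hB, hpB, hBpos, χ, hχ, h⟩ := exists_determining_test U.isOpen hp₀.1 hpos hp₀.2 n
  refine ⟨hχ.toTest, fun T hT hq hTχ => ?_⟩
  refine hξ.eq_zero_of_nhds hconn hsign hT hp₀ (hB.mem_nhds hpB)
    (hξ.eq_zero_of_zero_pos hT hBpos fun f hf => ?_)
  have h1 := h _ (hξ.isBorelEquivariant hT hr) (fun f hf => ?_) ?_ f (IsTest.of_testFunction f hf)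
  · simpa [hr] using h1
  · have e : (fun p : Fin 3 → ℝ => (p 0 ^ 2 + p 1 * p 2) * f p) = qOp hf.toTest := by
      funext p
      rw [qOp_apply]
      rfl
    rw [e, LinearMap.comp_apply, LinearMap.comp_apply, hr, ← mulQ_apply, hq]
    simp
  · have e : χ = hχ.toTest := rfl
    rw [e, LinearMap.comp_apply, LinearMap.comp_apply, hr, hTχ]

theorem IsWeightSystem.exists_mulQ_pow_eq_zero (hξ : IsWeightSystem n ξ)
    (hconn : IsPreconnected ((U : Set (Fin 3 → ℝ)) ∩ nilCone))
    (hsign : ∀ p ∈ (U : Set (Fin 3 → ℝ)) ∩ nilCone, 0 < p 1 ∨ p 2 < 0)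
    {p₀ : Fin 3 → ℝ} (hp₀ : p₀ ∈ (U : Set (Fin 3 → ℝ)) ∩ nilCone) (T : 𝓓'(U, V))
    (hT : (T : 𝓓(U, ℝ) →L[ℝ] V).toLinearMap ∈ algInv U V) :
    ∃ M : ℕ, (mulQ ^ M) (T : 𝓓(U, ℝ) →L[ℝ] V).toLinearMap = 0 := by
  obtain ⟨K, hK, hKU, hKc⟩ := local_compact_nhds (U.isOpen.mem_nhds hp₀.1)
  obtain ⟨M, hM⟩ := exists_qOp_pow_eq_zero T hT.2 hKc hKU
  refine ⟨M, hξ.eq_zero_of_nhds hconn hsign (mulQ_pow_mem hT M) hp₀ hK fun f hf => ?_⟩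
  rw [mulQ_pow_apply]
  exact hM f hf

/-- Iterated contractions of a functional with `h` and `x`. -/
def contraction (S : ℕ → 𝓓(U, ℝ) →ₗ[ℝ] ℝ) : ℕ → ℕ → 𝓓(U, ℝ) →ₗ[ℝ] ℝ
  | 0, i => S i
  | j + 1, i => contraction S j i ∘ₗ zOp 0 + contraction S j (i + 1) ∘ₗ zOp 1

theorem contraction_succ_apply (S : ℕ → 𝓓(U, ℝ) →ₗ[ℝ] ℝ) (j i : ℕ) (f : 𝓓(U, ℝ)) :
    contraction S (j + 1) i f =
      contraction S j i (zOp 0 f) + contraction S j (i + 1) (zOp 1 f) := rfl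

theorem qOp_zOp (i : Fin 3) (f : 𝓓(U, ℝ)) : qOp (zOp i f) = zOp i (qOp f) := by
  ext p
  simp only [qOp_apply, zOp_apply]
  ring

theorem contraction_relation {S : ℕ → 𝓓(U, ℝ) →ₗ[ℝ] ℝ}
    (hS : ∀ i ≤ n, ∀ f, (n - i : ℝ) * S (i + 1) (zOp 1 f) + (n - 2 * i : ℝ) * S i (zOp 0 f) +
      (i : ℝ) * S (i - 1) (zOp 2 f) = 0) (j : ℕ) : ∀ i, i + j ≤ n → ∀ f : 𝓓(U, ℝ),
    (n - i - j : ℝ) * contraction S j (i + 1) (zOp 1 f) +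
      (n - 2 * i - j : ℝ) * contraction S j i (zOp 0 f) +
      (i : ℝ) * contraction S j (i - 1) (zOp 2 f) +
      (j : ℝ) * contraction S (j - 1) i (qOp f) = 0 := by
  induction j with
  | zero =>
    intro i hi f
    simpa [contraction] using hS i hi f
  | succ j ih =>
    intro i hi f
    have h1 := ih i (by omega) (zOp 0 f)
    have h2 := ih (i + 1) (by omega) (zOp 1 f)
    have h3 : (j : ℝ) * contraction S j i (qOp f) =
        (j : ℝ) * (contraction S (j - 1) i (qOp (zOp 0 f)) +
          contraction S (j - 1) (i + 1) (qOp (zOp 1 f))) := by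
      rcases j with _ | j
      · simp
      · rw [contraction_succ_apply, qOp_zOp, qOp_zOp]
        rfl
    have h4 : (i : ℝ) * contraction S (j + 1) (i - 1) (zOp 2 f) =
        (i : ℝ) * (contraction S j (i - 1) (zOp 2 (zOp 0 f)) +
          contraction S j i (zOp 1 (zOp 2 f))) := by
      rcases i with _ | i
      · simp
      · rw [contraction_succ_apply, zOp_comm 0 2]
        rfl
    have h5 : contraction S j i (qOp f) =
        contraction S j i (zOp 0 (zOp 0 f)) + contraction S j i (zOp 1 (zOp 2 f)) := by
      rw [qOp_apply', map_add]
    rw [h4, contraction_succ_apply, contraction_succ_apply, Nat.add_sub_cancel, zOp_comm 0 1]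
    rw [Nat.add_sub_cancel, zOp_comm 2 1, zOp_comm 0 1] at h2
    push_cast at h1 h2 ⊢
    linear_combination h1 + h2 + h3 + h5

theorem contraction_zero_relation {S : ℕ → 𝓓(U, ℝ) →ₗ[ℝ] ℝ}
    (hS : ∀ i ≤ n, ∀ f, (n - i : ℝ) * S (i + 1) (zOp 1 f) + (n - 2 * i : ℝ) * S i (zOp 0 f) +
      (i : ℝ) * S (i - 1) (zOp 2 f) = 0) {j : ℕ} (hj : j ≤ n) (f : 𝓓(U, ℝ)) :
    (n - j : ℝ) * contraction S (j + 1) 0 f + (j : ℝ) * contraction S (j - 1) 0 (qOp f) = 0 := by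
  have h := contraction_relation hS j 0 (by omega) f
  rw [contraction_succ_apply]
  push_cast at h
  linear_combination h

theorem qOp_pow_eq_zero_of_odd {m : ℕ} {S : ℕ → 𝓓(U, ℝ) →ₗ[ℝ] ℝ} (hn : n = 2 * m + 1)
    (hS : ∀ i ≤ n, ∀ f, (n - i : ℝ) * S (i + 1) (zOp 1 f) + (n - 2 * i : ℝ) * S i (zOp 0 f) +
      (i : ℝ) * S (i - 1) (zOp 2 f) = 0) (f : 𝓓(U, ℝ)) :
    S 0 ((qOp ^ (m + 1) : Module.End ℝ 𝓓(U, ℝ)) f) = 0 := by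
  have key : ∀ k ≤ m, ∃ c : ℝ, ∀ f : 𝓓(U, ℝ),
      S 0 ((qOp ^ k : Module.End ℝ 𝓓(U, ℝ)) f) = c * contraction S (2 * k) 0 f := by
    intro k
    induction k with
    | zero => exact fun _ => ⟨1, fun f => by simp [contraction]⟩
    | succ k ih =>
      intro hk
      obtain ⟨c, hc⟩ := ih (by omega)
      refine ⟨-c * (n - (2 * k + 1 : ℕ)) / (2 * k + 1 : ℕ), fun f => ?_⟩
      rw [pow_succ, Module.End.mul_apply, hc]
      have h := contraction_zero_relation hS (j := 2 * k + 1) (by omega) f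
      rw [Nat.add_sub_cancel] at h
      have hne : ((2 * k + 1 : ℕ) : ℝ) ≠ 0 := by positivity
      field_simp
      have e : 2 * (k + 1) = 2 * k + 1 + 1 := by ring
      rw [e]
      linear_combination c * h
  obtain ⟨c, hc⟩ := key m le_rfl
  rw [pow_succ, Module.End.mul_apply, hc]
  have h := contraction_zero_relation hS (j := n) le_rfl f
  rw [sub_self, zero_mul, zero_add] at h
  have hne : (n : ℝ) ≠ 0 := by
    rw [hn]
    positivity
  have h2 := (mul_eq_zero.1 h).resolve_left hne
  rw [hn, Nat.add_sub_cancel] at h2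
  rw [h2, mul_zero]

theorem IsWeightSystem.mulQ_pow_eq_zero_of_odd (hξ : IsWeightSystem n ξ) {m : ℕ}
    (hn : n = 2 * m + 1)
    (hconn : IsPreconnected ((U : Set (Fin 3 → ℝ)) ∩ nilCone))
    (hsign : ∀ p ∈ (U : Set (Fin 3 → ℝ)) ∩ nilCone, 0 < p 1 ∨ p 2 < 0)
    {p₀ : Fin 3 → ℝ} (hp₀ : p₀ ∈ (U : Set (Fin 3 → ℝ)) ∩ nilCone) (hpos : 0 < p₀ 1)
    {T : 𝓓(U, ℝ) →ₗ[ℝ] V} (hT : T ∈ algInv U V) : (mulQ ^ (m + 1)) T = 0 := by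
  have h := mulQ_pow_mem hT (m + 1)
  refine hξ.eq_zero_of_nhds hconn hsign h hp₀ ((eventually_pos hpos))
    (hξ.eq_zero_of_zero_pos h Subset.rfl fun f _ => ?_)
  rw [mulQ_pow_apply]
  exact qOp_pow_eq_zero_of_odd (S := fun i => ξ i ∘ₗ T) hn
    (fun i hi f => hξ.isotropy hT hi f) f

end Gluing
end SlTwo
end

noncomputable section
namespace SlTwo

/-! ### The moment map -/

section Moment

open Set Topology

/-- The action of the matrix with coordinates `z` on `ℝ²`. -/
def stdAct (z : Fin 3 → ℝ) (v : Fin 2 → ℝ) : Fin 2 → ℝ :=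
  ![z 0 * v 0 + z 1 * v 1, z 2 * v 0 - z 0 * v 1]

theorem contDiff_moment : ContDiff ℝ ((⊤ : ℕ∞) : WithTop ℕ∞) moment := by
  refine contDiff_pi.2 fun i => ?_
  fin_cases i
  · change ContDiff ℝ _ fun v : Fin 2 → ℝ => -(v 0 * v 1) / 2
    fun_prop
  · change ContDiff ℝ _ fun v : Fin 2 → ℝ => v 0 ^ 2 / 2
    fun_prop
  · change ContDiff ℝ _ fun v : Fin 2 → ℝ => -v 1 ^ 2 / 2
    fun_prop

theorem fderiv_moment (v u : Fin 2 → ℝ) :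
    fderiv ℝ moment v u = ![-(u 0 * v 1 + v 0 * u 1) / 2, v 0 * u 0, -(v 1 * u 1)] := by
  have h0 : HasFDerivAt (fun v : Fin 2 → ℝ => v 0)
      (ContinuousLinearMap.proj (R := ℝ) (φ := fun _ : Fin 2 => ℝ) 0) v := hasFDerivAt_apply 0 v
  have h1 : HasFDerivAt (fun v : Fin 2 → ℝ => v 1)
      (ContinuousLinearMap.proj (R := ℝ) (φ := fun _ : Fin 2 => ℝ) 1) v := hasFDerivAt_apply 1 v
  have hd := (contDiff_moment.differentiable (by simp) v).hasFDerivAt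
  have hi := fun i => hasFDerivAt_pi'.1 hd i
  funext i
  fin_cases i
  · have e := (hi 0).unique ((((h0.mul h1).neg)).mul_const (2 : ℝ)⁻¹)
    have := DFunLike.congr_fun e u
    simp at this
    simp [this]
    ring
  · have e := (hi 1).unique ((h0.pow 2).mul_const (2 : ℝ)⁻¹)
    have := DFunLike.congr_fun e u
    simp at this
    simp [this]
    ring
  · have e := (hi 2).unique (((h1.pow 2).neg).mul_const (2 : ℝ)⁻¹)
    have := DFunLike.congr_fun e u
    simp at this
    simp [this]
    ring

theorem fderiv_moment_stdAct (z : Fin 3 → ℝ) (v : Fin 2 → ℝ) :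
    fderiv ℝ moment v (stdAct z v) = ofCoords.symm ⁅ofCoords z, ofCoords (moment v)⁆ := by
  rw [fderiv_moment, symm_lie_ofCoords]
  funext i
  fin_cases i <;> simp [stdAct, moment] <;> ring

theorem fderiv_moment_self (v : Fin 2 → ℝ) : fderiv ℝ moment v v = (2 : ℝ) • moment v := by
  rw [fderiv_moment]
  funext i
  fin_cases i <;> simp [moment] <;> ring

theorem moment_mem_nilCone (v : Fin 2 → ℝ) : moment v ∈ nilCone := by
  change (-(v 0 * v 1) / 2) ^ 2 + v 0 ^ 2 / 2 * (-v 1 ^ 2 / 2) = 0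
  ring

theorem moment_mem_nilConePlus {v : Fin 2 → ℝ} (hv : v ≠ 0) : moment v ∈ nilConePlus := by
  refine ⟨moment_mem_nilCone v, ?_⟩
  change 0 < v 0 ^ 2 / 2 - -v 1 ^ 2 / 2
  have : v 0 ≠ 0 ∨ v 1 ≠ 0 := by
    by_contra! h
    exact hv (by funext i; fin_cases i <;> simp [h.1, h.2])
  have h0 := sq_nonneg (v 0)
  have h1 := sq_nonneg (v 1)
  rcases this with h | h
  · have := sq_pos_of_ne_zero h
    linarith
  · have := sq_pos_of_ne_zero h
    linarith

theorem moment_zero : moment 0 = 0 := by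
  funext i
  fin_cases i <;> simp [moment]

theorem isCompact_preimage_moment {K : Set (Fin 3 → ℝ)} (hK : IsCompact K) :
    IsCompact (moment ⁻¹' K) := by
  refine Metric.isCompact_of_isClosed_isBounded
    (hK.isClosed.preimage contDiff_moment.continuous) ?_
  obtain ⟨R, hR⟩ := hK.isBounded.exists_norm_le
  refine (Metric.isBounded_closedBall (x := (0 : Fin 2 → ℝ)) (r := 2 * |R| + 1)).subset fun v hv => ?_
  have h1 := hR _ hv
  have h2 : ∀ i, |moment v i| ≤ |R| := fun i =>
    ((norm_le_pi_norm (moment v) i).trans h1).trans (le_abs_self R)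
  have h3 : v 0 ^ 2 / 2 ≤ |R| := (le_abs_self _).trans (h2 1)
  have h4 : -(-v 1 ^ 2 / 2) ≤ |R| := (neg_le_abs _).trans (h2 2)
  rw [mem_closedBall_zero_iff, pi_norm_le_iff_of_nonneg (by positivity)]
  intro i
  rw [Real.norm_eq_abs, abs_le]
  fin_cases i
  · constructor <;> simp only [Fin.zero_eta, Fin.isValue] <;> nlinarith [sq_nonneg (v 0 - 1), sq_nonneg (v 0 + 1)]
  · constructor <;> simp only [Fin.mk_one, Fin.isValue] <;> nlinarith [sq_nonneg (v 1 - 1), sq_nonneg (v 1 + 1)]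

theorem moment_div_right {p : Fin 3 → ℝ} (hp : p ∈ nilCone) {t : ℝ} (ht : t ≠ 0)
    (h : t ^ 2 = 2 * p 1) : moment ![t, -2 * p 0 / t] = p := by
  have hN : p 0 ^ 2 + p 1 * p 2 = 0 := hp
  funext i
  fin_cases i
  · simp only [moment, Matrix.cons_val_zero, Matrix.cons_val_one]
    change -(t * (-2 * p 0 / t)) / 2 = p 0
    field_simp
  · change t ^ 2 / 2 = p 1
    linarith
  · change -(-2 * p 0 / t) ^ 2 / 2 = p 2
    field_simp
    linear_combination (-2) * hN - p 2 * h

theorem moment_div_left {p : Fin 3 → ℝ} (hp : p ∈ nilCone) {t : ℝ} (ht : t ≠ 0)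
    (h : t ^ 2 = -2 * p 2) : moment ![-2 * p 0 / t, t] = p := by
  have hN : p 0 ^ 2 + p 1 * p 2 = 0 := hp
  funext i
  fin_cases i
  · change -(-2 * p 0 / t * t) / 2 = p 0
    field_simp
  · change (-2 * p 0 / t) ^ 2 / 2 = p 1
    field_simp
    linear_combination 2 * hN - p 1 * h
  · change -t ^ 2 / 2 = p 2
    linarith

/-- The moment map has continuous local sections over the upper half cone. -/
theorem exists_local_section {v₀ : Fin 2 → ℝ} (hv₀ : v₀ ≠ 0) :
    ∃ σ : (Fin 3 → ℝ) → (Fin 2 → ℝ), ContinuousAt σ (moment v₀) ∧ σ (moment v₀) = v₀ ∧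
      ∀ᶠ p in 𝓝 (moment v₀), p ∈ nilCone → moment (σ p) = p := by
  have hsgn : ∀ t : ℝ, t ≠ 0 → ∃ c : ℝ, c ≠ 0 ∧ c ^ 2 = 1 ∧ c * |t| = t := by
    intro t ht
    have : |t| ≠ 0 := abs_ne_zero.2 ht
    refine ⟨t / |t|, by positivity, ?_, by field_simp⟩
    rw [div_pow, sq_abs]
    field_simp
  by_cases h0 : v₀ 0 = 0
  · have h1 : v₀ 1 ≠ 0 := fun h1 => hv₀ (by funext i; fin_cases i <;> simp [h0, h1])
    obtain ⟨c, hcne, hc, hc'⟩ := hsgn _ h1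
    have hm2 : √(-2 * moment v₀ 2) = |v₀ 1| := by
      rw [← Real.sqrt_sq_eq_abs]
      congr 1
      simp [moment]
      ring
    have hs : Continuous (fun p : Fin 3 → ℝ => c * √(-2 * p 2)) := by fun_prop
    refine ⟨fun p => ![-2 * p 0 / (c * √(-2 * p 2)), c * √(-2 * p 2)], ?_, ?_, ?_⟩
    · refine continuousAt_pi.2 fun i => ?_
      fin_cases i
      · have hn : Continuous (fun p : Fin 3 → ℝ => -2 * p 0) := by fun_prop
        refine hn.continuousAt.div hs.continuousAt ?_
        rw [hm2, hc']
        exact h1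
      · exact hs.continuousAt
    · funext i
      fin_cases i
      · simp [moment, h0]
      · simp only [hm2]
        exact hc'
    · have hn : ∀ᶠ p : Fin 3 → ℝ in 𝓝 (moment v₀), p 2 < 0 := by
        refine (continuous_apply 2).continuousAt.eventually (gt_mem_nhds ?_)
        change -v₀ 1 ^ 2 / 2 < 0
        have : 0 < v₀ 1 ^ 2 := by positivity
        linarith
      filter_upwards [hn] with p hp hpN
      refine moment_div_left hpN (mul_ne_zero hcne (Real.sqrt_pos.2 (by linarith)).ne') ?_
      rw [mul_pow, hc, one_mul, Real.sq_sqrt (by linarith)]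
  · obtain ⟨c, hcne, hc, hc'⟩ := hsgn _ h0
    have hm2 : √(2 * moment v₀ 1) = |v₀ 0| := by
      rw [← Real.sqrt_sq_eq_abs]
      congr 1
      simp [moment]
      ring
    have hs : Continuous (fun p : Fin 3 → ℝ => c * √(2 * p 1)) := by fun_prop
    refine ⟨fun p => ![c * √(2 * p 1), -2 * p 0 / (c * √(2 * p 1))], ?_, ?_, ?_⟩
    · refine continuousAt_pi.2 fun i => ?_
      fin_cases i
      · exact hs.continuousAt
      · have hn : Continuous (fun p : Fin 3 → ℝ => -2 * p 0) := by fun_prop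
        refine hn.continuousAt.div hs.continuousAt ?_
        rw [hm2, hc']
        exact h0
    · funext i
      fin_cases i
      · simp only [hm2]
        exact hc'
      · simp only [hm2, hc']
        simp [moment]
        field_simp
    · have hn : ∀ᶠ p : Fin 3 → ℝ in 𝓝 (moment v₀), 0 < p 1 := by
        refine (continuous_apply 1).continuousAt.eventually (lt_mem_nhds ?_)
        change 0 < v₀ 0 ^ 2 / 2
        positivity
      filter_upwards [hn] with p hp hpN
      refine moment_div_right hpN (mul_ne_zero hcne (Real.sqrt_pos.2 (by linarith)).ne') ?_
      rw [mul_pow, hc, one_mul, Real.sq_sqrt (by linarith)]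

theorem exists_moment_eq {p : Fin 3 → ℝ} (hp : p ∈ nilConePlus) : ∃ v, v ≠ 0 ∧ moment v = p := by
  obtain ⟨hN, hpos⟩ := hp
  suffices h : ∃ v, moment v = p by
    obtain ⟨v, rfl⟩ := h
    refine ⟨v, fun h0 => ?_, rfl⟩
    simp [h0, moment_zero] at hpos
  rcases lt_or_ge 0 (p 1) with h | h
  · exact ⟨_, moment_div_right hN (Real.sqrt_pos.2 (by linarith : 0 < 2 * p 1)).ne'
      (Real.sq_sqrt (by linarith))⟩
  · exact ⟨_, moment_div_left hN (Real.sqrt_pos.2 (by linarith : 0 < -2 * p 2)).ne'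
      (Real.sq_sqrt (by linarith))⟩

theorem measurableSet_nilConePlus : MeasurableSet nilConePlus := by
  have h : nilConePlus = nilCone ∩ {p | 0 < p 1 - p 2} := rfl
  have hcl : IsClosed nilCone := isClosed_singleton.preimage contDiff_quad.continuous
  rw [h]
  exact hcl.measurableSet.inter (isOpen_lt continuous_const (by fun_prop)).measurableSet

theorem diracPlus_apply {A : Set (Fin 3 → ℝ)} (hA : MeasurableSet A) :
    diracPlus A = 2 * volume (moment ⁻¹' A) := by
  rw [diracPlus, Measure.map_apply contDiff_moment.continuous.measurable hA]
  simp

theorem ae_mem_nilConePlus : ∀ᵐ p ∂diracPlus, p ∈ nilConePlus := by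
  rw [ae_iff]
  change diracPlus nilConePlusᶜ = 0
  rw [diracPlus_apply measurableSet_nilConePlus.compl]
  have : moment ⁻¹' nilConePlusᶜ ⊆ {0} := by
    intro v hv
    by_contra h
    exact hv (moment_mem_nilConePlus h)
  rw [measure_mono_null this (measure_singleton _), mul_zero]

end Moment

/-! ### Integration by parts on the plane -/

section Parts

variable {V : Type*} [NormedAddCommGroup V] [NormedSpace ℝ V]

theorem integral_coord_smul_fderiv {G : (Fin 2 → ℝ) → V}
    (hG : ContDiff ℝ ((⊤ : ℕ∞) : WithTop ℕ∞) G) (hGc : HasCompactSupport G) (j : Fin 2)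
    (u : Fin 2 → ℝ) : ∫ v, v j • fderiv ℝ G v u = -(u j • ∫ v, G v) := by
  have hd : ∀ v : Fin 2 → ℝ, fderiv ℝ (fun v : Fin 2 → ℝ => v j) v u = u j := by
    intro v
    rw [(hasFDerivAt_apply (𝕜 := ℝ) j v).fderiv]
    rfl
  have hGi : Integrable G := hG.continuous.integrable_of_hasCompactSupport hGc
  have hcd : Continuous fun v => fderiv ℝ G v u :=
    (hG.continuous_fderiv (by simp)).clm_apply continuous_const
  have h := integral_smul_fderiv_eq_neg_fderiv_smul_of_integrable (μ := volume)
    (f := fun v : Fin 2 → ℝ => v j) (g := G) (v := u) ?_ ?_ ?_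
    (fun v _ => differentiableAt_apply j v) (fun v _ => hG.differentiable (by simp) v)
  · rw [h]
    simp only [hd, integral_smul]
  · simp only [hd]
    exact hGi.smul (u j)
  · refine Continuous.integrable_of_hasCompactSupport ((continuous_apply j).smul hcd) ?_
    exact (hGc.fderiv_apply ℝ u).smul_left
  · exact ((continuous_apply j).smul hG.continuous).integrable_of_hasCompactSupport hGc.smul_left

theorem integrable_coord_smul_fderiv {G : (Fin 2 → ℝ) → V}
    (hG : ContDiff ℝ ((⊤ : ℕ∞) : WithTop ℕ∞) G) (hGc : HasCompactSupport G) (j : Fin 2)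
    (u : Fin 2 → ℝ) : Integrable fun v : Fin 2 → ℝ => v j • fderiv ℝ G v u :=
  ((continuous_apply j).smul ((hG.continuous_fderiv (by simp)).clm_apply
    continuous_const)).integrable_of_hasCompactSupport (hGc.fderiv_apply ℝ u).smul_left

/-- `∫ (D G)(v) (A v) dv = -(tr A) ∫ G(v) dv` for the linear vector field of `A`. -/
theorem integral_fderiv_linear {G : (Fin 2 → ℝ) → V}
    (hG : ContDiff ℝ ((⊤ : ℕ∞) : WithTop ℕ∞) G) (hGc : HasCompactSupport G)
    (A : Fin 2 → Fin 2 → ℝ) :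
    ∫ v : Fin 2 → ℝ, fderiv ℝ G v (v 0 • A 0 + v 1 • A 1) = -((A 0 0 + A 1 1) • ∫ v, G v) := by
  simp only [map_add, map_smul]
  rw [integral_add (integrable_coord_smul_fderiv hG hGc 0 _)
    (integrable_coord_smul_fderiv hG hGc 1 _), integral_coord_smul_fderiv hG hGc,
    integral_coord_smul_fderiv hG hGc]
  module

end Parts
end SlTwo
end

noncomputable section
namespace SlTwo

/-! ### The generalized function `s δ` for an equivariant function `s` on the cone -/

section Dirac

open Set Topology

variable {U : Opens (Fin 3 → ℝ)} {V : Type*} [NormedAddCommGroup V] [NormedSpace ℝ V]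

/-- `s` is a smooth function on the upper half cone, equivariant and homogeneous of degree `n / 2`,
expressed through its pull-back under the moment map. -/
structure IsEquivariantSection [LieRingModule Sl V] (U : Opens (Fin 3 → ℝ)) (n : ℕ)
    (s : (Fin 3 → ℝ) → V) : Prop where
  contDiffAt : ∀ v, moment v ∈ U → ContDiffAt ℝ ((⊤ : ℕ∞) : WithTop ℕ∞) (fun v => s (moment v)) v
  fderiv_lie : ∀ v, moment v ∈ U → ∀ z,
    fderiv ℝ (fun v => s (moment v)) v (stdAct z v) = ⁅ofCoords z, s (moment v)⁆
  fderiv_self : ∀ v, moment v ∈ U →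
    fderiv ℝ (fun v => s (moment v)) v v = (n : ℝ) • s (moment v)

theorem continuousOn_of_comp_moment {s : (Fin 3 → ℝ) → V}
    (hs : ∀ v, moment v ∈ U → ContDiffAt ℝ ((⊤ : ℕ∞) : WithTop ℕ∞) (fun v => s (moment v)) v) :
    ContinuousOn s ((U : Set (Fin 3 → ℝ)) ∩ nilConePlus) := by
  rintro p ⟨hpU, hpN⟩
  obtain ⟨v, hv, rfl⟩ := exists_moment_eq hpN
  obtain ⟨σ, hσ, hσv, hσm⟩ := exists_local_section hv
  have h1 : ContinuousAt (fun p => s (moment (σ p))) (moment v) := by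
    refine ContinuousAt.comp (g := fun v => s (moment v)) ?_ hσ
    rw [hσv]
    exact (hs v hpU).continuousAt
  refine (h1.continuousWithinAt (s := (U : Set (Fin 3 → ℝ)) ∩ nilConePlus)).congr_of_eventuallyEq
    ?_ (by rw [hσv])
  filter_upwards [mem_nhdsWithin_of_mem_nhds hσm, self_mem_nhdsWithin] with q hq hqN
  rw [hq hqN.2.1]

theorem locallyIntegrableOn_of_comp_moment {s : (Fin 3 → ℝ) → V}
    (hs : ∀ v, moment v ∈ U → ContDiffAt ℝ ((⊤ : ℕ∞) : WithTop ℕ∞) (fun v => s (moment v)) v) :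
    LocallyIntegrableOn s U diracPlus := by
  intro p hp
  obtain ⟨K, hK, hKU, hKc⟩ := local_compact_nhds (U.isOpen.mem_nhds hp)
  refine ⟨K, mem_nhdsWithin_of_mem_nhds hK, ?_⟩
  have hKm := hKc.isClosed.measurableSet
  have hc : ContinuousOn (fun v => s (moment v)) (moment ⁻¹' K) := fun v hv =>
    (hs v (hKU hv)).continuousAt.continuousWithinAt
  obtain ⟨C, hC⟩ := (isCompact_preimage_moment hKc).exists_bound_of_continuousOn hc
  have hae : ∀ᵐ q ∂(diracPlus.restrict K), q ∈ (U : Set (Fin 3 → ℝ)) ∩ nilConePlus := by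
    filter_upwards [ae_restrict_mem hKm, ae_restrict_of_ae ae_mem_nilConePlus] with q h1 h2
      using ⟨hKU h1, h2⟩
  have hmeas : AEStronglyMeasurable s (diracPlus.restrict K) := by
    have h1 := (continuousOn_of_comp_moment hs).aestronglyMeasurable (μ := diracPlus.restrict K)
      (U.isOpen.measurableSet.inter measurableSet_nilConePlus)
    rwa [Measure.restrict_eq_self_of_ae_mem hae] at h1
  have hfin : diracPlus K < ⊤ := by
    rw [diracPlus_apply hKm]
    exact ENNReal.mul_lt_top (by simp) (isCompact_preimage_moment hKc).measure_lt_top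
  refine IntegrableOn.of_bound hfin hmeas C ?_
  filter_upwards [ae_restrict_mem hKm, hae] with q hq hqN
  obtain ⟨v, -, rfl⟩ := exists_moment_eq hqN.2
  exact hC v hq

/-- The pull-back of `f s` to the plane. -/
def pullSmul (s : (Fin 3 → ℝ) → V) (f : 𝓓(U, ℝ)) (v : Fin 2 → ℝ) : V := f (moment v) • s (moment v)

theorem hasCompactSupport_pullSmul (s : (Fin 3 → ℝ) → V) (f : 𝓓(U, ℝ)) :
    HasCompactSupport (pullSmul s f) :=
  HasCompactSupport.intro (isCompact_preimage_moment f.hasCompactSupport) fun v hv => by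
    have : f (moment v) = 0 := image_eq_zero_of_notMem_tsupport hv
    simp [pullSmul, this]

theorem pullSmul_eventuallyEq_zero (s : (Fin 3 → ℝ) → V) (f : 𝓓(U, ℝ)) {v : Fin 2 → ℝ}
    (hv : moment v ∉ tsupport f) : pullSmul s f =ᶠ[𝓝 v] 0 := by
  filter_upwards [contDiff_moment.continuous.continuousAt.preimage_mem_nhds
    ((isClosed_tsupport f).isOpen_compl.mem_nhds hv)] with u hu
  have : f (moment u) = 0 := image_eq_zero_of_notMem_tsupport hu
  simp [pullSmul, this]

theorem contDiff_pullSmul {s : (Fin 3 → ℝ) → V}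
    (hs : ∀ v, moment v ∈ U → ContDiffAt ℝ ((⊤ : ℕ∞) : WithTop ℕ∞) (fun v => s (moment v)) v)
    (f : 𝓓(U, ℝ)) : ContDiff ℝ ((⊤ : ℕ∞) : WithTop ℕ∞) (pullSmul s f) := by
  refine contDiff_iff_contDiffAt.2 fun v => ?_
  by_cases hv : moment v ∈ tsupport f
  · exact (f.contDiff.comp contDiff_moment).contDiffAt.smul (hs v (f.tsupport_subset hv))
  · exact contDiffAt_const.congr_of_eventuallyEq (pullSmul_eventuallyEq_zero s f hv)

theorem mulDiracPlus_apply {s : (Fin 3 → ℝ) → V}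
    (hs : ∀ v, moment v ∈ U → ContDiffAt ℝ ((⊤ : ℕ∞) : WithTop ℕ∞) (fun v => s (moment v)) v)
    (f : 𝓓(U, ℝ)) : mulDiracPlus U s f = (2 : ℝ) • ∫ v, pullSmul s f v := by
  have hloc := locallyIntegrableOn_of_comp_moment hs
  have hint := TestFunction.integrable_bilin (ContinuousLinearMap.lsmul ℝ ℝ) hloc f
  have h1 : mulDiracPlus U s f = ∫ p, ContinuousLinearMap.lsmul ℝ ℝ (f p) (s p) ∂diracPlus :=
    TestFunction.integralAgainstBilinCLM_eq_integral hloc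
  rw [h1]
  unfold diracPlus at hint ⊢
  rw [integral_map contDiff_moment.continuous.aemeasurable hint.1, integral_smul_measure]
  rfl

theorem pullSmul_of_notMem (s : (Fin 3 → ℝ) → V) (f : 𝓓(U, ℝ)) {v : Fin 2 → ℝ}
    (hv : moment v ∉ U) : pullSmul s f v = 0 := by
  have : f (moment v) = 0 :=
    image_eq_zero_of_notMem_tsupport fun h => hv (f.tsupport_subset h)
  simp [pullSmul, this]

theorem fderiv_pullSmul_of_notMem (s : (Fin 3 → ℝ) → V) (f : 𝓓(U, ℝ)) {v : Fin 2 → ℝ}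
    (hv : moment v ∉ U) : fderiv ℝ (pullSmul s f) v = 0 := by
  rw [(pullSmul_eventuallyEq_zero s f fun h => hv (f.tsupport_subset h)).fderiv_eq]
  simp

theorem casimir_apply (T : 𝓓'(U, V)) (f : 𝓓(U, ℝ)) : casimir T f = T (boxOp f) := by
  have h : ∀ (v : Fin 3 → ℝ) (T : 𝓓'(U, V)) (f : 𝓓(U, ℝ)), (∂_{v} T) f = -T (dOp v f) := by
    intro v T f
    rw [Distribution.lineDerivOp_apply_apply, map_neg]
    rfl
  change (1 / 2 : ℝ) • (∂_{cH} (∂_{cH} T)) f + (2 : ℝ) • (∂_{cY} (∂_{cX} T)) f = _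
  rw [h, h, h, h, neg_neg, neg_neg, boxOp_apply', map_add, map_smul, map_smul]

theorem iterate_casimir_toLinearMap (T : 𝓓'(U, V)) (k : ℕ) :
    ((casimir^[k] T : 𝓓'(U, V)) : 𝓓(U, ℝ) →L[ℝ] V).toLinearMap =
      (boxEnd ^ k) (T : 𝓓(U, ℝ) →L[ℝ] V).toLinearMap := by
  induction k with
  | zero => simp
  | succ k ih =>
    rw [Function.iterate_succ_apply', pow_succ', Module.End.mul_apply, ← ih]
    ext f
    exact casimir_apply _ f

variable [LieRingModule Sl V] {n : ℕ} {s : (Fin 3 → ℝ) → V}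

theorem fderiv_pullSmul (hs : IsEquivariantSection U n s) (f : 𝓓(U, ℝ)) {v : Fin 2 → ℝ}
    (hv : moment v ∈ U) (u : Fin 2 → ℝ) : fderiv ℝ (pullSmul s f) v u =
      fderiv ℝ f (moment v) (fderiv ℝ moment v u) • s (moment v) +
        f (moment v) • fderiv ℝ (fun v => s (moment v)) v u := by
  have h1 : HasFDerivAt (fun v => f (moment v)) _ v :=
    (differentiable_testFunction f (moment v)).hasFDerivAt.comp v
      (contDiff_moment.differentiable (by simp) v).hasFDerivAt
  have h2 := ((hs.contDiffAt v hv).differentiableAt (by simp)).hasFDerivAt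
  have h3 : HasFDerivAt (pullSmul s f) _ v := h1.smul h2
  rw [h3.fderiv]
  simp [add_comm]

theorem integrable_pullSmul (hs : IsEquivariantSection U n s) (f : 𝓓(U, ℝ)) :
    Integrable (pullSmul s f) :=
  (contDiff_pullSmul hs.contDiffAt f).continuous.integrable_of_hasCompactSupport
    (hasCompactSupport_pullSmul s f)

theorem mulDiracPlus_eq_zero (hs : IsEquivariantSection U n s) (f : 𝓓(U, ℝ))
    (hf : ∀ p ∈ nilCone, f p = 0) : mulDiracPlus U s f = 0 := by
  rw [mulDiracPlus_apply hs.contDiffAt]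
  have : pullSmul s f = 0 := by
    funext v
    simp [pullSmul, hf _ (moment_mem_nilCone v)]
  simp [this]

theorem mulDiracPlus_eulerOp (hs : IsEquivariantSection U n s) (f : 𝓓(U, ℝ)) :
    mulDiracPlus U s (eulerOp f) = (-(1 + (n : ℝ) / 2)) • mulDiracPlus U s f := by
  rw [mulDiracPlus_apply hs.contDiffAt, mulDiracPlus_apply hs.contDiffAt]
  have hpt : ∀ v, fderiv ℝ (pullSmul s f) v v =
      (2 : ℝ) • pullSmul s (eulerOp f) v + (n : ℝ) • pullSmul s f v := by
    intro v
    by_cases hv : moment v ∈ U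
    · rw [fderiv_pullSmul hs f hv, hs.fderiv_self v hv, fderiv_moment_self, pullSmul, pullSmul,
        eulerOp_apply, map_smul, smul_eq_mul]
      module
    · rw [fderiv_pullSmul_of_notMem s f hv, pullSmul_of_notMem s f hv, pullSmul_of_notMem s _ hv]
      simp
  have h := integral_fderiv_linear (contDiff_pullSmul hs.contDiffAt f)
    (hasCompactSupport_pullSmul s f) ![![1, 0], ![0, 1]]
  have e : ∀ v : Fin 2 → ℝ, v 0 • (![![1, 0], ![0, 1]] : Fin 2 → Fin 2 → ℝ) 0 +
      v 1 • (![![1, 0], ![0, 1]] : Fin 2 → Fin 2 → ℝ) 1 = v := by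
    intro v
    funext i
    fin_cases i <;> simp
  simp only [e, hpt] at h
  have hi : ∀ (c : ℝ) (f : 𝓓(U, ℝ)), Integrable fun v => c • pullSmul s f v := fun c f =>
    (integrable_pullSmul hs f).smul c
  rw [integral_add (hi _ _) (hi _ _),
    integral_smul, integral_smul] at h
  rw [eq_sub_of_add_eq h]
  simp only [Matrix.cons_val_zero, Matrix.cons_val_one]
  module

theorem mulQ_mulDiracPlus (hs : IsEquivariantSection U n s) :
    mulQ (mulDiracPlus U s : 𝓓(U, ℝ) →L[ℝ] V).toLinearMap = 0 := by
  ext f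
  refine mulDiracPlus_eq_zero hs _ fun p hp => ?_
  have : p 0 ^ 2 + p 1 * p 2 = 0 := hp
  rw [qOp_apply, this, zero_mul]

theorem mulDiracPlus_ne_zero [FiniteDimensional ℝ V] (hs : IsEquivariantSection U n s) {p₀ : Fin 3 → ℝ} (hp₀ : p₀ ∈ U)
    (hN : p₀ ∈ nilConePlus) (ξ : V →ₗ[ℝ] ℝ) (hξ : ξ (s p₀) ≠ 0) :
    (mulDiracPlus U s : 𝓓(U, ℝ) →L[ℝ] V).toLinearMap ≠ 0 := by
  intro hzero
  set c := ξ (s p₀) with hc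
  let L : V →L[ℝ] ℝ := LinearMap.toContinuousLinearMap ξ
  have hcont : ContinuousWithinAt (fun p => c * L (s p)) ((U : Set (Fin 3 → ℝ)) ∩ nilConePlus) p₀ :=
    continuousWithinAt_const.mul (L.continuous.continuousAt.comp_continuousWithinAt
      (continuousOn_of_comp_moment hs.contDiffAt p₀ ⟨hp₀, hN⟩))
  have hpos : 0 < c * L (s p₀) := mul_self_pos.2 hξ
  obtain ⟨O, hO, hOs⟩ := mem_nhdsWithin_iff_exists_mem_nhds_inter.1
    (hcont.eventually (lt_mem_nhds hpos))
  have hpl : IsOpen {p : Fin 3 → ℝ | 0 < p 1 - p 2} := isOpen_lt continuous_const (by fun_prop)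
  obtain ⟨f, hfs, hfc, hf, hfr, hf1⟩ := exists_contDiff_tsupport_subset (n := (⊤ : ℕ∞))
    (Filter.inter_mem hO (Filter.inter_mem (U.isOpen.mem_nhds hp₀) (hpl.mem_nhds hN.2)))
  let F : 𝓓(U, ℝ) := ⟨f, hf, hfc, hfs.trans fun p hp => hp.2.1⟩
  have h0 : mulDiracPlus U s F = 0 := LinearMap.congr_fun hzero F
  rw [mulDiracPlus_apply hs.contDiffAt, smul_eq_zero_iff_right (by norm_num)] at h0
  have h1 : ∫ v, L (pullSmul s F v) = 0 := by
    rw [L.integral_comp_comm (integrable_pullSmul hs F), h0, map_zero]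
  obtain ⟨v₀, -, rfl⟩ := exists_moment_eq hN
  have h2 : 0 < ∫ v, c * L (pullSmul s F v) := by
    have hcts : Continuous fun v => c * L (pullSmul s F v) :=
      continuous_const.mul (L.continuous.comp (contDiff_pullSmul hs.contDiffAt F).continuous)
    refine hcts.integral_pos_of_hasCompactSupport_nonneg_nonzero (x := v₀)
      (((hasCompactSupport_pullSmul s F).comp_left (g := L) (map_zero L)).mul_left) (fun v => ?_) ?_
    · have e : c * L (pullSmul s F v) = f (moment v) * (c * L (s (moment v))) := by
        change c * L (f (moment v) • s (moment v)) = _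
        rw [map_smul, smul_eq_mul]
        ring
      change 0 ≤ c * L (pullSmul s F v)
      rw [e]
      by_cases hv : f (moment v) = 0
      · simp [hv]
      have hm := hfs (subset_tsupport f hv)
      have h3 : 0 < c * L (s (moment v)) := hOs ⟨hm.1, hm.2.1, moment_mem_nilCone v, hm.2.2⟩
      exact mul_nonneg (hfr ⟨_, rfl⟩).1 h3.le
    · have e : c * L (pullSmul s F v₀) = f (moment v₀) * (c * L (s (moment v₀))) := by
        change c * L (f (moment v₀) • s (moment v₀)) = _
        rw [map_smul, smul_eq_mul]
        ring
      rw [e, hf1, one_mul]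
      exact hpos.ne'
  rw [integral_const_mul, h1, mul_zero] at h2
  exact lt_irrefl _ h2

variable [LieModule ℝ Sl V] [FiniteDimensional ℝ V]

theorem mulDiracPlus_lie (hs : IsEquivariantSection U n s) (Z : Sl) (f : 𝓓(U, ℝ)) :
    ⁅Z, mulDiracPlus U s f⁆ = mulDiracPlus U s (lieDeriv Z f) := by
  obtain ⟨z, rfl⟩ := ofCoords.surjective Z
  rw [mulDiracPlus_apply hs.contDiffAt, mulDiracPlus_apply hs.contDiffAt, lie_smul]
  congr 1
  let L : V →L[ℝ] V := LinearMap.toContinuousLinearMap (LieModule.toEnd ℝ Sl V (ofCoords z))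
  have hL : ⁅ofCoords z, ∫ v, pullSmul s f v⁆ = ∫ v, ⁅ofCoords z, pullSmul s f v⁆ :=
    (L.integral_comp_comm (integrable_pullSmul hs f)).symm
  have hpt : ∀ v, fderiv ℝ (pullSmul s f) v (stdAct z v) =
      ⁅ofCoords z, pullSmul s f v⁆ - pullSmul s (lieDeriv (ofCoords z) f) v := by
    intro v
    by_cases hv : moment v ∈ U
    · rw [fderiv_pullSmul hs f hv, hs.fderiv_lie v hv, fderiv_moment_stdAct]
      have : lieDeriv (ofCoords z) f (moment v) =
        fderiv ℝ f (moment v) (-ofCoords.symm ⁅ofCoords z, ofCoords (moment v)⁆) := rfl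
      rw [pullSmul, pullSmul, this, map_neg, lie_smul]
      module
    · rw [fderiv_pullSmul_of_notMem s f hv, pullSmul_of_notMem s f hv, pullSmul_of_notMem s _ hv]
      simp
  have h0 : ∫ v, fderiv ℝ (pullSmul s f) v (stdAct z v) = 0 := by
    have h := integral_fderiv_linear (contDiff_pullSmul hs.contDiffAt f)
      (hasCompactSupport_pullSmul s f) ![![z 0, z 2], ![z 1, -z 0]]
    have e : ∀ v : Fin 2 → ℝ, v 0 • (![![z 0, z 2], ![z 1, -z 0]] : Fin 2 → Fin 2 → ℝ) 0 +
        v 1 • (![![z 0, z 2], ![z 1, -z 0]] : Fin 2 → Fin 2 → ℝ) 1 = stdAct z v := by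
      intro v
      funext i
      fin_cases i <;> simp [stdAct] <;> ring
    simp only [e] at h
    rw [h]
    simp
  have hLi : Integrable fun v => ⁅ofCoords z, pullSmul s f v⁆ :=
    L.integrable_comp (integrable_pullSmul hs f)
  simp only [hpt] at h0
  rw [integral_sub hLi (integrable_pullSmul hs _), sub_eq_zero] at h0
  rw [hL, h0]

theorem mulDiracPlus_mem_algInv (hs : IsEquivariantSection U n s) :
    (mulDiracPlus U s : 𝓓(U, ℝ) →L[ℝ] V).toLinearMap ∈ algInv U V :=
  ⟨fun Z f => mulDiracPlus_lie hs Z f, fun f hf => mulDiracPlus_eq_zero hs f fun _ hp =>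
    image_eq_zero_of_notMem_tsupport fun h => (hf h).2 hp⟩

end Dirac
end SlTwo
end

noncomputable section
namespace SlTwo

/-! ### Strings of weight vectors -/

section Weights

variable {M : Type*} [AddCommGroup M] [Module ℝ M] [LieRingModule Sl M]

/-- The weight vectors `w 0, …, w n` of the irreducible representation of dimension `n + 1`,
generated from a highest weight vector `w 0` by divided powers of `Y`. -/
structure IsWeightString (n : ℕ) (w : ℕ → M) : Prop where
  lie_H : ∀ k, ⁅ofCoords cH, w k⁆ = (n - 2 * k : ℝ) • w k
  lie_X_zero : ⁅ofCoords cX, w 0⁆ = 0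
  lie_X : ∀ k, ⁅ofCoords cX, w (k + 1)⁆ = (n - k : ℝ) • w k
  lie_Y : ∀ k, ⁅ofCoords cY, w k⁆ = (k + 1 : ℝ) • w (k + 1)
  eq_zero_of_lt : ∀ k, n < k → w k = 0
  zero_ne : w 0 ≠ 0

variable {n : ℕ} {w : ℕ → M}

theorem IsWeightString.map {M' : Type*} [AddCommGroup M'] [Module ℝ M'] [LieRingModule Sl M']
    (hw : IsWeightString n w) (e : M ≃ₗ⁅ℝ, Sl⁆ M') : IsWeightString n fun k => e (w k) where
  lie_H k := by
    rw [← map_smul, ← hw.lie_H]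
    exact (e.toLieModuleHom.map_lie _ _).symm
  lie_X_zero := by
    rw [← map_zero e, ← hw.lie_X_zero]
    exact (e.toLieModuleHom.map_lie _ _).symm
  lie_X k := by
    rw [← map_smul, ← hw.lie_X]
    exact (e.toLieModuleHom.map_lie _ _).symm
  lie_Y k := by
    rw [← map_smul, ← hw.lie_Y]
    exact (e.toLieModuleHom.map_lie _ _).symm
  eq_zero_of_lt k hk := by rw [hw.eq_zero_of_lt k hk, map_zero]
  zero_ne h := hw.zero_ne (e.toLinearEquiv.map_eq_zero_iff.1 h)

theorem ofCoords_eq (z : Fin 3 → ℝ) :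
    ofCoords z = z 0 • ofCoords cH + z 1 • ofCoords cX + z 2 • ofCoords cY := by
  rw [← map_smul, ← map_smul, ← map_smul, ← map_add, ← map_add]
  congr 1
  funext i
  fin_cases i <;> simp

theorem IsWeightString.mem_lieSpan (hw : IsWeightString n w) (k : ℕ) :
    w k ∈ LieSubmodule.lieSpan ℝ Sl {w 0} := by
  induction k with
  | zero => exact LieSubmodule.subset_lieSpan rfl
  | succ k ih =>
    have h := LieSubmodule.lie_mem (x := ofCoords cY) _ ih
    rw [hw.lie_Y] at h
    have hk : (k + 1 : ℝ) ≠ 0 := by positivity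
    have h2 := (LieSubmodule.lieSpan ℝ Sl {w 0}).smul_mem (k + 1 : ℝ)⁻¹ h
    rwa [smul_smul, inv_mul_cancel₀ hk, one_smul] at h2

theorem IsWeightString.ne_zero (hw : IsWeightString n w) {k : ℕ} (hk : k ≤ n) : w k ≠ 0 := by
  induction k with
  | zero => exact hw.zero_ne
  | succ k ih =>
    intro h
    have h1 := hw.lie_X k
    rw [h, lie_zero] at h1
    have hne : (n - k : ℝ) ≠ 0 := by
      rw [sub_ne_zero]
      exact_mod_cast (by omega : n ≠ k)
    exact ih (by omega) ((smul_eq_zero.1 h1.symm).resolve_left hne)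

/-- The weight string, viewed in the submodule generated by its highest weight vector. -/
theorem IsWeightString.lieSpan (hw : IsWeightString n w) :
    IsWeightString n (fun k => (⟨w k, hw.mem_lieSpan k⟩ : LieSubmodule.lieSpan ℝ Sl {w 0})) where
  lie_H k := Subtype.ext (hw.lie_H k)
  lie_X_zero := Subtype.ext hw.lie_X_zero
  lie_X k := Subtype.ext (hw.lie_X k)
  lie_Y k := Subtype.ext (hw.lie_Y k)
  eq_zero_of_lt k hk := Subtype.ext (hw.eq_zero_of_lt k hk)
  zero_ne h := hw.zero_ne (congrArg Subtype.val h)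

variable [LieModule ℝ Sl M]

theorem ofCoords_lie (z : Fin 3 → ℝ) (m : M) : ⁅ofCoords z, m⁆ =
    z 0 • ⁅ofCoords cH, m⁆ + z 1 • ⁅ofCoords cX, m⁆ + z 2 • ⁅ofCoords cY, m⁆ := by
  rw [ofCoords_eq z, add_lie, add_lie, smul_lie, smul_lie, smul_lie]

theorem IsWeightString.lie_mem_span (hw : IsWeightString n w) (Z : Sl) {m : M}
    (hm : m ∈ Submodule.span ℝ (Set.range w)) : ⁅Z, m⁆ ∈ Submodule.span ℝ (Set.range w) := by
  obtain ⟨z, rfl⟩ := ofCoords.surjective Z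
  have hk : ∀ k, w k ∈ Submodule.span ℝ (Set.range w) := fun k => Submodule.subset_span ⟨k, rfl⟩
  induction hm using Submodule.span_induction with
  | mem x hx =>
    obtain ⟨k, rfl⟩ := hx
    rw [ofCoords_lie, hw.lie_H, hw.lie_Y]
    refine add_mem (add_mem (Submodule.smul_mem _ _ (Submodule.smul_mem _ _ (hk _)))
      (Submodule.smul_mem _ _ ?_)) (Submodule.smul_mem _ _ (Submodule.smul_mem _ _ (hk _)))
    rcases k with _ | k
    · rw [hw.lie_X_zero]
      exact zero_mem _
    · rw [hw.lie_X]
      exact Submodule.smul_mem _ _ (hk _)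
  | zero => simp
  | add x y _ _ hx hy =>
    rw [lie_add]
    exact add_mem hx hy
  | smul c x _ hx =>
    rw [lie_smul]
    exact Submodule.smul_mem _ _ hx

theorem IsWeightString.lieSpan_le_span (hw : IsWeightString n w) {m : M}
    (hm : m ∈ LieSubmodule.lieSpan ℝ Sl {w 0}) : m ∈ Submodule.span ℝ (Set.range w) := by
  let N : LieSubmodule ℝ Sl M :=
    { Submodule.span ℝ (Set.range w) with lie_mem := fun {Z m} hm => hw.lie_mem_span Z hm }
  have h : LieSubmodule.lieSpan ℝ Sl {w 0} ≤ N :=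
    LieSubmodule.lieSpan_le.2 (Set.singleton_subset_iff.2 (Submodule.subset_span ⟨0, rfl⟩))
  exact h hm

theorem IsWeightString.span_lieSpan (hw : IsWeightString n w) : Submodule.span ℝ (Set.range
    fun k => (⟨w k, hw.mem_lieSpan k⟩ : LieSubmodule.lieSpan ℝ Sl {w 0})) = ⊤ := by
  rw [eq_top_iff]
  rintro ⟨m, hm⟩ -
  have h1 := hw.lieSpan_le_span hm
  have h2 : Submodule.span ℝ (Set.range w) = (Submodule.span ℝ (Set.range
      fun k => (⟨w k, hw.mem_lieSpan k⟩ : LieSubmodule.lieSpan ℝ Sl {w 0}))).map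
        (LieSubmodule.lieSpan ℝ Sl {w 0}).toSubmodule.subtype := by
    rw [Submodule.map_span, ← Set.range_comp]
    rfl
  rw [h2] at h1
  obtain ⟨x, hx, hxm⟩ := h1
  have : x = ⟨m, hm⟩ := Subtype.ext hxm
  rwa [this] at hx

theorem IsWeightString.linearIndependent (hw : IsWeightString n w) :
    LinearIndependent ℝ fun k : Fin (n + 1) => w k := by
  refine Module.End.eigenvectors_linearIndependent' (LieModule.toEnd ℝ Sl M (ofCoords cH))
    (fun k : Fin (n + 1) => (n - 2 * (k : ℕ) : ℝ)) (fun i j hij => ?_) _ fun k => ?_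
  · have h : ((i : ℕ) : ℝ) = (j : ℕ) := by
      simp only at hij
      linarith
    exact Fin.ext (by exact_mod_cast h)
  · exact ⟨Module.End.mem_eigenspace_iff.2 (hw.lie_H k), hw.ne_zero (Nat.lt_succ_iff.1 k.2)⟩

/-- The coordinates with respect to a spanning weight string form a weight system. -/
theorem IsWeightString.exists_coords (hw : IsWeightString n w)
    (hspan : Submodule.span ℝ (Set.range w) = ⊤) :
    FiniteDimensional ℝ M ∧ ∃ ξ : ℕ → M →ₗ[ℝ] ℝ,
      (∀ j v, ξ j ⁅ofCoords cH, v⁆ = (n - 2 * j : ℝ) * ξ j v) ∧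
      (∀ j v, ξ j ⁅ofCoords cX, v⁆ = (n - j : ℝ) * ξ (j + 1) v) ∧
      (∀ j ≤ n, ∀ v, ξ j ⁅ofCoords cY, v⁆ = (j : ℝ) * ξ (j - 1) v) ∧
      (∀ j, n < j → ξ j = 0) ∧ (∀ v, (∀ j, ξ j v = 0) → v = 0) ∧
      ∀ j k, ξ j (w k) = if j = k ∧ k ≤ n then 1 else 0 := by
  have hle : ⊤ ≤ Submodule.span ℝ (Set.range fun k : Fin (n + 1) => w k) := by
    rw [← hspan, Submodule.span_le]
    rintro _ ⟨k, rfl⟩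
    rcases Nat.lt_or_ge n k with h | h
    · rw [hw.eq_zero_of_lt k h]
      exact zero_mem _
    · exact Submodule.subset_span ⟨⟨k, by omega⟩, rfl⟩
  let b := Module.Basis.mk hw.linearIndependent hle
  have hb : ∀ k, b k = w k := fun k => Module.Basis.mk_apply hw.linearIndependent hle k
  let ξ : ℕ → M →ₗ[ℝ] ℝ := fun j => if h : j < n + 1 then b.coord ⟨j, h⟩ else 0
  have hξ0 : ∀ j, n < j → ξ j = 0 := fun j hj => dif_neg (by omega)
  have hξ : ∀ j k, ξ j (w k) = if j = k ∧ k ≤ n then 1 else 0 := by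
    intro j k
    rcases Nat.lt_or_ge n k with h | h
    · rw [hw.eq_zero_of_lt k h, map_zero, if_neg (by omega)]
    rcases Nat.lt_or_ge n j with hj | hj
    · rw [hξ0 j hj, LinearMap.zero_apply, if_neg (by omega)]
    have e1 : ξ j = b.coord ⟨j, by omega⟩ := dif_pos (by omega)
    have e2 : w k = b ⟨k, by omega⟩ := (hb ⟨k, by omega⟩).symm
    rw [e1, e2, Module.Basis.coord_apply, Module.Basis.repr_self, Finsupp.single_apply]
    refine if_congr ?_ rfl rfl
    rw [Fin.mk.injEq]
    exact ⟨fun h' => ⟨h'.symm, h⟩, fun h' => h'.1.symm⟩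
  have hext : ∀ f g : M →ₗ[ℝ] ℝ, (∀ k, f (w k) = g (w k)) → ∀ v, f v = g v := fun f g h v => by
    have : f = g := b.ext fun k => by rw [hb, h]
    rw [this]
  refine ⟨Module.Basis.finiteDimensional_of_finite b, ξ, ?_, ?_, ?_, hξ0, ?_, hξ⟩
  · refine fun j => hext (ξ j ∘ₗ (LieModule.toEnd ℝ Sl M (ofCoords cH) : M →ₗ[ℝ] M))
      ((n - 2 * j : ℝ) • ξ j) fun k => ?_
    simp only [LinearMap.comp_apply, LieModule.toEnd_apply_apply, LinearMap.smul_apply, hw.lie_H,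
      map_smul, hξ, smul_eq_mul]
    split_ifs with h
    · rw [h.1]
    · simp
  · refine fun j => hext (ξ j ∘ₗ (LieModule.toEnd ℝ Sl M (ofCoords cX) : M →ₗ[ℝ] M))
      ((n - j : ℝ) • ξ (j + 1)) fun k => ?_
    simp only [LinearMap.comp_apply, LieModule.toEnd_apply_apply, LinearMap.smul_apply]
    rcases k with _ | k
    · rw [hw.lie_X_zero, hξ, if_neg (by omega)]
      simp
    · rw [hw.lie_X, map_smul, hξ, hξ, smul_eq_mul, smul_eq_mul]
      by_cases h : j = k
      · subst h
        rcases Nat.lt_or_ge j n with h' | h'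
        · rw [if_pos ⟨rfl, h'.le⟩, if_pos ⟨rfl, h'⟩]
        · rcases h'.eq_or_lt with h'' | h''
          · simp [h'']
          · rw [if_neg (by omega), if_neg (by omega)]
      · rw [if_neg (by omega), if_neg (by omega), mul_zero, mul_zero]
  · refine fun j hj => hext (ξ j ∘ₗ (LieModule.toEnd ℝ Sl M (ofCoords cY) : M →ₗ[ℝ] M))
      ((j : ℝ) • ξ (j - 1)) fun k => ?_
    simp only [LinearMap.comp_apply, LieModule.toEnd_apply_apply, LinearMap.smul_apply, hw.lie_Y,
      map_smul, hξ, smul_eq_mul]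
    rcases j with _ | j
    · simp
    · by_cases h : j = k
      · subst h
        rw [if_pos ⟨rfl, hj⟩, if_pos ⟨rfl, by omega⟩]
        push_cast
        ring
      · rw [if_neg (by omega), if_neg (by omega), mul_zero, mul_zero]
  · intro v hv
    refine b.ext_elem_iff.2 fun k => ?_
    have h := hv k
    have e1 : ξ k = b.coord k := dif_pos k.2
    rw [e1, Module.Basis.coord_apply] at h
    rw [h, map_zero, Finsupp.zero_apply]

end Weights

/-! ### The equivariant polynomial function attached to a weight string -/

section Polynomial

/-- The function `v ↦ ∑ v₀ ^ (n - k) v₁ ^ k w k`. -/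
def weightPoly {M : Type*} [AddCommGroup M] [Module ℝ M] (n : ℕ) (w : ℕ → M) (v : Fin 2 → ℝ) : M :=
  ∑ k ∈ Finset.range (n + 1), (v 0 ^ (n - k) * v 1 ^ k) • w k

variable {V : Type*} [NormedAddCommGroup V] [NormedSpace ℝ V] {n : ℕ} {w : ℕ → V}

theorem contDiff_weightPoly (n : ℕ) (w : ℕ → V) :
    ContDiff ℝ ((⊤ : ℕ∞) : WithTop ℕ∞) (weightPoly n w) := by
  unfold weightPoly
  fun_prop

theorem fderiv_weightPoly (n : ℕ) (w : ℕ → V) (v u : Fin 2 → ℝ) : fderiv ℝ (weightPoly n w) v u =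
    ∑ k ∈ Finset.range (n + 1), ((n - k : ℕ) * v 0 ^ (n - k - 1) * v 1 ^ k * u 0 +
      v 0 ^ (n - k) * (k * v 1 ^ (k - 1)) * u 1) • w k := by
  have h0 : HasFDerivAt (fun v : Fin 2 → ℝ => v 0)
      (ContinuousLinearMap.proj (R := ℝ) (φ := fun _ : Fin 2 => ℝ) 0) v := hasFDerivAt_apply 0 v
  have h1 : HasFDerivAt (fun v : Fin 2 → ℝ => v 1)
      (ContinuousLinearMap.proj (R := ℝ) (φ := fun _ : Fin 2 => ℝ) 1) v := hasFDerivAt_apply 1 v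
  have h : HasFDerivAt (weightPoly n w) _ v := HasFDerivAt.fun_sum
    (u := Finset.range (n + 1)) fun k _ => ((h0.pow (n - k)).mul (h1.pow k)).smul_const (w k)
  rw [h.fderiv]
  simp only [FunLike.coe_sum, Finset.sum_apply]
  refine Finset.sum_congr rfl fun k _ => ?_
  simp
  ring_nf

theorem fderiv_weightPoly_self (w : ℕ → V) (v : Fin 2 → ℝ) :
    fderiv ℝ (weightPoly n w) v v = (n : ℝ) • weightPoly n w v := by
  rw [fderiv_weightPoly, weightPoly, Finset.smul_sum]
  refine Finset.sum_congr rfl fun k hk => ?_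
  have hk' : k ≤ n := Nat.lt_succ_iff.1 (Finset.mem_range.1 hk)
  rw [smul_smul]
  congr 1
  have e1 : ((n - k : ℕ) : ℝ) * v 0 ^ (n - k - 1) * v 0 = (n - k : ℝ) * v 0 ^ (n - k) := by
    rw [← Nat.cast_sub hk']
    rcases n - k with _ | d
    · simp
    · rw [Nat.add_sub_cancel, pow_succ]
      ring
  have e2 : (k : ℝ) * v 1 ^ (k - 1) * v 1 = k * v 1 ^ k := by
    rcases k with _ | d
    · simp
    · rw [Nat.add_sub_cancel, pow_succ]
      ring
  linear_combination v 1 ^ k * e1 + v 0 ^ (n - k) * e2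

variable [LieRingModule Sl V] [LieModule ℝ Sl V]

theorem IsWeightString.fderiv_weightPoly_stdAct (hw : IsWeightString n w) (z : Fin 3 → ℝ)
    (v : Fin 2 → ℝ) :
    fderiv ℝ (weightPoly n w) v (stdAct z v) = ⁅ofCoords z, weightPoly n w v⁆ := by
  have eX : ∑ k ∈ Finset.range (n + 1), ((n - k : ℕ) * v 0 ^ (n - k - 1) * v 1 ^ (k + 1)) • w k =
      ∑ k ∈ Finset.range (n + 1), (v 0 ^ (n - k) * v 1 ^ k) • ⁅ofCoords cX, w k⁆ := by
    rw [Finset.sum_range_succ, Finset.sum_range_succ', hw.lie_X_zero, smul_zero, Nat.sub_self]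
    simp only [Nat.cast_zero, zero_mul, zero_smul]
    congr 1
    refine Finset.sum_congr rfl fun k hk => ?_
    rw [hw.lie_X, smul_smul, Nat.sub_sub, Nat.cast_sub (Finset.mem_range.1 hk).le]
    congr 1
    ring
  have eY : ∑ k ∈ Finset.range (n + 1), (v 0 ^ (n - k) * v 0 * (k * v 1 ^ (k - 1))) • w k =
      ∑ k ∈ Finset.range (n + 1), (v 0 ^ (n - k) * v 1 ^ k) • ⁅ofCoords cY, w k⁆ := by
    rw [Finset.sum_range_succ', Finset.sum_range_succ, hw.lie_Y n,
      hw.eq_zero_of_lt (n + 1) (Nat.lt_succ_self n), smul_zero, smul_zero]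
    simp only [Nat.cast_zero, zero_mul, mul_zero, zero_smul]
    congr 1
    refine Finset.sum_congr rfl fun k hk => ?_
    rw [hw.lie_Y, smul_smul, ← pow_succ, Nat.add_sub_cancel]
    have : n - (k + 1) + 1 = n - k := by
      have := Finset.mem_range.1 hk
      omega
    rw [this]
    congr 1
    push_cast
    ring
  have eH : ∑ k ∈ Finset.range (n + 1), ((n - 2 * k : ℝ) * (v 0 ^ (n - k) * v 1 ^ k)) • w k =
      ∑ k ∈ Finset.range (n + 1), (v 0 ^ (n - k) * v 1 ^ k) • ⁅ofCoords cH, w k⁆ := by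
    refine Finset.sum_congr rfl fun k _ => ?_
    rw [hw.lie_H, smul_smul, mul_comm]
  have hlie : ∀ Z : Sl, ⁅Z, weightPoly n w v⁆ =
      ∑ k ∈ Finset.range (n + 1), (v 0 ^ (n - k) * v 1 ^ k) • ⁅Z, w k⁆ := by
    intro Z
    rw [weightPoly, lie_sum]
    simp only [lie_smul]
  rw [ofCoords_lie, hlie, hlie, hlie, ← eX, ← eY, ← eH, fderiv_weightPoly, Finset.smul_sum,
    Finset.smul_sum, Finset.smul_sum, ← Finset.sum_add_distrib, ← Finset.sum_add_distrib]
  refine Finset.sum_congr rfl fun k hk => ?_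
  have hk' : k ≤ n := Nat.lt_succ_iff.1 (Finset.mem_range.1 hk)
  rw [smul_smul, smul_smul, smul_smul, ← add_smul, ← add_smul]
  congr 1
  have e1 : ((n - k : ℕ) : ℝ) * v 0 ^ (n - k - 1) * v 0 = (n - k : ℝ) * v 0 ^ (n - k) := by
    rw [← Nat.cast_sub hk']
    rcases n - k with _ | d
    · simp
    · rw [Nat.add_sub_cancel, pow_succ]
      ring
  have e2 : (k : ℝ) * v 1 ^ (k - 1) * v 1 = k * v 1 ^ k := by
    rcases k with _ | d
    · simp
    · rw [Nat.add_sub_cancel, pow_succ]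
      ring
  change _ * (z 0 * v 0 + z 1 * v 1) + _ * (z 2 * v 0 - z 0 * v 1) = _
  linear_combination z 0 * v 1 ^ k * e1 - z 0 * v 0 ^ (n - k) * e2

theorem IsWeightString.isEquivariantSection (hw : IsWeightString n w) {U : Opens (Fin 3 → ℝ)}
    {s : (Fin 3 → ℝ) → V} {ε : (Fin 2 → ℝ) → ℝ}
    (hs : ∀ v, moment v ∈ U → s (moment v) = ε v • weightPoly n w v)
    (hε : ∀ v, moment v ∈ U → ∀ᶠ u in nhds v, ε u = ε v) : IsEquivariantSection U n s := by
  have hev : ∀ v, moment v ∈ U →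
      (fun u => s (moment u)) =ᶠ[nhds v] fun u => ε v • weightPoly n w u := by
    intro v hv
    filter_upwards [hε v hv, contDiff_moment.continuous.continuousAt.preimage_mem_nhds
      (U.isOpen.mem_nhds hv)] with u hu huU
    rw [hs u huU, hu]
  have hfd : ∀ v, moment v ∈ U → ∀ u,
      fderiv ℝ (fun u => s (moment u)) v u = ε v • fderiv ℝ (weightPoly n w) v u := by
    intro v hv u
    rw [(hev v hv).fderiv_eq, fderiv_fun_const_smul
      ((contDiff_weightPoly n w).differentiable (by simp) v)]
    rfl
  refine ⟨fun v hv => ?_, fun v hv z => ?_, fun v hv => ?_⟩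
  · exact ((contDiff_weightPoly n w).const_smul (ε v)).contDiffAt.congr_of_eventuallyEq (hev v hv)
  · rw [hfd v hv, hw.fderiv_weightPoly_stdAct, hs v hv, lie_smul]
  · rw [hfd v hv, fderiv_weightPoly_self, hs v hv, smul_comm]

end Polynomial
end SlTwo
end

noncomputable section
namespace SlTwo

/-! ### The weight strings of the even and odd representations -/

section Strings

/-- The generators of the symmetric algebra of `sl(2, ℝ)`. -/
def symGen (p : Fin 3 → ℝ) : SymmetricAlgebra ℝ Sl := SymmetricAlgebra.ι ℝ Sl (ofCoords p)

theorem lie_symGen (z p : Fin 3 → ℝ) : ⁅ofCoords z, symGen p⁆ = symGen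
    ![z 1 * p 2 - p 1 * z 2, 2 * (z 0 * p 1 - z 1 * p 0), 2 * (z 2 * p 0 - z 0 * p 2)] := by
  have h : ⁅ofCoords z, ofCoords p⁆ = ofCoords
      ![z 1 * p 2 - p 1 * z 2, 2 * (z 0 * p 1 - z 1 * p 0), 2 * (z 2 * p 0 - z 0 * p 2)] := by
    rw [← LinearEquiv.symm_apply_eq, symm_lie_ofCoords]
  rw [symGen, sym_lie_apply, symDer_ι, h]
  rfl

theorem symGen_eq (p : Fin 3 → ℝ) :
    symGen p = p 0 • symGen cH + p 1 • symGen cX + p 2 • symGen cY := by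
  simp only [symGen]
  rw [ofCoords_eq p, map_add, map_add, map_smul, map_smul, map_smul]

theorem lie_sym_mul (Z : Sl) (p q : SymmetricAlgebra ℝ Sl) : ⁅Z, p * q⁆ = p * ⁅Z, q⁆ + q * ⁅Z, p⁆ := by
  simp only [sym_lie_apply, Derivation.leibniz, smul_eq_mul]

theorem lie_sym_one (Z : Sl) : ⁅Z, (1 : SymmetricAlgebra ℝ Sl)⁆ = 0 := by
  rw [sym_lie_apply, Derivation.map_one_eq_zero]

theorem lie_H_H : ⁅ofCoords cH, symGen cH⁆ = 0 := by rw [lie_symGen, symGen_eq]; simp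
theorem lie_H_X : ⁅ofCoords cH, symGen cX⁆ = 2 * symGen cX := by
  rw [lie_symGen, symGen_eq]; simp [ofNat_smul_eq_nsmul]
theorem lie_H_Y : ⁅ofCoords cH, symGen cY⁆ = -(2 * symGen cY) := by
  rw [lie_symGen, symGen_eq]; simp [ofNat_smul_eq_nsmul]
theorem lie_X_H : ⁅ofCoords cX, symGen cH⁆ = -(2 * symGen cX) := by
  rw [lie_symGen, symGen_eq]; simp [ofNat_smul_eq_nsmul]
theorem lie_X_X : ⁅ofCoords cX, symGen cX⁆ = 0 := by rw [lie_symGen, symGen_eq]; simp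
theorem lie_X_Y : ⁅ofCoords cX, symGen cY⁆ = symGen cH := by rw [lie_symGen, symGen_eq]; simp
theorem lie_Y_H : ⁅ofCoords cY, symGen cH⁆ = 2 * symGen cY := by
  rw [lie_symGen, symGen_eq]; simp [ofNat_smul_eq_nsmul]
theorem lie_Y_X : ⁅ofCoords cY, symGen cX⁆ = -symGen cH := by rw [lie_symGen, symGen_eq]; simp
theorem lie_Y_Y : ⁅ofCoords cY, symGen cY⁆ = 0 := by rw [lie_symGen, symGen_eq]; simp

/-- The coefficient of `t ^ k` in `(X - t H - t ^ 2 Y) ^ m`. -/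
def powCoeff : ℕ → ℕ → SymmetricAlgebra ℝ Sl
  | 0, 0 => 1
  | 0, _ + 1 => 0
  | m + 1, 0 => powCoeff m 0 * symGen cX
  | m + 1, 1 => powCoeff m 1 * symGen cX - powCoeff m 0 * symGen cH
  | m + 1, k + 2 => powCoeff m (k + 2) * symGen cX - powCoeff m (k + 1) * symGen cH -
      powCoeff m k * symGen cY

theorem powCoeff_zero_right (m : ℕ) : powCoeff m 0 = symGen cX ^ m := by
  induction m with
  | zero => simp [powCoeff]
  | succ m ih => rw [powCoeff, ih, pow_succ]

theorem powCoeff_eq_zero (m : ℕ) : ∀ k, 2 * m < k → powCoeff m k = 0 := by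
  induction m with
  | zero =>
    rintro (_ | k) hk
    · omega
    · rfl
  | succ m ih =>
    rintro (_ | _ | k) hk
    · omega
    · omega
    · rw [powCoeff, ih (k + 2) (by omega), ih (k + 1) (by omega), ih k (by omega)]
      simp

theorem lie_Y_powCoeff (m : ℕ) : ∀ k,
    ⁅ofCoords cY, powCoeff m k⁆ = ((k : SymmetricAlgebra ℝ Sl) + 1) * powCoeff m (k + 1) := by
  induction m with
  | zero =>
    rintro (_ | k)
    · simp [powCoeff, lie_sym_one]
    · simp [powCoeff]
  | succ m ih =>
    rintro (_ | _ | k)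
    · simp only [powCoeff, lie_sym_mul, ih, lie_Y_X]
      push_cast
      ring
    · simp only [powCoeff, lie_sym_mul, lie_sub, ih, lie_Y_X, lie_Y_H]
      push_cast
      ring
    · simp only [powCoeff, lie_sym_mul, lie_sub, ih, lie_Y_X, lie_Y_H, lie_Y_Y]
      push_cast
      ring

theorem lie_H_powCoeff (m : ℕ) : ∀ k,
    ⁅ofCoords cH, powCoeff m k⁆ = ((2 * m : SymmetricAlgebra ℝ Sl) - 2 * k) * powCoeff m k := by
  induction m with
  | zero =>
    rintro (_ | k)
    · simp [powCoeff, lie_sym_one]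
    · simp [powCoeff]
  | succ m ih =>
    rintro (_ | _ | k)
    · simp only [powCoeff, lie_sym_mul, ih, lie_H_X]
      push_cast
      ring
    · simp only [powCoeff, lie_sym_mul, lie_sub, ih, lie_H_X, lie_H_H]
      push_cast
      ring
    · simp only [powCoeff, lie_sym_mul, lie_sub, ih, lie_H_X, lie_H_H, lie_H_Y]
      push_cast
      ring

theorem lie_X_powCoeff_zero (m : ℕ) : ⁅ofCoords cX, powCoeff m 0⁆ = 0 := by
  induction m with
  | zero => simp [powCoeff, lie_sym_one]
  | succ m ih => simp [powCoeff, lie_sym_mul, ih, lie_X_X]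

theorem lie_X_powCoeff (m : ℕ) : ∀ k,
    ⁅ofCoords cX, powCoeff m (k + 1)⁆ = ((2 * m : SymmetricAlgebra ℝ Sl) - k) * powCoeff m k := by
  induction m with
  | zero =>
    rintro (_ | k)
    · simp [powCoeff]
    · simp [powCoeff]
  | succ m ih =>
    rintro (_ | _ | k)
    · simp only [powCoeff, lie_sym_mul, lie_sub, ih, lie_X_powCoeff_zero, lie_X_X, lie_X_H]
      push_cast
      ring
    · simp only [powCoeff, lie_sym_mul, lie_sub, ih, lie_X_powCoeff_zero, lie_X_X, lie_X_H, lie_X_Y]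
      push_cast
      ring
    · simp only [powCoeff, lie_sym_mul, lie_sub, ih, lie_X_X, lie_X_H, lie_X_Y]
      push_cast
      ring

/-- An algebra homomorphism from the symmetric algebra sending `X` to `1`. -/
def evalX : SymmetricAlgebra ℝ Sl →ₐ[ℝ] ℝ :=
  SymmetricAlgebra.lift ((LinearMap.proj 1 : (Fin 3 → ℝ) →ₗ[ℝ] ℝ) ∘ₗ ofCoords.symm.toLinearMap)

theorem evalX_powCoeff_zero (m : ℕ) : evalX (powCoeff m 0) = 1 := by
  rw [powCoeff_zero_right, map_pow]
  simp [evalX, symGen]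

theorem isWeightString_powCoeff (m : ℕ) : IsWeightString (2 * m) (powCoeff m) where
  lie_H k := by
    have h2 : algebraMap ℝ (SymmetricAlgebra ℝ Sl) 2 = 2 := map_ofNat _ 2
    rw [lie_H_powCoeff, Algebra.smul_def]
    simp [h2]
  lie_X_zero := lie_X_powCoeff_zero m
  lie_X k := by
    have h2 : algebraMap ℝ (SymmetricAlgebra ℝ Sl) 2 = 2 := map_ofNat _ 2
    rw [lie_X_powCoeff, Algebra.smul_def]
    simp [h2]
  lie_Y k := by
    rw [lie_Y_powCoeff, Algebra.smul_def]
    simp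
  eq_zero_of_lt := powCoeff_eq_zero m
  zero_ne h := by simpa [h] using evalX_powCoeff_zero m

/-- `(s² X - s t H - t² Y) ^ m` in terms of its coefficients. -/
theorem sum_powCoeff (m : ℕ) (v : Fin 2 → ℝ) : weightPoly (2 * m) (powCoeff m) v =
    (v 0 ^ 2 • symGen cX - (v 0 * v 1) • symGen cH - v 1 ^ 2 • symGen cY) ^ m := by
  induction m with
  | zero => simp [weightPoly, powCoeff]
  | succ m ih =>
    have e : 2 * (m + 1) = 2 * m + 1 + 1 := by ring
    have hF : weightPoly (2 * m) (powCoeff m) v =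
        ∑ k ∈ Finset.range (2 * m + 1), (v 0 ^ (2 * m - k) * v 1 ^ k) • powCoeff m k := rfl
    have hF1 : (v 0 * v 1) • weightPoly (2 * m) (powCoeff m) v =
        ∑ k ∈ Finset.range (2 * m + 1), (v 0 ^ (2 * m - k) * v 1 ^ (k + 2)) • powCoeff m (k + 1) +
          (v 0 ^ (2 * m + 1) * v 1) • powCoeff m 0 := by
      rw [hF, Finset.sum_range_succ', smul_add, Finset.sum_range_succ,
        powCoeff_eq_zero m (2 * m + 1) (Nat.lt_succ_self _), smul_zero, add_zero, Finset.smul_sum,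
        smul_smul]
      congr 1
      · refine Finset.sum_congr rfl fun k hk => ?_
        have h1 : 2 * m - k = 2 * m - (k + 1) + 1 := by
          have := Finset.mem_range.1 hk
          omega
        rw [smul_smul, h1, pow_succ (v 0)]
        congr 1
        ring
      · congr 1
        rw [Nat.sub_zero]
        ring
    have hF2 : v 0 ^ 2 • weightPoly (2 * m) (powCoeff m) v =
        ∑ k ∈ Finset.range (2 * m + 1), (v 0 ^ (2 * m - k) * v 1 ^ (k + 2)) • powCoeff m (k + 2) +
          (v 0 ^ (2 * m + 1) * v 1) • powCoeff m 1 + v 0 ^ (2 * m + 2) • powCoeff m 0 := by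
      have hz : ∀ k, 2 * m ≤ k → powCoeff m (k + 1) = 0 := fun k hk => powCoeff_eq_zero m _ (by omega)
      have h1 : weightPoly (2 * m) (powCoeff m) v =
          ∑ k ∈ Finset.range (2 * m + 1 + 1 + 1), (v 0 ^ (2 * m - k) * v 1 ^ k) • powCoeff m k := by
        rw [Finset.sum_range_succ, Finset.sum_range_succ, hz _ le_rfl, hz _ (by omega), smul_zero,
          smul_zero, add_zero, add_zero]
        rfl
      rw [h1, Finset.sum_range_succ', Finset.sum_range_succ', smul_add, smul_add, Finset.smul_sum,
        smul_smul, smul_smul]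
      congr 1
      · congr 1
        · refine Finset.sum_congr rfl fun k _ => ?_
          rw [smul_smul]
          rcases Nat.lt_or_ge (k + 1) (2 * m) with hk | hk
          · have h2 : 2 * m - k = 2 * m - (k + 1 + 1) + 2 := by omega
            rw [h2, pow_add]
            congr 1
            ring
          · rw [hz _ hk, smul_zero, smul_zero]
        · rcases m with _ | m
          · rw [hz 0 le_rfl, smul_zero, smul_zero]
          · have h2 : 2 * (m + 1) + 1 = 2 * (m + 1) - (0 + 1) + 2 := by omega
            rw [h2, pow_add]
            congr 1
            ring
      · congr 1
        rw [Nat.sub_zero]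
        ring
    have hF0 : v 1 ^ 2 • weightPoly (2 * m) (powCoeff m) v =
        ∑ k ∈ Finset.range (2 * m + 1), (v 0 ^ (2 * m - k) * v 1 ^ (k + 2)) • powCoeff m k := by
      rw [hF, Finset.smul_sum]
      refine Finset.sum_congr rfl fun k _ => ?_
      rw [smul_smul]
      congr 1
      ring
    have hR : weightPoly (2 * m) (powCoeff m) v *
        (v 0 ^ 2 • symGen cX - (v 0 * v 1) • symGen cH - v 1 ^ 2 • symGen cY) =
        (v 0 ^ 2 • weightPoly (2 * m) (powCoeff m) v) * symGen cX -
        ((v 0 * v 1) • weightPoly (2 * m) (powCoeff m) v) * symGen cH -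
        (v 1 ^ 2 • weightPoly (2 * m) (powCoeff m) v) * symGen cY := by
      simp only [mul_sub, mul_smul_comm, smul_mul_assoc]
    rw [pow_succ, ← ih, e, weightPoly, Finset.sum_range_succ', Finset.sum_range_succ', hR, hF0, hF1,
      hF2]
    simp only [powCoeff, Nat.add_sub_add_right, Nat.sub_zero, zero_add, pow_zero, mul_one, pow_one,
      smul_sub, Finset.sum_sub_distrib, add_mul, Finset.sum_mul, smul_mul_assoc, add_assoc,
      Nat.reduceAdd]
    rw [show 2 * m + 2 - 1 = 2 * m + 1 from rfl]
    module

theorem symPow_moment (m : ℕ) (v : Fin 2 → ℝ) :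
    symPow m (moment v) = ((1 / 2 : ℝ) ^ m) • weightPoly (2 * m) (powCoeff m) v := by
  have h : SymmetricAlgebra.ι ℝ Sl (ofCoords (moment v)) = (1 / 2 : ℝ) •
      (v 0 ^ 2 • symGen cX - (v 0 * v 1) • symGen cH - v 1 ^ 2 • symGen cY) := by
    change symGen (moment v) = _
    rw [symGen_eq]
    simp only [moment, Matrix.cons_val_zero, Matrix.cons_val_one, Matrix.cons_val]
    module
  rw [sum_powCoeff, symPow, h, smul_pow]

theorem powCoeff_zero_eq_symPow (m : ℕ) : powCoeff m 0 = symPow m cX := powCoeff_zero_right m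

theorem std_lie (z : Fin 3 → ℝ) (v : Fin 2 → ℝ) : ⁅ofCoords z, v⁆ = stdAct z v := by
  change (ofCoords z).1 *ᵥ v = _
  rw [coe_ofCoords]
  funext i
  fin_cases i <;> (simp [stdAct, Matrix.mulVec, dotProduct, Fin.sum_univ_two]; try ring)

/-- The vectors `e ⊗ a k + f ⊗ a (k - 1)`, where `a k` are the coefficients `powCoeff m k`. -/
def oddCoeff (m : ℕ) : ℕ → (Fin 2 → ℝ) ⊗[ℝ] SymmetricAlgebra ℝ Sl
  | 0 => ![1, 0] ⊗ₜ powCoeff m 0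
  | k + 1 => ![1, 0] ⊗ₜ powCoeff m (k + 1) + ![0, 1] ⊗ₜ powCoeff m k

theorem std_H_e : ⁅ofCoords cH, (![1, 0] : Fin 2 → ℝ)⁆ = ![1, 0] := by
  rw [std_lie]; funext i; fin_cases i <;> simp [stdAct]
theorem std_H_f : ⁅ofCoords cH, (![0, 1] : Fin 2 → ℝ)⁆ = (-1 : ℝ) • ![0, 1] := by
  rw [std_lie]; funext i; fin_cases i <;> simp [stdAct]
theorem std_X_e : ⁅ofCoords cX, (![1, 0] : Fin 2 → ℝ)⁆ = 0 := by
  rw [std_lie]; funext i; fin_cases i <;> simp [stdAct]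
theorem std_X_f : ⁅ofCoords cX, (![0, 1] : Fin 2 → ℝ)⁆ = ![1, 0] := by
  rw [std_lie]; funext i; fin_cases i <;> simp [stdAct]
theorem std_Y_e : ⁅ofCoords cY, (![1, 0] : Fin 2 → ℝ)⁆ = ![0, 1] := by
  rw [std_lie]; funext i; fin_cases i <;> simp [stdAct]
theorem std_Y_f : ⁅ofCoords cY, (![0, 1] : Fin 2 → ℝ)⁆ = 0 := by
  rw [std_lie]; funext i; fin_cases i <;> simp [stdAct]

theorem isWeightString_oddCoeff (m : ℕ) : IsWeightString (2 * m + 1) (oddCoeff m) where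
  lie_H k := by
    rcases k with _ | k
    · simp only [oddCoeff, TensorProduct.LieModule.lie_tmul_right, std_H_e,
        (isWeightString_powCoeff m).lie_H, TensorProduct.tmul_smul]
      push_cast
      module
    · simp only [oddCoeff, lie_add, TensorProduct.LieModule.lie_tmul_right, std_H_e, std_H_f,
        (isWeightString_powCoeff m).lie_H, TensorProduct.tmul_smul, ← TensorProduct.smul_tmul']
      push_cast
      module
  lie_X_zero := by
    simp only [oddCoeff, TensorProduct.LieModule.lie_tmul_right, std_X_e,
      (isWeightString_powCoeff m).lie_X_zero, TensorProduct.tmul_zero, TensorProduct.zero_tmul,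
      add_zero]
  lie_X k := by
    rcases k with _ | k
    · simp only [oddCoeff, lie_add, TensorProduct.LieModule.lie_tmul_right, std_X_e, std_X_f,
        (isWeightString_powCoeff m).lie_X, (isWeightString_powCoeff m).lie_X_zero,
        TensorProduct.tmul_smul, TensorProduct.tmul_zero, TensorProduct.zero_tmul]
      push_cast
      module
    · simp only [oddCoeff, lie_add, TensorProduct.LieModule.lie_tmul_right, std_X_e, std_X_f,
        (isWeightString_powCoeff m).lie_X, TensorProduct.tmul_smul, TensorProduct.zero_tmul]
      push_cast
      module
  lie_Y k := by
    rcases k with _ | k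
    · simp only [oddCoeff, TensorProduct.LieModule.lie_tmul_right, std_Y_e,
        (isWeightString_powCoeff m).lie_Y, TensorProduct.tmul_smul]
      push_cast
      module
    · simp only [oddCoeff, lie_add, TensorProduct.LieModule.lie_tmul_right, std_Y_e, std_Y_f,
        (isWeightString_powCoeff m).lie_Y, TensorProduct.tmul_smul, TensorProduct.zero_tmul]
      push_cast
      module
  eq_zero_of_lt k hk := by
    rcases k with _ | k
    · omega
    · rw [oddCoeff, powCoeff_eq_zero m _ (by omega), powCoeff_eq_zero m _ (by omega)]
      simp
  zero_ne h := by
    let L : (Fin 2 → ℝ) ⊗[ℝ] SymmetricAlgebra ℝ Sl →ₗ[ℝ] ℝ := TensorProduct.lift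
      ((LinearMap.mul ℝ ℝ).compl₁₂ (LinearMap.proj 0) evalX.toLinearMap)
    have h1 : L (oddCoeff m 0) = 1 := by
      simp [L, oddCoeff, evalX_powCoeff_zero]
    simp [h] at h1

theorem weightPoly_oddCoeff (m : ℕ) (v : Fin 2 → ℝ) : weightPoly (2 * m + 1) (oddCoeff m) v =
    v ⊗ₜ weightPoly (2 * m) (powCoeff m) v := by
  have hv : v = v 0 • ![1, 0] + v 1 • ![0, 1] := by
    funext i
    fin_cases i <;> simp
  have h1 : v 0 • weightPoly (2 * m) (powCoeff m) v =
      ∑ k ∈ Finset.range (2 * m + 1), (v 0 ^ (2 * m - k) * v 1 ^ (k + 1)) • powCoeff m (k + 1) +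
        v 0 ^ (2 * m + 1) • powCoeff m 0 := by
    have hz := powCoeff_eq_zero m (2 * m + 1) (Nat.lt_succ_self _)
    rw [weightPoly, Finset.sum_range_succ', Finset.sum_range_succ, hz, smul_zero, add_zero, smul_add,
      Finset.smul_sum, smul_smul]
    congr 1
    · refine Finset.sum_congr rfl fun k hk => ?_
      have h1 : 2 * m - k = 2 * m - (k + 1) + 1 := by
        have := Finset.mem_range.1 hk
        omega
      rw [smul_smul, h1, pow_succ (v 0)]
      congr 1
      ring
    · congr 1
      rw [Nat.sub_zero]
      ring
  have h2 : v 1 • weightPoly (2 * m) (powCoeff m) v =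
      ∑ k ∈ Finset.range (2 * m + 1), (v 0 ^ (2 * m - k) * v 1 ^ (k + 1)) • powCoeff m k := by
    rw [weightPoly, Finset.smul_sum]
    refine Finset.sum_congr rfl fun k _ => ?_
    rw [smul_smul]
    congr 1
    ring
  conv_rhs => rw [hv]
  rw [TensorProduct.add_tmul, TensorProduct.smul_tmul, TensorProduct.smul_tmul, ← hv, h1, h2,
    weightPoly, Finset.sum_range_succ']
  simp only [oddCoeff, Nat.add_sub_add_right, Nat.sub_zero, pow_zero, mul_one, smul_add,
    Finset.sum_add_distrib, TensorProduct.tmul_add, TensorProduct.tmul_sum, TensorProduct.tmul_smul]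
  abel

end Strings
end SlTwo
end

noncomputable section
namespace SlTwo

/-! ### Chains for a locally nilpotent operator -/

section Chain

variable {E : Type*} [AddCommGroup E] [Module ℝ E] {Q : Module.End ℝ E} {t : ℕ → E} {c : ℕ → ℝ}

theorem pow_chain_eq_zero (h0 : Q (t 0) = 0) (hQ : ∀ k, Q (t (k + 1)) = c k • t k) (N : ℕ) :
    ∀ k < N, (Q ^ N) (t k) = 0 := by
  induction N with
  | zero => intro k hk; omega
  | succ N ih =>
    rintro (_ | k) hk
    · rw [pow_succ, Module.End.mul_apply, h0, map_zero]
    · rw [pow_succ, Module.End.mul_apply, hQ, map_smul, ih k (by omega), smul_zero]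

theorem pow_chain_ne_zero (ht : t 0 ≠ 0) (hQ : ∀ k, Q (t (k + 1)) = c k • t k) (N : ℕ)
    (hc : ∀ k < N, c k ≠ 0) : (Q ^ N) (t N) ≠ 0 := by
  induction N with
  | zero => simpa using ht
  | succ N ih =>
    rw [pow_succ, Module.End.mul_apply, hQ, map_smul]
    exact smul_ne_zero (hc N (Nat.lt_succ_self N)) (ih fun k hk => hc k (by omega))

theorem chain_coeff_eq_zero (ht : t 0 ≠ 0) (h0 : Q (t 0) = 0)
    (hQ : ∀ k, Q (t (k + 1)) = c k • t k) (N : ℕ) (hc : ∀ k, k + 1 < N → c k ≠ 0) (a : ℕ → ℝ)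
    (ha : ∑ k ∈ Finset.range N, a k • t k = 0) : ∀ k < N, a k = 0 := by
  induction N with
  | zero => intro k hk; omega
  | succ N ih =>
    have h1 := congrArg (Q ^ N) ha
    rw [Finset.sum_range_succ, map_add, map_zero, map_sum, Finset.sum_eq_zero, zero_add,
      map_smul] at h1
    · have hN : a N = 0 := (smul_eq_zero.1 h1).resolve_right
        (pow_chain_ne_zero ht hQ N fun k hk => hc k (by omega))
      rw [Finset.sum_range_succ, hN, zero_smul, add_zero] at ha
      intro k hk
      rcases Nat.lt_succ_iff_lt_or_eq.1 hk with h | h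
      · exact ih (fun k hk => hc k (by omega)) ha k h
      · rw [h, hN]
    · intro k hk
      rw [map_smul, pow_chain_eq_zero h0 hQ N k (Finset.mem_range.1 hk), smul_zero]

theorem mem_span_chain {A : Submodule ℝ E} (hA : ∀ x ∈ A, Q x ∈ A) (htA : ∀ k, t k ∈ A)
    (hker : ∀ x ∈ A, Q x = 0 → x ∈ Submodule.span ℝ {t 0})
    (hQ : ∀ k, Q (t (k + 1)) = c k • t k) (N : ℕ) (hc : ∀ k, k + 1 < N → c k ≠ 0) :
    ∀ x ∈ A, (Q ^ N) x = 0 → x ∈ Submodule.span ℝ (t '' Set.Iio N) := by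
  induction N with
  | zero =>
    intro x _ hx
    have : x = 0 := by simpa using hx
    rw [this]
    exact zero_mem _
  | succ N ih =>
    intro x hxA hx
    have h1 : Q x ∈ Submodule.span ℝ (t '' Set.Iio N) :=
      ih (fun k hk => hc k (by omega)) _ (hA x hxA) (by
        rw [← Module.End.mul_apply, ← pow_succ]
        exact hx)
    have h2 : Submodule.span ℝ (t '' Set.Iio N) ≤
        (Submodule.span ℝ (t '' Set.Iio (N + 1))).map Q := by
      rw [Submodule.span_le]
      rintro _ ⟨k, hk, rfl⟩
      have hk' : k < N := hk
      refine ⟨(c k)⁻¹ • t (k + 1), Submodule.smul_mem _ _ (Submodule.subset_span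
        ⟨k + 1, Nat.succ_lt_succ hk', rfl⟩), ?_⟩
      rw [map_smul, hQ, smul_smul, inv_mul_cancel₀ (hc k (by omega)), one_smul]
    obtain ⟨y, hy, hyx⟩ := h2 h1
    have hyA : y ∈ A := by
      refine (Submodule.span_le (p := A)).2 ?_ hy
      rintro _ ⟨k, -, rfl⟩
      exact htA k
    have h3 := hker (x - y) (sub_mem hxA hyA) (by rw [map_sub, hyx, sub_self])
    have h4 : Submodule.span ℝ {t 0} ≤ Submodule.span ℝ (t '' Set.Iio (N + 1)) :=
      Submodule.span_mono (Set.singleton_subset_iff.2 ⟨0, Nat.succ_pos N, rfl⟩)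
    have h5 := add_mem (h4 h3) hy
    rwa [sub_add_cancel] at h5

theorem linearIndependent_chain (ht : t 0 ≠ 0) (h0 : Q (t 0) = 0)
    (hQ : ∀ k, Q (t (k + 1)) = c k • t k) (hc : ∀ k, c k ≠ 0) : LinearIndependent ℝ t := by
  rw [linearIndependent_iff'']
  intro s g hg hsum i
  by_cases hi : i ∈ s
  · obtain ⟨N, hN⟩ := s.exists_nat_subset_range
    refine chain_coeff_eq_zero ht h0 hQ N (fun k _ => hc k) g ?_ i (Finset.mem_range.1 (hN hi))
    rw [← hsum]
    exact (Finset.sum_subset hN fun k _ hk => by rw [hg k hk, zero_smul]).symm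
  · exact hg i hi

theorem linearIndependent_chain_fin (ht : t 0 ≠ 0) (h0 : Q (t 0) = 0)
    (hQ : ∀ k, Q (t (k + 1)) = c k • t k) (N : ℕ) (hc : ∀ k, k + 1 < N → c k ≠ 0) :
    LinearIndependent ℝ fun k : Fin N => t k := by
  rw [Fintype.linearIndependent_iff]
  intro g hg i
  let a : ℕ → ℝ := fun k => if h : k < N then g ⟨k, h⟩ else 0
  have ha : ∀ k : Fin N, a k = g k := fun k => dif_pos k.2
  have h := chain_coeff_eq_zero ht h0 hQ N hc a ?_ i i.2
  · rwa [ha] at h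
  · rw [← Fin.sum_univ_eq_sum_range fun k => a k • t k]
    simpa only [ha] using hg

end Chain

/-! ### The tube around `X` -/

section Tube

variable {𝒱 : Set (Matrix.SpecialLinearGroup (Fin 2) ℝ)} {Δ : Set ℝ}

/-- Coordinates of `Ad(g) X`. -/
def adX (g : Matrix.SpecialLinearGroup (Fin 2) ℝ) : Fin 3 → ℝ :=
  ![-(g.1 0 0 * g.1 1 0), g.1 0 0 ^ 2, -g.1 1 0 ^ 2]

theorem continuous_adX : Continuous adX := by
  have h : ∀ i j, Continuous fun g : Matrix.SpecialLinearGroup (Fin 2) ℝ => g.1 i j :=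
    fun i j => (continuous_apply j).comp ((continuous_apply i).comp continuous_subtype_val)
  refine continuous_pi fun i => ?_
  fin_cases i
  · exact ((h 0 0).mul (h 1 0)).neg
  · exact (h 0 0).pow 2
  · exact ((h 1 0).pow 2).neg

theorem ad_X (g : Matrix.SpecialLinearGroup (Fin 2) ℝ) :
    (g : Matrix (Fin 2) (Fin 2) ℝ) * (ofCoords (cX + (0 : ℝ) • cY)).1 *
      ((g⁻¹ : Matrix.SpecialLinearGroup (Fin 2) ℝ) : Matrix (Fin 2) (Fin 2) ℝ) =
        (ofCoords (adX g)).1 := by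
  rw [Matrix.SpecialLinearGroup.coe_inv, Matrix.adjugate_fin_two, coe_ofCoords, coe_ofCoords,
    Matrix.eta_fin_two (g : Matrix (Fin 2) (Fin 2) ℝ), Matrix.mul_fin_two, Matrix.mul_fin_two]
  ext i j
  fin_cases i <;> fin_cases j <;> simp [adX] <;> ring

theorem adTube_inter_nilCone (hΔ0 : (0 : ℝ) ∈ Δ) : adTube 𝒱 Δ ∩ nilCone = adX '' 𝒱 := by
  ext p
  constructor
  · rintro ⟨⟨g, hg, y, -, hp⟩, hpN⟩
    have hdet := congrArg Matrix.det hp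
    rw [Matrix.det_mul, Matrix.det_mul, g.2, (g⁻¹).2, coe_ofCoords, coe_ofCoords,
      Matrix.det_fin_two_of, Matrix.det_fin_two_of] at hdet
    have hN : p 0 ^ 2 + p 1 * p 2 = 0 := hpN
    have hy : y = 0 := by
      simp at hdet
      linarith
    rw [hy, ad_X] at hp
    exact ⟨g, hg, ofCoords.injective (Subtype.ext hp.symm)⟩
  · rintro ⟨g, hg, rfl⟩
    refine ⟨⟨g, hg, 0, hΔ0, (ad_X g).symm⟩, ?_⟩
    change (-(g.1 0 0 * g.1 1 0)) ^ 2 + g.1 0 0 ^ 2 * -g.1 1 0 ^ 2 = 0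
    ring

theorem adX_sign (g : Matrix.SpecialLinearGroup (Fin 2) ℝ) : 0 < adX g 1 ∨ adX g 2 < 0 := by
  have hdet : g.1 0 0 * g.1 1 1 - g.1 0 1 * g.1 1 0 = 1 := by rw [← Matrix.det_fin_two, g.2]
  by_cases h : g.1 0 0 = 0
  · right
    change -g.1 1 0 ^ 2 < 0
    have : g.1 1 0 ≠ 0 := fun h' => by simp [h, h'] at hdet
    have := sq_pos_of_ne_zero this
    linarith
  · left
    exact sq_pos_of_ne_zero h

theorem adX_one : adX 1 = cX := by
  funext i
  fin_cases i <;> simp [adX, cX]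

end Tube

/-! ### Transport of weight strings and sections -/

section Transport

/-- The span of a weight string, transported along an isomorphism. -/
theorem IsWeightString.span_map {M M' : Type*} [AddCommGroup M] [Module ℝ M] [LieRingModule Sl M]
    [AddCommGroup M'] [Module ℝ M'] [LieRingModule Sl M'] {w : ℕ → M}
    (hspan : Submodule.span ℝ (Set.range w) = ⊤) (e : M ≃ₗ⁅ℝ, Sl⁆ M') :
    Submodule.span ℝ (Set.range fun k => e (w k)) = ⊤ := by
  have h : Set.range (fun k => e (w k)) = e.toLinearEquiv '' Set.range w := by
    rw [← Set.range_comp]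
    rfl
  rw [h, ← LinearEquiv.coe_coe, ← Submodule.map_span, hspan, Submodule.map_top]
  exact LinearEquiv.range _

theorem map_weightPoly {M M' : Type*} [AddCommGroup M] [Module ℝ M] [AddCommGroup M'] [Module ℝ M']
    (L : M →ₗ[ℝ] M') (n : ℕ) (w : ℕ → M) (v : Fin 2 → ℝ) :
    L (weightPoly n w v) = weightPoly n (fun k => L (w k)) v := by
  simp only [weightPoly, map_sum, map_smul]

theorem IsWeightString.weightPoly_mem {M : Type*} [AddCommGroup M] [Module ℝ M]
    [LieRingModule Sl M] {n : ℕ} {w : ℕ → M} (hw : IsWeightString n w) (v : Fin 2 → ℝ) :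
    weightPoly n w v ∈ LieSubmodule.lieSpan ℝ Sl {w 0} :=
  Submodule.sum_mem (LieSubmodule.lieSpan ℝ Sl {w 0}).toSubmodule fun k _ =>
    (LieSubmodule.lieSpan ℝ Sl {w 0}).smul_mem _ (hw.mem_lieSpan k)

theorem sq_add_sq_pos {v : Fin 2 → ℝ} (hv : v ≠ 0) : 0 < v 0 ^ 2 + v 1 ^ 2 := by
  have := (moment_mem_nilConePlus hv).2
  have e : moment v 1 - moment v 2 = (v 0 ^ 2 + v 1 ^ 2) / 2 := by
    simp [moment]
    ring
  linarith

/-- If `moment u = moment v` then `u = ± v`; the sign is a continuous function. -/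
theorem eq_smul_of_moment_eq {u v : Fin 2 → ℝ} (hv : v ≠ 0) (h : moment u = moment v) :
    u = ((u 0 * v 0 + u 1 * v 1) / (v 0 ^ 2 + v 1 ^ 2)) • v ∧
      ((u 0 * v 0 + u 1 * v 1) / (v 0 ^ 2 + v 1 ^ 2)) ^ 2 = 1 := by
  have h0 : -(u 0 * u 1) / 2 = -(v 0 * v 1) / 2 := congrFun h 0
  have h1 : u 0 ^ 2 / 2 = v 0 ^ 2 / 2 := congrFun h 1
  have h2 : -u 1 ^ 2 / 2 = -v 1 ^ 2 / 2 := congrFun h 2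
  have hpos := sq_add_sq_pos hv
  constructor
  · funext i
    fin_cases i
    · simp only [Fin.zero_eta, Pi.smul_apply, smul_eq_mul]
      field_simp
      linear_combination 2 * u 0 * h2 - 2 * u 1 * h0
    · simp only [Fin.mk_one, Pi.smul_apply, smul_eq_mul]
      field_simp
      linear_combination (-2 * u 1) * h1 - 2 * u 0 * h0
  · rw [div_pow, div_eq_one_iff_eq (by positivity)]
    linear_combination 2 * v 0 ^ 2 * h1 - 2 * v 1 ^ 2 * h2 - 4 * v 0 * v 1 * h0

theorem moment_base : moment ![√2, 0] = cX := by
  funext i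
  fin_cases i <;> simp [moment, cX]

theorem coe_sEven_moment (m : ℕ) (v : Fin 2 → ℝ) : (sEven m (moment v) : SymmetricAlgebra ℝ Sl) =
    (1 / 2 : ℝ) ^ m • weightPoly (2 * m) (powCoeff m) v := by
  have h : symPow m (moment v) ∈ evenRep m := by
    rw [symPow_moment, evenRep, ← powCoeff_zero_eq_symPow]
    exact (LieSubmodule.lieSpan ℝ Sl _).smul_mem _ ((isWeightString_powCoeff m).weightPoly_mem v)
  rw [sEven, dif_pos h]
  exact symPow_moment m v

theorem coe_sOdd_moment (m : ℕ) {s₁ : (Fin 3 → ℝ) → (Fin 2 → ℝ)} {v : Fin 2 → ℝ} {c : ℝ}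
    (hc : s₁ (moment v) = c • v) :
    (sOdd m s₁ (moment v) : (Fin 2 → ℝ) ⊗[ℝ] SymmetricAlgebra ℝ Sl) =
      (c * (1 / 2 : ℝ) ^ m) • weightPoly (2 * m + 1) (oddCoeff m) v := by
  have h1 : s₁ (moment v) ⊗ₜ[ℝ] symPow m (moment v) =
      (c * (1 / 2 : ℝ) ^ m) • weightPoly (2 * m + 1) (oddCoeff m) v := by
    rw [hc, symPow_moment, weightPoly_oddCoeff, TensorProduct.tmul_smul,
      ← TensorProduct.smul_tmul', smul_smul, mul_comm]
  have h : s₁ (moment v) ⊗ₜ[ℝ] symPow m (moment v) ∈ oddRep m := by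
    rw [h1, oddRep, ← powCoeff_zero_eq_symPow]
    exact (LieSubmodule.lieSpan ℝ Sl _).smul_mem _ ((isWeightString_oddCoeff m).weightPoly_mem v)
  rw [sOdd, dif_pos h]
  exact h1

/-- The sign `η` with `s₁ (moment v) = η v • v`. -/
def sectionSign (s₁ : (Fin 3 → ℝ) → (Fin 2 → ℝ)) (v : Fin 2 → ℝ) : ℝ :=
  (s₁ (moment v) 0 * v 0 + s₁ (moment v) 1 * v 1) / (v 0 ^ 2 + v 1 ^ 2)

theorem IsMomentSection.eq_sectionSign_smul {U : Opens (Fin 3 → ℝ)}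
    {s₁ : (Fin 3 → ℝ) → (Fin 2 → ℝ)} (hs : IsMomentSection U s₁) {v : Fin 2 → ℝ} (hv : v ≠ 0)
    (hvU : moment v ∈ U) : s₁ (moment v) = sectionSign s₁ v • v ∧ sectionSign s₁ v ^ 2 = 1 :=
  eq_smul_of_moment_eq hv (hs.moment_eq _ ⟨hvU, moment_mem_nilConePlus hv⟩)

theorem IsMomentSection.sectionSign_eventually_eq {U : Opens (Fin 3 → ℝ)}
    {s₁ : (Fin 3 → ℝ) → (Fin 2 → ℝ)} (hs : IsMomentSection U s₁) {v : Fin 2 → ℝ} (hv : v ≠ 0)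
    (hvU : moment v ∈ U) : ∀ᶠ u in nhds v, sectionSign s₁ u = sectionSign s₁ v := by
  have hne : ∀ᶠ u in nhds v, u ≠ 0 := isOpen_ne.mem_nhds hv
  have hmom : ContinuousAt moment v := contDiff_moment.continuous.continuousAt
  have hUev : ∀ᶠ u in nhds v, moment u ∈ U := hmom.preimage_mem_nhds (U.isOpen.mem_nhds hvU)
  have hs₁ : ContinuousAt (fun u => s₁ (moment u)) v := by
    refine (hs.continuousOn _ ⟨hvU, moment_mem_nilConePlus hv⟩).tendsto.comp
      (tendsto_nhdsWithin_iff.2 ⟨hmom, ?_⟩)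
    filter_upwards [hne, hUev] with u hu huU
    exact ⟨huU, moment_mem_nilConePlus hu⟩
  have hcont : ContinuousAt (sectionSign s₁) v := by
    have h : ∀ i, ContinuousAt (fun u => s₁ (moment u) i) v := fun i =>
      (continuous_apply i).continuousAt.comp hs₁
    have h' : ∀ i, ContinuousAt (fun u : Fin 2 → ℝ => u i) v := fun i =>
      (continuous_apply i).continuousAt
    exact (((h 0).mul (h' 0)).add ((h 1).mul (h' 1))).div (((h' 0).pow 2).add ((h' 1).pow 2))
      (sq_add_sq_pos hv).ne'
  filter_upwards [hne, hUev, hcont.eventually (Metric.ball_mem_nhds _ one_pos)] with u hu huU hdist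
  have h1 := (hs.eq_sectionSign_smul hv hvU).2
  have h2 := (hs.eq_sectionSign_smul hu huU).2
  rw [Real.dist_eq, abs_lt] at hdist
  rcases mul_self_eq_one_iff.1 ((sq _).symm.trans h1) with h | h <;>
    rcases mul_self_eq_one_iff.1 ((sq _).symm.trans h2) with h' | h' <;> linarith

end Transport

/-! ### Bases of the space of invariants -/

section Main

variable {U : Opens (Fin 3 → ℝ)} {V : Type*} [NormedAddCommGroup V] [NormedSpace ℝ V]
  [LieRingModule Sl V] [LieModule ℝ Sl V]

theorem mem_invariantsOnCone_iff (T : 𝓓'(U, V)) :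
    T ∈ invariantsOnCone U V ↔ (T : 𝓓(U, ℝ) →L[ℝ] V).toLinearMap ∈ algInv U V := by
  constructor
  · rintro ⟨h1, h2⟩
    exact ⟨fun Z f => add_neg_eq_zero.1 (h1 Z f), h2⟩
  · rintro ⟨h1, h2⟩
    exact ⟨fun Z f => add_neg_eq_zero.2 (h1 Z f), h2⟩

variable (U V) in
/-- The inclusion of the continuous invariants into the linear ones. -/
def toAlg : invariantsOnCone U V →ₗ[ℝ] (𝓓(U, ℝ) →ₗ[ℝ] V) where
  toFun T := (T.1 : 𝓓(U, ℝ) →L[ℝ] V).toLinearMap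
  map_add' _ _ := rfl
  map_smul' _ _ := rfl

theorem toAlg_injective : Function.Injective (toAlg U V) := by
  intro S T h
  refine Subtype.ext (DFunLike.ext _ _ fun f => ?_)
  exact LinearMap.congr_fun h f

theorem exists_basis_of_toAlg {κ : Type*} (j : κ → ℕ) {T₀ : 𝓓'(U, V)}
    (hT₀ : (T₀ : 𝓓(U, ℝ) →L[ℝ] V).toLinearMap ∈ algInv U V)
    (hli : LinearIndependent ℝ fun k => (boxEnd ^ j k) (T₀ : 𝓓(U, ℝ) →L[ℝ] V).toLinearMap)
    (hspan : ∀ T ∈ invariantsOnCone U V, (T : 𝓓(U, ℝ) →L[ℝ] V).toLinearMap ∈ Submodule.span ℝ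
      (Set.range fun k => (boxEnd ^ j k) (T₀ : 𝓓(U, ℝ) →L[ℝ] V).toLinearMap)) :
    ∃ b : Module.Basis κ ℝ (invariantsOnCone U V), ∀ k, (b k : 𝓓'(U, V)) = casimir^[j k] T₀ := by
  have hmem : ∀ k, casimir^[j k] T₀ ∈ invariantsOnCone U V := fun k => by
    rw [mem_invariantsOnCone_iff, iterate_casimir_toLinearMap]
    exact boxEnd_pow_mem hT₀ _
  let v : κ → invariantsOnCone U V := fun k => ⟨_, hmem k⟩
  have hv : toAlg U V ∘ v = fun k => (boxEnd ^ j k) (T₀ : 𝓓(U, ℝ) →L[ℝ] V).toLinearMap := by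
    funext k
    exact iterate_casimir_toLinearMap T₀ (j k)
  have hli' : LinearIndependent ℝ v := LinearIndependent.of_comp (toAlg U V) (by rwa [hv])
  have hsp : ⊤ ≤ Submodule.span ℝ (Set.range v) := by
    rintro T -
    have h := hspan T.1 T.2
    rw [← hv, Set.range_comp, ← Submodule.map_span] at h
    obtain ⟨S, hS, hST⟩ := h
    have : S = T := toAlg_injective hST
    rwa [this] at hS
  exact ⟨Module.Basis.mk hli' hsp, fun k => by rw [Module.Basis.mk_apply]⟩

theorem exists_basis {n : ℕ} {w : ℕ → V} (hw : IsWeightString n w)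
    (hspan : Submodule.span ℝ (Set.range w) = ⊤)
    (hconn : IsPreconnected ((U : Set (Fin 3 → ℝ)) ∩ nilCone))
    (hsign : ∀ p ∈ (U : Set (Fin 3 → ℝ)) ∩ nilCone, 0 < p 1 ∨ p 2 < 0) (hX : cX ∈ U)
    {s : (Fin 3 → ℝ) → V} {ε : (Fin 2 → ℝ) → ℝ}
    (hs : ∀ v, moment v ∈ U → s (moment v) = ε v • weightPoly n w v)
    (hε : ∀ v, moment v ∈ U → ∀ᶠ u in nhds v, ε u = ε v) (hε0 : ε ![√2, 0] ≠ 0) :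
    (Even n → ∃ b : Module.Basis ℕ ℝ (invariantsOnCone U V),
      ∀ k, (b k : 𝓓'(U, V)) = casimir^[k] (mulDiracPlus U s)) ∧
    ∀ m, n = 2 * m + 1 → ∃ b : Module.Basis (Fin (m + 1)) ℝ (invariantsOnCone U V),
      ∀ k : Fin (m + 1), (b k : 𝓓'(U, V)) = casimir^[(k : ℕ)] (mulDiracPlus U s) := by
  obtain ⟨hfd, ξ, hH, hXr, hY, hlt, hsep, hξw⟩ := hw.exists_coords hspan
  have hξ : IsWeightSystem n ξ := ⟨hH, hXr, hY, hlt, hsep⟩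
  have hsec := hw.isEquivariantSection hs hε
  have hXN : cX ∈ (U : Set (Fin 3 → ℝ)) ∩ nilCone := ⟨hX, by simp [nilCone]⟩
  have hXpos : 0 < cX 1 := by simp
  set T₀ : 𝓓(U, ℝ) →ₗ[ℝ] V := (mulDiracPlus U s : 𝓓(U, ℝ) →L[ℝ] V).toLinearMap with hT₀
  have hmem : T₀ ∈ algInv U V := mulDiracPlus_mem_algInv hsec
  have hne : T₀ ≠ 0 := by
    refine mulDiracPlus_ne_zero hsec hX ⟨hXN.2, by simp⟩ (ξ 0) ?_
    rw [← moment_base, hs _ (by rwa [moment_base]), map_smul, smul_eq_mul]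
    refine mul_ne_zero hε0 ?_
    rw [weightPoly, map_sum, Finset.sum_eq_single 0]
    · simp [hξw]
    · intro k _ hk
      simp [hk]
    · simp
  have h0 : mulQ T₀ = 0 := mulQ_mulDiracPlus hsec
  have hQ : ∀ k : ℕ, mulQ ((boxEnd ^ (k + 1)) T₀) =
      ((k + 1) * (2 * k + 1 - n) : ℝ) • (boxEnd ^ k) T₀ :=
    mulQ_boxEnd_pow (fun f => mulDiracPlus_eulerOp hsec f) h0
  have hker : ∀ T ∈ algInv U V, mulQ T = 0 → T ∈ Submodule.span ℝ {(boxEnd ^ 0) T₀} := by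
    obtain ⟨χ, hχ⟩ := hξ.exists_determining hconn hsign hXN hXpos
    intro T hT hTq
    have hχ0 : ξ 0 (T₀ χ) ≠ 0 := fun h => hne (hχ T₀ hmem h0 h)
    have h1 := hχ (T - (ξ 0 (T χ) / ξ 0 (T₀ χ)) • T₀) (sub_mem hT (Submodule.smul_mem _ _ hmem))
      (by rw [map_sub, map_smul, hTq, h0, smul_zero, sub_zero]) (by
        simp only [LinearMap.sub_apply, LinearMap.smul_apply, map_sub, map_smul, smul_eq_mul]
        field_simp
        ring)
    rw [pow_zero, Module.End.one_apply]
    exact Submodule.mem_span_singleton.2 ⟨_, (sub_eq_zero.1 h1).symm⟩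
  have hspanN := fun N hc => mem_span_chain (t := fun k => (boxEnd ^ k) T₀)
    (fun T hT => mulQ_mem hT) (fun k => boxEnd_pow_mem hmem k) hker hQ N hc
  refine ⟨fun hn => ?_, fun m hm => ?_⟩
  · have hc : ∀ k : ℕ, ((k + 1) * (2 * k + 1 - n) : ℝ) ≠ 0 := by
      intro k
      obtain ⟨m, rfl⟩ := hn
      refine mul_ne_zero (by positivity) ?_
      rw [sub_ne_zero]
      exact_mod_cast (by omega : 2 * k + 1 ≠ m + m)
    refine exists_basis_of_toAlg (fun k : ℕ => k) hmem
      (linearIndependent_chain (t := fun k => (boxEnd ^ k) T₀) hne h0 hQ hc) fun T hT => ?_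
    rw [mem_invariantsOnCone_iff] at hT
    obtain ⟨M, hM⟩ := hξ.exists_mulQ_pow_eq_zero hconn hsign hXN T hT
    exact Submodule.span_mono (Set.image_subset_range _ _) (hspanN M (fun k _ => hc k) _ hT hM)
  · have hc : ∀ k : ℕ, k + 1 < m + 1 → ((k + 1) * (2 * k + 1 - n) : ℝ) ≠ 0 := by
      intro k hk
      refine mul_ne_zero (by positivity) ?_
      rw [sub_ne_zero]
      exact_mod_cast (by omega : 2 * k + 1 ≠ n)
    refine exists_basis_of_toAlg (fun k : Fin (m + 1) => (k : ℕ)) hmem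
      (linearIndependent_chain_fin (t := fun k => (boxEnd ^ k) T₀) hne h0 hQ _ hc) fun T hT => ?_
    rw [mem_invariantsOnCone_iff] at hT
    have h1 := hspanN (m + 1) hc _ hT
      (hξ.mulQ_pow_eq_zero_of_odd hm hconn hsign hXN hXpos hT)
    refine Submodule.span_mono ?_ h1
    rintro _ ⟨k, hk, rfl⟩
    exact ⟨⟨k, hk⟩, rfl⟩

/-- The basis theorem for a module identified with the submodule generated by the highest weight
vector of a weight string. -/
theorem exists_basis_of_equiv {M : Type*} [AddCommGroup M] [Module ℝ M] [LieRingModule Sl M]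
    [LieModule ℝ Sl M] {n : ℕ} {w : ℕ → M} (hw : IsWeightString n w) {N : LieSubmodule ℝ Sl M}
    (hN : N = LieSubmodule.lieSpan ℝ Sl {w 0}) (e : V ≃ₗ⁅ℝ, Sl⁆ N)
    (hconn : IsPreconnected ((U : Set (Fin 3 → ℝ)) ∩ nilCone))
    (hsign : ∀ p ∈ (U : Set (Fin 3 → ℝ)) ∩ nilCone, 0 < p 1 ∨ p 2 < 0) (hX : cX ∈ U)
    {s : (Fin 3 → ℝ) → N} {ε : (Fin 2 → ℝ) → ℝ}
    (hs : ∀ v, moment v ∈ U → (s (moment v) : M) = ε v • weightPoly n w v)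
    (hε : ∀ v, moment v ∈ U → ∀ᶠ u in nhds v, ε u = ε v) (hε0 : ε ![√2, 0] ≠ 0) :
    (Even n → ∃ b : Module.Basis ℕ ℝ (invariantsOnCone U V),
      ∀ k, (b k : 𝓓'(U, V)) = casimir^[k] (mulDiracPlus U fun p => e.symm (s p))) ∧
    ∀ m, n = 2 * m + 1 → ∃ b : Module.Basis (Fin (m + 1)) ℝ (invariantsOnCone U V),
      ∀ k : Fin (m + 1), (b k : 𝓓'(U, V)) =
        casimir^[(k : ℕ)] (mulDiracPlus U fun p => e.symm (s p)) := by
  subst hN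
  refine exists_basis (hw.lieSpan.map e.symm)
    (IsWeightString.span_map hw.span_lieSpan e.symm) hconn hsign hX (fun v hv => ?_) hε hε0
  have h : s (moment v) = ε v • weightPoly n
      (fun k => (⟨w k, hw.mem_lieSpan k⟩ : LieSubmodule.lieSpan ℝ Sl {w 0})) v := by
    refine Subtype.ext ((hs v hv).trans ?_)
    exact congrArg (ε v • ·) (map_weightPoly
      (LieSubmodule.lieSpan ℝ Sl {w 0}).toSubmodule.subtype n
      (fun k => ⟨w k, hw.mem_lieSpan k⟩) v).symm
  rw [h, map_smul]
  exact congrArg (ε v • ·) (map_weightPoly e.symm.toLinearEquiv.toLinearMap n _ v)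

end Main
end SlTwo
end

theorem mainTheorem2
    (𝒱 : Set (Matrix.SpecialLinearGroup (Fin 2) ℝ)) (h𝒱 : IsOpen 𝒱) (h𝒱c : IsConnected 𝒱)
    (h𝒱1 : 1 ∈ 𝒱)
    (Δ : Set ℝ) (hΔ : IsOpen Δ) (hΔi : Δ.OrdConnected) (hΔ0 : (0 : ℝ) ∈ Δ)
    (U : Opens (Fin 3 → ℝ)) (hU : (U : Set (Fin 3 → ℝ)) = SlTwo.adTube 𝒱 Δ)
    (n : ℕ) (V : Type*) [NormedAddCommGroup V] [NormedSpace ℝ V]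
    [LieRingModule SlTwo.Sl V] [LieModule ℝ SlTwo.Sl V] :
    (Even n → ∀ e : V ≃ₗ⁅ℝ, SlTwo.Sl⁆ SlTwo.evenRep (n / 2),
      ¬ FiniteDimensional ℝ (SlTwo.invariantsOnCone U V) ∧
      ∃ b : Module.Basis ℕ ℝ (SlTwo.invariantsOnCone U V), ∀ k : ℕ,
        (b k : 𝓓'(U, V)) =
          SlTwo.casimir^[k] (SlTwo.mulDiracPlus U fun p => e.symm (SlTwo.sEven (n / 2) p))) ∧
    (Odd n → ∀ e : V ≃ₗ⁅ℝ, SlTwo.Sl⁆ SlTwo.oddRep ((n - 1) / 2),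
      ∀ s₁ : (Fin 3 → ℝ) → (Fin 2 → ℝ), SlTwo.IsMomentSection U s₁ →
      Module.finrank ℝ (SlTwo.invariantsOnCone U V) = (n + 1) / 2 ∧
      ∃ b : Module.Basis (Fin ((n - 1) / 2 + 1)) ℝ (SlTwo.invariantsOnCone U V),
        ∀ k : Fin ((n - 1) / 2 + 1),
          (b k : 𝓓'(U, V)) =
            SlTwo.casimir^[(k : ℕ)]
              (SlTwo.mulDiracPlus U fun p => e.symm (SlTwo.sOdd ((n - 1) / 2) s₁ p))) := by
  have hcone : (U : Set (Fin 3 → ℝ)) ∩ SlTwo.nilCone = SlTwo.adX '' 𝒱 := by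
    rw [hU, SlTwo.adTube_inter_nilCone hΔ0]
  have hconn : IsPreconnected ((U : Set (Fin 3 → ℝ)) ∩ SlTwo.nilCone) := by
    rw [hcone]
    exact h𝒱c.isPreconnected.image _ SlTwo.continuous_adX.continuousOn
  have hsign : ∀ p ∈ (U : Set (Fin 3 → ℝ)) ∩ SlTwo.nilCone, 0 < p 1 ∨ p 2 < 0 := by
    rw [hcone]
    rintro _ ⟨g, -, rfl⟩
    exact SlTwo.adX_sign g
  have hX : SlTwo.cX ∈ U := by
    have h : SlTwo.cX ∈ (U : Set (Fin 3 → ℝ)) ∩ SlTwo.nilCone := by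
      rw [hcone]
      exact ⟨1, h𝒱1, SlTwo.adX_one⟩
    exact h.1
  have hne : ∀ v, SlTwo.moment v ∈ U → v ≠ 0 := by
    rintro _ hv rfl
    have h := hsign _ ⟨hv, SlTwo.moment_mem_nilCone 0⟩
    simp [SlTwo.moment] at h
  refine ⟨fun hn e => ?_, fun hn e s₁ hs₁ => ?_⟩
  · obtain ⟨b, hb⟩ := (SlTwo.exists_basis_of_equiv (SlTwo.isWeightString_powCoeff (n / 2))
      (by rw [SlTwo.evenRep, SlTwo.powCoeff_zero_eq_symPow]) e hconn hsign hX
      (s := SlTwo.sEven (n / 2)) (ε := fun _ => (1 / 2 : ℝ) ^ (n / 2))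
      (fun v _ => SlTwo.coe_sEven_moment _ v) (fun _ _ => Filter.Eventually.of_forall fun _ => rfl)
      (by positivity)).1 (even_two_mul _)
    refine ⟨fun hfin => ?_, b, hb⟩
    have : Finite ℕ := Module.Finite.finite_basis b
    exact not_finite ℕ
  · have hXm : SlTwo.moment ![√2, 0] ∈ U := by rwa [SlTwo.moment_base]
    obtain ⟨b, hb⟩ := (SlTwo.exists_basis_of_equiv (SlTwo.isWeightString_oddCoeff ((n - 1) / 2))
      (by rw [SlTwo.oddRep, ← SlTwo.powCoeff_zero_eq_symPow]; rfl) e hconn hsign hX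
      (s := SlTwo.sOdd ((n - 1) / 2) s₁)
      (ε := fun v => SlTwo.sectionSign s₁ v * (1 / 2 : ℝ) ^ ((n - 1) / 2))
      (fun v hv => SlTwo.coe_sOdd_moment _ (hs₁.eq_sectionSign_smul (hne v hv) hv).1)
      (fun v hv => (hs₁.sectionSign_eventually_eq (hne v hv) hv).mono fun u hu => by rw [hu])
      (mul_ne_zero (fun h => by simpa [h] using (hs₁.eq_sectionSign_smul (hne _ hXm) hXm).2)
        (by positivity))).2 _ rfl
    refine ⟨?_, b, hb⟩
    rw [Module.finrank_eq_card_basis b, Fintype.card_fin]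
    obtain ⟨m, rfl⟩ := hn
    omega
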